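/- Let $\Sigma$ be a compact Riemann surface with (possibly empty) boundary $\partial\Sigma$, and let $(E,L)\to(\Sigma,\partial\Sigma)$ be a bundle pair: $E\to\Sigma$ is a smooth symplectic vector bundle with symplectic form $\omega$, and $L\to\partial\Sigma$ is a smooth Lagrangian subbundle of $E|_{\partial\Sigma}$. Let $J$ be a complex structure on $E$ compatible with $\omega$, let $g(v,w)=\omega(v,Jw)$, and regard $E$ as a complex vector bundle with hermitian inner product $g_{\mathbb C}=g+\sqrt{-1}\,\omega$. Connections on $E$ are smooth and complex linear ($\nabla J=0$); $F_\nabla\in\Omega^2(\Sigma,\mathrm{End}(E))$ denotes the curvature and $\mathrm{tr}$ the complex trace. A connection $\nabla$ is unitary if it is compatible with $g_{\mathbb C}$. A unitary connection is called $L$-orthogonal if its parallel transport along $\partial\Sigma$ preserves $L$. (1) If $\nabla^1,\nabla^2$ are $L$-orthogonal unitary connections on $E$, then $$\int_\Sigma \mathrm{tr}(F_{\nabla^1})=\int_\Sigma \mathrm{tr}(F_{\nabla^2}).$$ (2) More generally, the Chern--Weil Maslov index $$\mu_{CW}(E,L)=\frac{\sqrt{-1}}{\pi}\int_\Sigma \mathrm{tr}(F_\nabla)$$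 takes the same value for all connections $\nabla$ on $E$ that restrict, on $\partial\Sigma$, to an $L$-orthogonal unitary connection on $(E|_{\partial\Sigma},J)$ (that is, $\nabla$ is compatible with $g_{\mathbb C}$ in the directions tangent to $\partial\Sigma$, and its parallel transport along $\partial\Sigma$ preserves $L$). In this sense $\mu_{CW}(E,L)$, computed with the given $J$, does not depend on the choice of $\nabla$. -/

import Mathlib

open Bundle Set
open scoped Manifold ContDiff Topology

namespace MaslovCW

noncomputable section

set_option linter.unusedSectionVars false

/-! ### Riemann surfaces with boundary -/

/-- The standard complex structure `(x₀, x₁) ↦ (-x₁, x₀)` of `ℝ² = ℂ`, `z = x₀ + i x₁`. -/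
def rot (v : EuclideanSpace ℝ (Fin 2)) : EuclideanSpace ℝ (Fin 2) := !₂[-v 1, v 0]

/-- `M` is a *Riemann surface with boundary*: a smooth surface with boundary, modelled on the closed
half-plane `{Re z ≥ 0} ⊆ ℂ`, all of whose coordinate changes are holomorphic (up to the boundary),
i.e. their differentials commute with multiplication by `i`. -/
class IsRiemannSurface (M : Type*) [TopologicalSpace M]
    [ChartedSpace (EuclideanHalfSpace 2) M] : Prop extends IsManifold (𝓡∂ 2) ∞ M where
  holomorphic : ∀ e ∈ atlas (EuclideanHalfSpace 2) M, ∀ e' ∈ atlas (EuclideanHalfSpace 2) M,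
    ∀ p ∈ ((e.extend (𝓡∂ 2)).symm ≫ e'.extend (𝓡∂ 2)).source,
    ∀ v : EuclideanSpace ℝ (Fin 2),
      fderivWithin ℝ (e'.extend (𝓡∂ 2) ∘ (e.extend (𝓡∂ 2)).symm) (range (𝓡∂ 2)) p (rot v) =
        rot (fderivWithin ℝ (e'.extend (𝓡∂ 2) ∘ (e.extend (𝓡∂ 2)).symm) (range (𝓡∂ 2)) p v)

section Integral

variable {M : Type*} [TopologicalSpace M] [ChartedSpace (EuclideanHalfSpace 2) M]

/-- The tangent space to the boundary, for `x ∈ ∂M`: the tangent vectors at `x` whose component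
normal to the boundary of the half-plane vanishes (`TangentSpace (𝓡∂ 2) x` is `ℝ²`, through the
preferred chart at `x`). -/
def boundaryTangent (x : M) : Set (TangentSpace (𝓡∂ 2) x) :=
  {X | (show EuclideanSpace ℝ (Fin 2) from X) 0 = 0}

/-- The coordinate vector `∂/∂x_k`, of the preferred chart at `c`, at the point of coordinates `p`. -/
def coordVec (c : M) (p : EuclideanSpace ℝ (Fin 2)) (k : Fin 2) :
    TangentSpace (𝓡∂ 2) ((extChartAt (𝓡∂ 2) c).symm p) :=
  mfderivWithin 𝓘(ℝ, EuclideanSpace ℝ (Fin 2)) (𝓡∂ 2) (extChartAt (𝓡∂ 2) c).symm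
    (range (𝓡∂ 2)) p (EuclideanSpace.single k (1 : ℝ) : EuclideanSpace ℝ (Fin 2))

variable [T2Space M] [SigmaCompactSpace M]

/-- A partition of unity subordinate to the charts `(chartAt _ c)_c`. -/
def chartPartition [IsManifold (𝓡∂ 2) ∞ M] : SmoothPartitionOfUnity M (𝓡∂ 2) M univ :=
  (SmoothPartitionOfUnity.exists_isSubordinate_chartAt_source (𝓡∂ 2) M).choose

/-- The integral over an oriented surface (here oriented by its complex structure, so that all
charts are positively oriented) of a complex valued 2-form `α`:
`∫_M α = ∑_c ∫ ρ_c α(∂/∂x₀, ∂/∂x₁) dx₀ dx₁`. -/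
def surfaceIntegral [IsRiemannSurface M]
    (α : Π x : M, TangentSpace (𝓡∂ 2) x → TangentSpace (𝓡∂ 2) x → ℂ) : ℂ :=
  ∑ᶠ c : M, ∫ p in (extChartAt (𝓡∂ 2) c).target,
    (chartPartition (M := M) c ((extChartAt (𝓡∂ 2) c).symm p) : ℂ) *
      α ((extChartAt (𝓡∂ 2) c).symm p) (coordVec c p 0) (coordVec c p 1)

end Integral

/-- The complex trace of a complex linear endomorphism `T` of a real vector space with complex
structure `J`, expressed through real traces. -/
def complexTrace {W : Type*} [AddCommGroup W] [Module ℝ W] (J T : W →ₗ[ℝ] W) : ℂ :=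
  ((LinearMap.trace ℝ W T : ℂ) - Complex.I * (LinearMap.trace ℝ W (J ∘ₗ T) : ℂ)) / 2

/-- `complexTrace` is the usual trace over `ℂ`. -/
theorem complexTrace_restrictScalars {W : Type*} [AddCommGroup W] [Module ℝ W] [Module ℂ W]
    [IsScalarTower ℝ ℂ W] [FiniteDimensional ℂ W] (J : W →ₗ[ℝ] W)
    (hJ : ∀ w, J w = Complex.I • w) (T : W →ₗ[ℂ] W) :
    complexTrace J (T.restrictScalars ℝ) = LinearMap.trace ℂ W T := by
  have key : ∀ S : W →ₗ[ℂ] W, LinearMap.trace ℝ W (S.restrictScalars ℝ) =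
      2 * (LinearMap.trace ℂ W S).re := by
    intro S
    let b := Module.finBasis ℂ W
    rw [LinearMap.trace_eq_matrix_trace ℝ (Complex.basisOneI.smulTower b),
      LinearMap.trace_eq_matrix_trace ℂ b, Matrix.trace, Matrix.trace, Fintype.sum_prod_type,
      Fin.sum_univ_two, ← Finset.sum_add_distrib, Complex.re_sum, Finset.mul_sum]
    refine Finset.sum_congr rfl fun i _ ↦ ?_
    simp [LinearMap.toMatrix_apply, Module.Basis.smulTower_repr]
    ring
  have hJT : J ∘ₗ T.restrictScalars ℝ = (Complex.I • T).restrictScalars ℝ := by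
    ext w
    simp [hJ]
  rw [complexTrace, hJT, key, key]
  apply Complex.ext <;> simp

/-! ### Connections -/

section Connection

variable {M : Type*} [TopologicalSpace M] [ChartedSpace (EuclideanHalfSpace 2) M]
  [IsManifold (𝓡∂ 2) ∞ M]
  {F : Type*} [NormedAddCommGroup F] [NormedSpace ℝ F]
  {V : M → Type*} [TopologicalSpace (TotalSpace F V)]
  [∀ x, AddCommGroup (V x)] [∀ x, Module ℝ (V x)] [∀ x, TopologicalSpace (V x)]
  [∀ x, IsTopologicalAddGroup (V x)] [∀ x, ContinuousSMul ℝ (V x)]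
  [FiberBundle F V] [VectorBundle ℝ F V] [ContMDiffVectorBundle ∞ F V (𝓡∂ 2)]

/-- `∇_X ∇_Y σ - ∇_Y ∇_X σ - ∇_[X,Y] σ` at the point `x`. -/
def curvatureAux (cov : CovariantDerivative (𝓡∂ 2) F V) (X Y : Π x : M, TangentSpace (𝓡∂ 2) x)
    (σ : Π x : M, V x) (x : M) : V x :=
  cov (fun y ↦ cov σ y (Y y)) x (X x) - cov (fun y ↦ cov σ y (X y)) x (Y x)
    - cov σ x (VectorField.mlieBracket (𝓡∂ 2) X Y x)

variable [T2Space M] [FiniteDimensional ℝ F]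

theorem exists_smooth_extend (x : M) (σ₀ : V x) :
    ∃ σ : Π x, V x, ContMDiff (𝓡∂ 2) ((𝓡∂ 2).prod 𝓘(ℝ, F)) ∞ (T% σ) ∧
      ∀ᶠ y in 𝓝 x, σ y = FiberBundle.extend F σ₀ y := by
  obtain ⟨s, hs, hσ⟩ := FiberBundle.exists_contMDiffOn_extend (k := ∞) (𝓡∂ 2) F σ₀
  obtain ⟨u, hus, hu, hxu⟩ := mem_nhds_iff.mp hs
  obtain ⟨f, -, hf⟩ := (SmoothBumpFunction.nhds_basis_tsupport (I := 𝓡∂ 2) x).mem_iff.mp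
    (hu.mem_nhds hxu)
  refine ⟨(f : M → ℝ) • FiberBundle.extend F σ₀,
    ContMDiffOn.smul_section_of_tsupport f.contMDiff.contMDiffOn hu hf (hσ.mono hus), ?_⟩
  filter_upwards [f.eventuallyEq_one] with y hy
  simp [hy]

theorem extend_mdifferentiable_nhds (x : M) (σ₀ : V x) :
    ∀ᶠ y in 𝓝 x, MDifferentiableAt (𝓡∂ 2) ((𝓡∂ 2).prod 𝓘(ℝ, F))
      (T% (FiberBundle.extend F σ₀)) y := by
  obtain ⟨σ, hσ, heq⟩ := exists_smooth_extend (F := F) x σ₀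
  filter_upwards [heq.eventually_nhds] with y hy
  have : MDifferentiableAt (𝓡∂ 2) ((𝓡∂ 2).prod 𝓘(ℝ, F)) (T% σ) y :=
    (hσ y).mdifferentiableAt (by simp)
  exact this.congr_of_eventuallyEq (hy.mono fun z hz ↦ by simp [hz])

theorem mdifferentiableAt_cov_extend (cov : CovariantDerivative (𝓡∂ 2) F V)
    (hcov : CovariantDerivative.ContMDiffCovariantDerivative cov ∞) {x : M} (σ₀ : V x)
    {Y : Π x : M, TangentSpace (𝓡∂ 2) x}
    (hY : MDifferentiableAt (𝓡∂ 2) ((𝓡∂ 2).prod 𝓘(ℝ, EuclideanSpace ℝ (Fin 2))) (T% Y) x) :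
    MDifferentiableAt (𝓡∂ 2) ((𝓡∂ 2).prod 𝓘(ℝ, F))
      (T% (fun y ↦ cov (FiberBundle.extend F σ₀) y (Y y))) x := by
  obtain ⟨σ, hσ, heq⟩ := exists_smooth_extend (F := F) x σ₀
  have h1 := (hcov.contMDiff.contMDiff (σ := σ) (by simpa using hσ.contMDiffOn)).contMDiffAt
    (x := x) Filter.univ_mem
  have h2 := (h1.mdifferentiableAt (by simp)).clm_bundle_apply hY
  refine h2.congr_of_eventuallyEq ?_
  filter_upwards [heq.eventually_nhds, extend_mdifferentiable_nhds (F := F) x σ₀] with y hy h'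
  have : MDifferentiableAt (𝓡∂ 2) ((𝓡∂ 2).prod 𝓘(ℝ, F)) (T% σ) y :=
    (hσ y).mdifferentiableAt (by simp)
  simp [cov.isCovariantDerivativeOn.congr_of_eventuallyEq this h' Filter.univ_mem hy]

theorem extend_smul_add (x : M) (a : ℝ) (σ₀ τ₀ : V x) :
    ∀ᶠ y in 𝓝 x, FiberBundle.extend F (a • σ₀ + τ₀) y =
      (a • FiberBundle.extend F σ₀ + FiberBundle.extend F τ₀) y := by
  have hx := FiberBundle.mem_baseSet_trivializationAt' (F := F) (E := V) x
  have h := ((trivializationAt F V x).linear ℝ hx)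
  filter_upwards [(trivializationAt F V x).open_baseSet.mem_nhds hx] with y hy
  simp only [FiberBundle.extend, Pi.add_apply, Pi.smul_apply, h.map_add, h.map_smul,
    ← Trivialization.symmₗ_apply (R := ℝ) _ hy, map_add, map_smul]

theorem cov_smul_add (cov : CovariantDerivative (𝓡∂ 2) F V)
    {x : M} (a : ℝ) {σ τ : Π x : M, V x}
    (hσ : MDifferentiableAt (𝓡∂ 2) ((𝓡∂ 2).prod 𝓘(ℝ, F)) (T% σ) x)
    (hτ : MDifferentiableAt (𝓡∂ 2) ((𝓡∂ 2).prod 𝓘(ℝ, F)) (T% τ) x) :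
    cov (a • σ + τ) x = a • cov σ x + cov τ x := by
  rw [cov.isCovariantDerivativeOnUniv.add (hσ.smul_const_section) hτ,
    cov.isCovariantDerivativeOnUniv.smul_const a hσ]

theorem cov_cov_extend_smul_add (cov : CovariantDerivative (𝓡∂ 2) F V)
    (hcov : CovariantDerivative.ContMDiffCovariantDerivative cov ∞) {x : M} (a : ℝ) (σ₀ τ₀ : V x)
    {Y : Π x : M, TangentSpace (𝓡∂ 2) x}
    (hY : MDifferentiableAt (𝓡∂ 2) ((𝓡∂ 2).prod 𝓘(ℝ, EuclideanSpace ℝ (Fin 2))) (T% Y) x) :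
    cov (fun y ↦ cov (FiberBundle.extend F (a • σ₀ + τ₀)) y (Y y)) x =
      a • cov (fun y ↦ cov (FiberBundle.extend F σ₀) y (Y y)) x +
        cov (fun y ↦ cov (FiberBundle.extend F τ₀) y (Y y)) x := by
  have h1 := mdifferentiableAt_cov_extend cov hcov σ₀ hY
  have h2 := mdifferentiableAt_cov_extend cov hcov τ₀ hY
  have h3 := mdifferentiableAt_cov_extend cov hcov (a • σ₀ + τ₀) hY
  rw [← cov_smul_add cov a h1 h2]
  refine cov.isCovariantDerivativeOnUniv.congr_of_eventuallyEq h3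
    (mdifferentiableAt_add_section h1.smul_const_section h2) Filter.univ_mem ?_
  filter_upwards [extend_mdifferentiable_nhds (F := F) x σ₀,
    extend_mdifferentiable_nhds (F := F) x τ₀, extend_mdifferentiable_nhds (F := F) x (a • σ₀ + τ₀),
    (extend_smul_add (F := F) x a σ₀ τ₀).eventually_nhds] with y hy hy' hy'' he
  rw [cov.isCovariantDerivativeOnUniv.congr_of_eventuallyEq hy''
    (mdifferentiableAt_add_section hy.smul_const_section hy') Filter.univ_mem he,
    cov_smul_add cov a hy hy']
  simp

variable (F V) in
/-- A smooth connection `∇` on the vector bundle `V`; `cov σ x X` is `(∇_X σ)(x)`. -/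
structure SmoothConnection where
  cov : CovariantDerivative (𝓡∂ 2) F V
  smooth : CovariantDerivative.ContMDiffCovariantDerivative cov ∞

theorem SmoothConnection.curvatureAux_smul_add (D : SmoothConnection F V) (x : M)
    (X₀ Y₀ : TangentSpace (𝓡∂ 2) x) (a : ℝ) (σ₀ τ₀ : V x) :
    curvatureAux D.cov (FiberBundle.extend (EuclideanSpace ℝ (Fin 2)) X₀)
        (FiberBundle.extend (EuclideanSpace ℝ (Fin 2)) Y₀)
        (FiberBundle.extend F (a • σ₀ + τ₀)) x =
      a • curvatureAux D.cov (FiberBundle.extend (EuclideanSpace ℝ (Fin 2)) X₀)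
        (FiberBundle.extend (EuclideanSpace ℝ (Fin 2)) Y₀) (FiberBundle.extend F σ₀) x +
      curvatureAux D.cov (FiberBundle.extend (EuclideanSpace ℝ (Fin 2)) X₀)
        (FiberBundle.extend (EuclideanSpace ℝ (Fin 2)) Y₀) (FiberBundle.extend F τ₀) x := by
  have hext (Z : TangentSpace (𝓡∂ 2) x) := FiberBundle.mdifferentiableAt_extend (𝓡∂ 2)
    (EuclideanSpace ℝ (Fin 2)) (V := fun y : M ↦ TangentSpace (𝓡∂ 2) y) Z
  have hσ := FiberBundle.mdifferentiableAt_extend (𝓡∂ 2) F σ₀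
  have hτ := FiberBundle.mdifferentiableAt_extend (𝓡∂ 2) F τ₀
  unfold curvatureAux
  rw [cov_cov_extend_smul_add D.cov D.smooth a σ₀ τ₀ (hext X₀),
    cov_cov_extend_smul_add D.cov D.smooth a σ₀ τ₀ (hext Y₀),
    D.cov.isCovariantDerivativeOnUniv.congr_of_eventuallyEq
      (FiberBundle.mdifferentiableAt_extend (𝓡∂ 2) F (a • σ₀ + τ₀))
      (mdifferentiableAt_add_section hσ.smul_const_section hτ) Filter.univ_mem
      (extend_smul_add (F := F) x a σ₀ τ₀),
    cov_smul_add D.cov a hσ hτ]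
  simp only [add_apply, smul_apply]
  module

/-- The curvature `F_∇(X₀, Y₀) ∈ End (V x)`,
`F_∇(X, Y) σ = ∇_X ∇_Y σ - ∇_Y ∇_X σ - ∇_[X,Y] σ`,
where tangent vectors and elements of `V x` are extended to smooth local fields and sections
(being tensorial, the result does not depend on the extensions). -/
def SmoothConnection.curvature (D : SmoothConnection F V) (x : M) (X₀ Y₀ : TangentSpace (𝓡∂ 2) x) :
    V x →ₗ[ℝ] V x where
  toFun σ₀ := curvatureAux D.cov (FiberBundle.extend (EuclideanSpace ℝ (Fin 2)) X₀)
    (FiberBundle.extend (EuclideanSpace ℝ (Fin 2)) Y₀) (FiberBundle.extend F σ₀) x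
  map_add' σ₀ τ₀ := by simpa using D.curvatureAux_smul_add x X₀ Y₀ 1 σ₀ τ₀
  map_smul' a σ₀ := by
    have h0 := D.curvatureAux_smul_add x X₀ Y₀ 1 0 0
    have h := D.curvatureAux_smul_add x X₀ Y₀ a σ₀ 0
    simp only [smul_zero, add_zero, one_smul, left_eq_add] at h0
    simpa [h0] using h

/-- The section `s` along the curve `γ : [a, b] → M` is parallel for `∇`. If `c` denotes `s` in the
local trivialization of `V` at `γ t`, then `(∇_{γ'} s)(t)` is the sum of `c'(t)` and of `∇_{γ'(t)}`
of the local section that is constant, equal to `c(t)`, in this trivialization. -/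
def SmoothConnection.IsParallelAlong (D : SmoothConnection F V) (γ : ℝ → M) (a b : ℝ)
    (s : Π t : ℝ, V (γ t)) : Prop :=
  ∀ t ∈ Icc a b, ∃ c' : F,
    HasDerivWithinAt (fun u ↦ (trivializationAt F V (γ t) ⟨γ u, s u⟩).2) c' (Icc a b) t ∧
    (trivializationAt F V (γ t)).symm (γ t) c' +
      D.cov (FiberBundle.extend F (s t)) (γ t)
        (mfderivWithin 𝓘(ℝ, ℝ) (𝓡∂ 2) γ (Icc a b) t (1 : ℝ)) = 0

/-- Parallel transport along smooth curves contained in `∂M` maps the subspaces `L` into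
themselves. -/
def SmoothConnection.PreservesAlongBoundary (D : SmoothConnection F V)
    (L : Π x : M, Submodule ℝ (V x)) : Prop :=
  ∀ (γ : ℝ → M) (a b : ℝ), a < b → ContMDiffOn 𝓘(ℝ, ℝ) (𝓡∂ 2) ∞ γ (Icc a b) →
    (∀ t ∈ Icc a b, γ t ∈ (𝓡∂ 2).boundary M) →
    ∀ s : Π t : ℝ, V (γ t), D.IsParallelAlong γ a b s → s a ∈ L (γ a) → s b ∈ L (γ b)

/-! ### Bundle pairs -/

variable (F V) in
/-- A *bundle pair* `(E, L) → (M, ∂M)`: a symplectic form on the smooth real vector bundle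
`E = V`, and a smooth Lagrangian subbundle `L` of `V` over `∂M`. (Only the values of `L` at points
of `∂M` are meaningful.) -/
structure BundlePair where
  form : Π x : M, V x →L[ℝ] V x →L[ℝ] ℝ
  form_smooth : ContMDiff (𝓡∂ 2) ((𝓡∂ 2).prod 𝓘(ℝ, F →L[ℝ] F →L[ℝ] ℝ)) ∞
    (fun x ↦ TotalSpace.mk' (F →L[ℝ] F →L[ℝ] ℝ) x (form x))
  form_alternating : ∀ x v, form x v v = 0
  form_nondegenerate : ∀ x v, (∀ w, form x v w = 0) → v = 0
  L : Π x : M, Submodule ℝ (V x)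
  L_smooth : ∀ x ∈ (𝓡∂ 2).boundary M, ∃ U ∈ 𝓝 x, ∃ (n : ℕ) (e : Fin n → Π y : M, V y),
    (∀ i, ContMDiffOn (𝓡∂ 2) ((𝓡∂ 2).prod 𝓘(ℝ, F)) ∞ (T% (e i)) U) ∧
    ∀ y ∈ U ∩ (𝓡∂ 2).boundary M, LinearIndependent ℝ (fun i ↦ e i y) ∧
      Submodule.span ℝ (range fun i ↦ e i y) = L y
  L_lagrangian : ∀ x ∈ (𝓡∂ 2).boundary M, ∀ v, v ∈ L x ↔ ∀ w ∈ L x, form x v w = 0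

/-- A complex structure `J` on `V` compatible with the symplectic form. -/
structure CompatibleComplexStructure (P : BundlePair F V) where
  J : Π x : M, V x →L[ℝ] V x
  J_smooth : ContMDiff (𝓡∂ 2) ((𝓡∂ 2).prod 𝓘(ℝ, F →L[ℝ] F)) ∞
    (fun x ↦ TotalSpace.mk' (F →L[ℝ] F) x (J x))
  J_sq : ∀ x v, J x (J x v) = -v
  invariant : ∀ x v w, P.form x (J x v) (J x w) = P.form x v w
  pos : ∀ x v, v ≠ 0 → 0 < P.form x v (J x v)

variable {P : BundlePair F V}

namespace CompatibleComplexStructure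

/-- The hermitian inner product `g + i ω`, where `g(v, w) = ω(v, J w)`. -/
def hermitian (𝒥 : CompatibleComplexStructure P) (x : M) (v w : V x) : ℂ :=
  (P.form x v (𝒥.J x w) : ℂ) + Complex.I * (P.form x v w : ℂ)

/-- A smooth connection on the complex vector bundle `(V, J)`: `∇ (J σ) = J ∇ σ`. -/
structure Connection (𝒥 : CompatibleComplexStructure P) extends SmoothConnection F V where
  complex_linear : ∀ (σ : Π x : M, V x) (x : M) (X : TangentSpace (𝓡∂ 2) x),
    MDifferentiableAt (𝓡∂ 2) ((𝓡∂ 2).prod 𝓘(ℝ, F)) (T% σ) x →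
      cov (fun y ↦ 𝒥.J y (σ y)) x X = 𝒥.J x (cov σ x X)

variable {𝒥 : CompatibleComplexStructure P}

namespace Connection

/-- `∇` is compatible with the hermitian metric in the direction of the tangent vector `X`:
`X ⟨σ, τ⟩ = ⟨∇_X σ, τ⟩ + ⟨σ, ∇_X τ⟩`. -/
def IsUnitaryInDirection (D : 𝒥.Connection) (x : M) (X : TangentSpace (𝓡∂ 2) x) : Prop :=
  ∀ σ τ : Π x : M, V x,
    MDifferentiableAt (𝓡∂ 2) ((𝓡∂ 2).prod 𝓘(ℝ, F)) (T% σ) x →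
    MDifferentiableAt (𝓡∂ 2) ((𝓡∂ 2).prod 𝓘(ℝ, F)) (T% τ) x →
    mvfderiv (𝓡∂ 2) (fun y ↦ 𝒥.hermitian y (σ y) (τ y)) x X =
      𝒥.hermitian x (D.cov σ x X) (τ x) + 𝒥.hermitian x (σ x) (D.cov τ x X)

/-- `∇` is an `L`-orthogonal unitary connection on `V → M`. -/
def IsLOrthogonalUnitary (D : 𝒥.Connection) : Prop :=
  (∀ x X, D.IsUnitaryInDirection x X) ∧ D.PreservesAlongBoundary P.L

/-- `∇` restricts, on `∂M`, to an `L`-orthogonal unitary connection on `V|_{∂M}`. -/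
def RestrictsToLOrthogonalUnitary (D : 𝒥.Connection) : Prop :=
  (∀ x ∈ (𝓡∂ 2).boundary M, ∀ X ∈ boundaryTangent x, D.IsUnitaryInDirection x X) ∧
    D.PreservesAlongBoundary P.L

/-- The 2-form `tr F_∇` (trace over `ℂ`). -/
def trCurvature (D : 𝒥.Connection) (x : M) (X Y : TangentSpace (𝓡∂ 2) x) : ℂ :=
  complexTrace (𝒥.J x : V x →ₗ[ℝ] V x) (D.curvature x X Y)

end Connection

end CompatibleComplexStructure

end Connection

end

end MaslovCW

open MeasureTheory

namespace MaslovCW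

noncomputable section

set_option linter.unusedSectionVars false

local notation "ℝ²" => EuclideanSpace ℝ (Fin 2)

/-! ### Stokes' theorem on the half-plane -/

/-! Let `A = ∇¹ - ∇²`, a one-form with values in the complex linear endomorphisms of `E`, and let `β
= tr A` (complex trace, `traceForm`). The argument rests on two facts: `tr F_{∇¹} - tr F_{∇²} = dβ`,
and `β` vanishes on vectors tangent to `∂Σ`. Stokes' theorem then gives the equality of the
integrals.

The first fact (`trCurvature_sub`) is local. In a frame, `∇ = d + Γ` and the curvature is `∂₀Γ₁ -
∂₁Γ₀ + [Γ₀, Γ₁]`. The frames are only real, so the matrix of `J` varies and satisfies `dJ = [J, Γ]`.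
Subtracting this relation for the two connections shows that `A` commutes with `J`. The complex
trace is `(tr S - i tr (J S)) / 2`. Its terms in `dJ`, and those coming from the quadratic part of
the curvature, are traces of commutators because `A` commutes with `J`.

For the second fact (`traceForm_eq_zero_of_boundaryTangent`), let `X` be tangent to the boundary.
Both connections are unitary along `X`, so `A_X` is skew-hermitian and its complex trace is
imaginary. Both parallel transports preserve `L`, so `A_X` maps `L` to itself
(`connectionDifference_mem_lagrangian`). Since `E = L ⊕ J L`, the complex trace is also real, hence
zero.

Stokes' theorem (`surfaceIntegral_eq_zero_of_exact`) has to be proved for the integral defined by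
charts and the partition of unity `ρ_c`. Write `ρ_c dβ = d(ρ_c β) - dρ_c ∧ β`. The exact terms
integrate to zero by the divergence theorem in the half-plane. The others cancel because `∑ dρ_c =
0`, once they are compared in common charts (`integral_chart_eq_integral_chart`). There holomorphy
of the coordinate changes makes the Jacobians nonnegative. Only the boundary behaviour of the
connections enters, so statement (1) is a case of (2). -/

theorem mem_range_halfPlane {p : ℝ²} : p ∈ range (𝓡∂ 2) ↔ 0 ≤ p 0 := by
  rw [range_modelWithCornersEuclideanHalfSpace]; rfl

theorem measurableSet_range_halfPlane : MeasurableSet (range (𝓡∂ 2)) :=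
  (𝓡∂ 2).isClosed_range.measurableSet

/-- The extension by zero of a function on a relatively open subset `T` of the half-plane, with
support in a compact subset `K` of `T`. -/
theorem contDiffOn_indicator_of_support {n : ℕ∞ω} {T K : Set ℝ²}
    (hT : ∀ p ∈ T, T ∈ 𝓝[range (𝓡∂ 2)] p) (hK : IsCompact K) (hKT : K ⊆ T)
    {g : ℝ² → ℂ} (hg : ContDiffOn ℝ n g T) (hgK : ∀ p ∈ T \ K, g p = 0) :
    ContDiffOn ℝ n (T.indicator g) (range (𝓡∂ 2)) := by
  intro p hp
  by_cases hpT : p ∈ T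
  · have h1 : ContDiffWithinAt ℝ n g (range (𝓡∂ 2)) p :=
      (hg p hpT).mono_of_mem_nhdsWithin (hT p hpT)
    refine h1.congr_of_eventuallyEq ?_ (by simp [hpT])
    filter_upwards [hT p hpT] with q hq using by simp [hq]
  · have hpK : p ∉ K := fun h ↦ hpT (hKT h)
    refine (contDiffWithinAt_const (c := (0 : ℂ))).congr_of_eventuallyEq ?_ (by simp [hpT])
    filter_upwards [mem_nhdsWithin_of_mem_nhds (hK.isClosed.isOpen_compl.mem_nhds hpK)] with q hq
    by_cases hqT : q ∈ T
    · simpa [hqT] using hgK q ⟨hqT, hq⟩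
    · simp [hqT]

theorem integrableOn_of_continuousOn_of_support {T K : Set ℝ²} (hT : MeasurableSet T)
    (hK : IsCompact K) (hKT : K ⊆ T) {g : ℝ² → ℂ} (hg : ContinuousOn g T)
    (hgK : ∀ p ∈ T \ K, g p = 0) : IntegrableOn g T :=
  IntegrableOn.of_forall_sdiff_eq_zero ((hg.mono hKT).integrableOn_compact hK) hT hgK

/-- The divergence theorem on a box `[0, S] × [-S, S]` containing the part of `K` in the half-plane.
On three sides the fields vanish because the sides miss `K`. On the side `x₀ = 0` only the normal
component `G₁` of the field contributes, and it vanishes there by `hb`. -/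
theorem integral_curl_halfPlane_eq_zero {G₀ G₁ : ℝ² → ℂ} {K : Set ℝ²} (hK : IsCompact K)
    (h₀ : ContDiffOn ℝ 1 G₀ (range (𝓡∂ 2))) (h₁ : ContDiffOn ℝ 1 G₁ (range (𝓡∂ 2)))
    (h₀K : ∀ p ∉ K, G₀ p = 0) (h₁K : ∀ p ∉ K, G₁ p = 0) (hb : ∀ p, p 0 = 0 → G₁ p = 0) :
    ∫ p in range (𝓡∂ 2),
      (fderivWithin ℝ G₁ (range (𝓡∂ 2)) p (EuclideanSpace.single 0 1) -
        fderivWithin ℝ G₀ (range (𝓡∂ 2)) p (EuclideanSpace.single 1 1)) = 0 := by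
  set H : Set ℝ² := range (𝓡∂ 2) with hH
  set e : ℝ² ≃L[ℝ] (Fin 2 → ℝ) := EuclideanSpace.equiv (Fin 2) ℝ with he
  obtain ⟨R, hR⟩ := hK.isBounded.exists_norm_le
  have hud : UniqueDiffOn ℝ H := (𝓡∂ 2).uniqueDiffOn
  set D : ℝ² → ℂ := fun p ↦ fderivWithin ℝ G₁ H p (EuclideanSpace.single 0 1) -
        fderivWithin ℝ G₀ H p (EuclideanSpace.single 1 1) with hD
  have hDK : ∀ p ∈ H, p ∉ K → D p = 0 := by
    intro p hp hpK
    have aux : ∀ G : ℝ² → ℂ, (∀ p ∉ K, G p = 0) → fderivWithin ℝ G H p = 0 := by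
      intro G hG
      have : G =ᶠ[𝓝[H] p] fun _ ↦ (0 : ℂ) := by
        filter_upwards [mem_nhdsWithin_of_mem_nhds (hK.isClosed.isOpen_compl.mem_nhds hpK)]
          with q hq using hG q hq
      rw [this.fderivWithin_eq (hG p hpK)]
      simp
    simp [hD, aux G₀ h₀K, aux G₁ h₁K]
  -- `R` only bounds the norm on `K`, and may be negative if `K` is empty. This `S` is positive and
  -- strictly larger than `R`, so the outer faces miss `K`.
  set S : ℝ := |R| + 1 with hS
  have hSpos : 0 < S := by positivity
  have hRS : R < S := (le_abs_self R).trans_lt (lt_add_one _)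
  have hout : ∀ p : ℝ², (∃ i, S ≤ |p i|) → p ∉ K := by
    rintro p ⟨i, hi⟩ hp
    have h1 := hR p hp
    have h2 : |p i| ≤ ‖p‖ := by simpa using PiLp.norm_apply_le p i
    linarith
  let a : Fin 2 → ℝ := ![0, -S]
  let b : Fin 2 → ℝ := ![S, S]
  have hab : a ≤ b := by
    intro i; fin_cases i <;> simp [a, b] <;> linarith
  set Q : Set ℝ² := e ⁻¹' Icc a b with hQ
  have hmem : ∀ p : ℝ², p ∈ Q ↔ (0 ≤ p 0 ∧ p 0 ≤ S) ∧ (-S ≤ p 1 ∧ p 1 ≤ S) := by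
    intro p
    simp only [hQ, mem_preimage, mem_Icc, Pi.le_def, Fin.forall_fin_two, a, b, he]
    simp
    tauto
  have hQH : Q ⊆ H := fun p hp ↦ mem_range_halfPlane.2 ((hmem p).1 hp).1.1
  have hmpe : MeasurePreserving e volume volume :=
    EuclideanSpace.volume_preserving_symm_measurableEquiv_toLp (Fin 2)
  have hQm : MeasurableSet Q := e.continuous.measurable measurableSet_Icc
  have hzero : ∀ p ∈ H \ Q, D p = 0 := by
    rintro p ⟨hpH, hpQ⟩
    refine hDK p hpH (hout p ?_)
    by_contra! hcon
    have h0 := abs_lt.1 (hcon 0)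
    have h1 := abs_lt.1 (hcon 1)
    exact hpQ ((hmem p).2 ⟨⟨mem_range_halfPlane.1 hpH, h0.2.le⟩, h1.1.le, h1.2.le⟩)
  rw [setIntegral_eq_of_subset_of_forall_sdiff_eq_zero measurableSet_range_halfPlane hQH hzero]
  have hcD : ContinuousOn D H :=
    ((h₁.continuousOn_fderivWithin hud le_rfl).clm_apply continuousOn_const).sub
      ((h₀.continuousOn_fderivWithin hud le_rfl).clm_apply continuousOn_const)
  have hms : ∀ x ∈ Icc a b, e.symm x ∈ H := fun x hx ↦ hQH (by simpa [hQ] using hx)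
  have hcv : ∫ p in Q, D p = ∫ x in Icc a b, D (e.symm x) := by
    have := hmpe.setIntegral_preimage_emb e.toHomeomorph.measurableEmbedding
      (fun x ↦ D (e.symm x)) (Icc a b)
    simpa using this
  rw [hcv]
  -- The divergence of `(G₁, -G₀)` is the curl of `(G₀, G₁)`.
  let f : Fin 2 → (Fin 2 → ℝ) → ℂ := ![fun x ↦ G₁ (e.symm x), fun x ↦ -G₀ (e.symm x)]
  let f' : Fin 2 → (Fin 2 → ℝ) → (Fin 2 → ℝ) →L[ℝ] ℂ :=
    ![fun x ↦ (fderivWithin ℝ G₁ H (e.symm x)).comp (e.symm : (Fin 2 → ℝ) →L[ℝ] ℝ²),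
      fun x ↦ -(fderivWithin ℝ G₀ H (e.symm x)).comp (e.symm : (Fin 2 → ℝ) →L[ℝ] ℝ²)]
  have hsum : ∀ x, ∑ i, f' i x (Pi.single i 1) = D (e.symm x) := by
    intro x
    simp [Fin.sum_univ_two, f', hD, sub_eq_add_neg]
    rfl
  have hc : ContinuousOn (fun x ↦ D (e.symm x)) (Icc a b) :=
    hcD.comp e.symm.continuous.continuousOn hms
  have hdiff : ∀ (G : ℝ² → ℂ), ContDiffOn ℝ 1 G H →
      ∀ x ∈ Set.pi univ fun i ↦ Ioo (a i) (b i), HasFDerivAt (fun x ↦ G (e.symm x))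
        ((fderivWithin ℝ G H (e.symm x)).comp (e.symm : (Fin 2 → ℝ) →L[ℝ] ℝ²)) x := by
    intro G hG x hx
    have h0 : 0 < (e.symm x) 0 := by
      exact (hx 0 (mem_univ _)).1
    have hn : H ∈ 𝓝 (e.symm x) := by
      have ho : IsOpen {p : ℝ² | 0 < p 0} := isOpen_lt continuous_const (by fun_prop)
      exact Filter.mem_of_superset (ho.mem_nhds h0) fun p hp ↦ mem_range_halfPlane.2 (le_of_lt hp)
    have h2 := ((hG.differentiableOn (by simp)) _ (mem_of_mem_nhds hn)).hasFDerivWithinAt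
    exact (h2.hasFDerivAt hn).comp x e.symm.hasFDerivAt
  have key := integral_divergence_of_hasFDerivAt_off_countable' a b hab f f' ∅ countable_empty
    (by
      intro i
      fin_cases i
      · exact h₁.continuousOn.comp e.symm.continuous.continuousOn hms
      · exact (h₀.continuousOn.comp e.symm.continuous.continuousOn hms).neg)
    (by
      intro x hx i
      fin_cases i
      · exact hdiff G₁ h₁ x hx.1
      · exact (hdiff G₀ h₀ x hx.1).neg)
    (by
      simp only [hsum]
      exact hc.integrableOn_compact isCompact_Icc)
  simp only [hsum] at key
  rw [key]
  have hface : ∀ (i : Fin 2) (t : ℝ), (t = a i ∨ t = b i) →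
      ∀ y : Fin 1 → ℝ, f i (i.insertNth t y) = 0 := by
    intro i t ht y
    have hval : (e.symm (i.insertNth t y : Fin 2 → ℝ)) i = t := by simp [he]
    fin_cases i
    · rcases ht with ht | ht
      · exact hb _ (hval.trans ht)
      · refine h₁K _ (hout _ ⟨0, ?_⟩)
        erw [hval, ht]
        exact le_abs_self _
    · have : G₀ (e.symm (Fin.insertNth (1 : Fin 2) t y : Fin 2 → ℝ)) = 0 := by
        refine h₀K _ (hout _ ⟨1, ?_⟩)
        erw [hval]
        rcases ht with ht | ht
        · rw [ht]; simp [a, abs_of_pos hSpos]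
        · rw [ht]; exact le_abs_self _
      simp only [f]
      simpa using this
  refine Finset.sum_eq_zero fun i _ ↦ ?_
  simp only [hface i (b i) (Or.inr rfl), hface i (a i) (Or.inl rfl), integral_zero, sub_zero]

/-- Extension by zero reduces this to the whole half-plane. As `T` is relatively open, derivatives
within the half-plane are unchanged on `T`. -/
theorem integral_curl_eq_zero {T K : Set ℝ²} (hTH : T ⊆ range (𝓡∂ 2)) (hTm : MeasurableSet T)
    (hT : ∀ p ∈ T, T ∈ 𝓝[range (𝓡∂ 2)] p) (hK : IsCompact K) (hKT : K ⊆ T)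
    {g₀ g₁ : ℝ² → ℂ} (h₀ : ContDiffOn ℝ 1 g₀ T) (h₁ : ContDiffOn ℝ 1 g₁ T)
    (h₀K : ∀ p ∈ T \ K, g₀ p = 0) (h₁K : ∀ p ∈ T \ K, g₁ p = 0)
    (hb : ∀ p ∈ T, p 0 = 0 → g₁ p = 0) :
    ∫ p in T, (fderivWithin ℝ g₁ (range (𝓡∂ 2)) p (EuclideanSpace.single 0 1) -
        fderivWithin ℝ g₀ (range (𝓡∂ 2)) p (EuclideanSpace.single 1 1)) = 0 := by
  have hsupp : ∀ g : ℝ² → ℂ, (∀ p ∈ T \ K, g p = 0) → ∀ p ∉ K, T.indicator g p = 0 := by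
    intro g hg p hp
    by_cases hpT : p ∈ T
    · simpa [hpT] using hg p ⟨hpT, hp⟩
    · simp [hpT]
  have hder : ∀ g : ℝ² → ℂ, ∀ p ∈ T, fderivWithin ℝ (T.indicator g) (range (𝓡∂ 2)) p =
      fderivWithin ℝ g (range (𝓡∂ 2)) p := by
    intro g p hp
    refine Filter.EventuallyEq.fderivWithin_eq ?_ (by simp [hp])
    filter_upwards [hT p hp] with q hq using by simp [hq]
  have key := integral_curl_halfPlane_eq_zero hK
    (contDiffOn_indicator_of_support hT hK hKT h₀ h₀K)
    (contDiffOn_indicator_of_support hT hK hKT h₁ h₁K) (hsupp g₀ h₀K) (hsupp g₁ h₁K)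
    (fun p hp ↦ by
      by_cases hpT : p ∈ T
      · simpa [hpT] using hb p hpT hp
      · simp [hpT])
  rw [setIntegral_eq_of_subset_of_forall_sdiff_eq_zero measurableSet_range_halfPlane hTH ?_] at key
  · rw [← key]
    refine setIntegral_congr_fun hTm fun p hp ↦ ?_
    simp only [hder _ p hp]
  · rintro p ⟨hpH, hpT⟩
    have hpK : p ∉ K := fun h ↦ hpT (hKT h)
    have aux : ∀ g : ℝ² → ℂ, (∀ p ∈ T \ K, g p = 0) →
        fderivWithin ℝ (T.indicator g) (range (𝓡∂ 2)) p = 0 := by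
      intro g hg
      have : T.indicator g =ᶠ[𝓝[range (𝓡∂ 2)] p] fun _ ↦ (0 : ℂ) := by
        filter_upwards [mem_nhdsWithin_of_mem_nhds (hK.isClosed.isOpen_compl.mem_nhds hpK)]
          with q hq using hsupp g hg q hq
      rw [this.fderivWithin_eq (hsupp g hg p hpK)]
      simp
    rw [aux g₀ h₀K, aux g₁ h₁K]
    simp

/-! ### Coordinate vector fields -/

section

section ConstSection
variable {M : Type*} [TopologicalSpace M] [ChartedSpace (EuclideanHalfSpace 2) M]
  {F : Type*} [NormedAddCommGroup F] [NormedSpace ℝ F]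
  {V : M → Type*} [TopologicalSpace (TotalSpace F V)]
  [∀ x, AddCommGroup (V x)] [∀ x, Module ℝ (V x)] [∀ x, TopologicalSpace (V x)]
  [FiberBundle F V] [VectorBundle ℝ F V] [ContMDiffVectorBundle ∞ F V (𝓡∂ 2)]

theorem contMDiffOn_trivialization_symm (x₀ : M) (v : F) :
    ContMDiffOn (𝓡∂ 2) ((𝓡∂ 2).prod 𝓘(ℝ, F)) ∞
      (T% (fun y ↦ (trivializationAt F V x₀).symm y v)) (trivializationAt F V x₀).baseSet := by
  intro x hx
  rw [(trivializationAt F V x₀).contMDiffWithinAt_section _ hx]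
  refine (contMDiffWithinAt_const (c := v)).congr (fun y hy ↦ ?_) ?_
  · simp [hy]
  · simp [hx]

end ConstSection

variable {M : Type*} [TopologicalSpace M] [ChartedSpace (EuclideanHalfSpace 2) M]
variable [IsManifold (𝓡∂ 2) ∞ M]

/-- The coordinate vector field `∂/∂x_k` of the preferred chart at `c`. -/
def coordField (c : M) (k : Fin 2) (y : M) : TangentSpace (𝓡∂ 2) y :=
  (trivializationAt ℝ² (TangentSpace (𝓡∂ 2)) c).symm y (EuclideanSpace.single k (1 : ℝ))

theorem coordField_eq_symmL {c y : M} (hy : y ∈ (chartAt (EuclideanHalfSpace 2) c).source)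
    (k : Fin 2) : coordField c k y = (trivializationAt ℝ² (TangentSpace (𝓡∂ 2)) c).symmL ℝ y
      (EuclideanSpace.single k (1 : ℝ)) :=
  ((trivializationAt ℝ² (TangentSpace (𝓡∂ 2)) c).symmL_apply (R := ℝ) (by simpa using hy) _).symm

/-- The tangent trivialization at `c` is the differential of the chart. This replaces vectors
indexed by points of the plane by a vector field on the surface, to which connections and Lie
brackets apply. -/
theorem coordVec_eq_coordField {c : M} {p : ℝ²} (hp : p ∈ (extChartAt (𝓡∂ 2) c).target)
    (k : Fin 2) : coordVec c p k = coordField c k ((extChartAt (𝓡∂ 2) c).symm p) := by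
  have hy : (extChartAt (𝓡∂ 2) c).symm p ∈ (chartAt (EuclideanHalfSpace 2) c).source := by
    simpa using (extChartAt (𝓡∂ 2) c).map_target hp
  rw [coordField_eq_symmL hy, TangentBundle.symmL_trivializationAt hy, coordVec,
    (extChartAt (𝓡∂ 2) c).right_inv hp]
  rfl

theorem contMDiffOn_coordField (c : M) (k : Fin 2) :
    ContMDiffOn (𝓡∂ 2) ((𝓡∂ 2).prod 𝓘(ℝ, ℝ²)) ∞ (T% (coordField c k))
      (extChartAt (𝓡∂ 2) c).source := by
  have := contMDiffOn_trivialization_symm (F := ℝ²) (V := fun y : M ↦ TangentSpace (𝓡∂ 2) y) c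
    (EuclideanSpace.single k (1 : ℝ))
  rwa [TangentBundle.trivializationAt_baseSet, ← extChartAt_source (I := 𝓡∂ 2)] at this

theorem coordField_eq_mfderivWithin {c y : M} (hy : y ∈ (extChartAt (𝓡∂ 2) c).source) (k : Fin 2) :
    coordField c k y = mfderivWithin 𝓘(ℝ, ℝ²) (𝓡∂ 2) (extChartAt (𝓡∂ 2) c).symm (range (𝓡∂ 2))
      (extChartAt (𝓡∂ 2) c y) (EuclideanSpace.single k (1 : ℝ) : ℝ²) := by
  rw [extChartAt_source] at hy
  rw [coordField_eq_symmL hy, TangentBundle.symmL_trivializationAt hy]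
  rfl

theorem mfderiv_extChartAt_coordField {c y : M} (hy : y ∈ (extChartAt (𝓡∂ 2) c).source) (k : Fin 2) :
    mfderiv (𝓡∂ 2) 𝓘(ℝ, ℝ²) (extChartAt (𝓡∂ 2) c) y (coordField c k y) =
      (EuclideanSpace.single k (1:ℝ) : ℝ²) := by
  have hy' := hy
  rw [extChartAt_source] at hy'
  rw [coordField_eq_symmL hy', ← TangentBundle.continuousLinearMapAt_trivializationAt hy']
  exact (trivializationAt ℝ² (TangentSpace (𝓡∂ 2)) c).continuousLinearMapAt_symmL (by simpa using hy') _

/-- The constant vector field on the plane. -/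
def constField (v p : ℝ²) : TangentSpace 𝓘(ℝ, ℝ²) p := v

theorem mlieBracket_constField (v w : ℝ²) :
    VectorField.mlieBracket 𝓘(ℝ, ℝ²) (constField v) (constField w) = 0 := by
  have h : VectorField.lieBracketWithin ℝ (fun _ : ℝ² ↦ v) (fun _ ↦ w) univ = 0 := by
    funext z
    simp [VectorField.lieBracketWithin]
  rw [← VectorField.mlieBracketWithin_univ, VectorField.mlieBracketWithin_eq_lieBracketWithin]
  exact h

theorem mdifferentiable_constField (v p : ℝ²) :
    MDifferentiableAt 𝓘(ℝ, ℝ²) (𝓘(ℝ, ℝ²).prod 𝓘(ℝ, ℝ²)) (T% (constField v)) p := by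
  have h : ContMDiffAt 𝓘(ℝ, ℝ²) (𝓘(ℝ, ℝ²).prod 𝓘(ℝ, ℝ²)) 1 (T% (constField v)) p :=
    contMDiffAt_vectorSpace_iff_contDiffAt.2 (contDiffAt_const (c := v))
  exact h.mdifferentiableAt (by simp)

theorem mpullback_constField {c y : M} (hy : y ∈ (extChartAt (𝓡∂ 2) c).source) (k : Fin 2) :
    VectorField.mpullback (𝓡∂ 2) 𝓘(ℝ, ℝ²) (extChartAt (𝓡∂ 2) c)
      (constField (EuclideanSpace.single k (1 : ℝ))) y = coordField c k y := by
  have h1 := mfderiv_extChartAt_coordField hy k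
  obtain ⟨e, he⟩ := isInvertible_mfderiv_extChartAt (I := 𝓡∂ 2) hy
  rw [VectorField.mpullback_apply, ← he, ContinuousLinearMap.inverse_equiv]
  rw [← he] at h1
  exact (e.symm_apply_eq).2 h1.symm

/-- Coordinate fields are pullbacks of constant fields by the chart, and pullback commutes with the
Lie bracket. -/
theorem mlieBracket_coordField {c y : M} (hy : y ∈ (extChartAt (𝓡∂ 2) c).source) (k l : Fin 2) :
    VectorField.mlieBracket (𝓡∂ 2) (coordField c k) (coordField c l) y = 0 := by
  have hev : ∀ j, coordField c j =ᶠ[𝓝 y] VectorField.mpullback (𝓡∂ 2) 𝓘(ℝ, ℝ²)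
      (extChartAt (𝓡∂ 2) c) (constField (EuclideanSpace.single j (1 : ℝ))) := by
    intro j
    filter_upwards [(isOpen_extChartAt_source (I := 𝓡∂ 2) c).mem_nhds hy] with z hz
    exact (mpullback_constField hz j).symm
  have h2 : IsManifold (𝓡∂ 2) (minSmoothness ℝ 2) M := by simp; infer_instance
  have h3 : IsManifold 𝓘(ℝ, ℝ²) (minSmoothness ℝ 2) ℝ² := inferInstance
  rw [(hev k).mlieBracket_vectorField_eq (hev l),
    ← VectorField.mpullback_mlieBracket (n := ∞) (mdifferentiable_constField _ _)
      (mdifferentiable_constField _ _) (contMDiffAt_extChartAt' (by simpa using hy))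
      (by simpa using ENat.LEInfty.out), mlieBracket_constField]
  simp

/-- The chain rule, turning intrinsic derivatives into partial derivatives in the chart.
Differentiating within the half-plane makes it valid at boundary points too. -/
theorem mvfderiv_coordField {G : Type*} [NormedAddCommGroup G] [NormedSpace ℝ G]
    {c y : M} (hy : y ∈ (extChartAt (𝓡∂ 2) c).source) (k : Fin 2)
    {f : M → G} (hf : MDifferentiableAt (𝓡∂ 2) 𝓘(ℝ, G) f y) :
    mvfderiv (𝓡∂ 2) f y (coordField c k y) =
      fderivWithin ℝ (f ∘ (extChartAt (𝓡∂ 2) c).symm) (range (𝓡∂ 2)) (extChartAt (𝓡∂ 2) c y)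
        (EuclideanSpace.single k (1 : ℝ)) := by
  have hp := (extChartAt (𝓡∂ 2) c).map_source hy
  have h1 : MDifferentiableWithinAt 𝓘(ℝ, ℝ²) (𝓡∂ 2) (extChartAt (𝓡∂ 2) c).symm (range (𝓡∂ 2))
      (extChartAt (𝓡∂ 2) c y) := mdifferentiableWithinAt_extChartAt_symm hp
  have hinv := (extChartAt (𝓡∂ 2) c).left_inv hy
  have h2 := mfderiv_comp_mfderivWithin_of_eq (I := 𝓘(ℝ, ℝ²)) (I' := 𝓡∂ 2) (I'' := 𝓘(ℝ, G))
    hf h1 ((𝓡∂ 2).uniqueMDiffOn _ (extChartAt_target_subset_range c hp)) hinv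
  rw [← mfderivWithin_eq_fderivWithin, h2, coordField_eq_mfderivWithin hy]
  rfl

end

/-! ### Change of chart for integrals of 2-forms -/

section

variable {M : Type*} [TopologicalSpace M] [ChartedSpace (EuclideanHalfSpace 2) M]

/-- The Cauchy-Riemann equations. The determinant is a sum of two squares, which is how the complex
structure orients the surface. -/
theorem det_eq_of_commute_rot (T : ℝ² →L[ℝ] ℝ²) (hT : ∀ v, T (rot v) = rot (T v)) :
    T.det = T (EuclideanSpace.single 0 1) 0 ^ 2 + T (EuclideanSpace.single 0 1) 1 ^ 2 ∧
    T (EuclideanSpace.single 1 1) = rot (T (EuclideanSpace.single 0 1)) := by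
  have h1 : T (EuclideanSpace.single 1 1) = rot (T (EuclideanSpace.single 0 1)) := by
    rw [← hT]
    congr 1
    ext i; fin_cases i <;> simp [rot]
  refine ⟨?_, h1⟩
  have : T.det = LinearMap.det (T : ℝ² →ₗ[ℝ] ℝ²) := rfl
  rw [this, ← LinearMap.det_toMatrix (EuclideanSpace.basisFun (Fin 2) ℝ).toBasis,
    Matrix.det_fin_two]
  simp [LinearMap.toMatrix_apply, h1, rot]
  ring

theorem measurableSet_extChartAt_target (c : M) :
    MeasurableSet (extChartAt (𝓡∂ 2) c).target := by
  rw [extChartAt_target]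
  exact (((chartAt (EuclideanHalfSpace 2) c).open_target.preimage
    (𝓡∂ 2).continuous_symm).measurableSet).inter measurableSet_range_halfPlane

theorem measurableSet_extCoordChange_source (c c' : M) :
    MeasurableSet ((extChartAt (𝓡∂ 2) c).symm ≫ extChartAt (𝓡∂ 2) c').source := by
  obtain ⟨u, hu, h⟩ := continuousOn_iff'.1 (continuousOn_extChartAt_symm (I := 𝓡∂ 2) c) _
    (isOpen_extChartAt_source (I := 𝓡∂ 2) c')
  have : ((extChartAt (𝓡∂ 2) c).symm ≫ extChartAt (𝓡∂ 2) c').source =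
      u ∩ (extChartAt (𝓡∂ 2) c).target := by
    rw [← h, PartialEquiv.trans_source, PartialEquiv.symm_source, inter_comm]
  rw [this]
  exact hu.measurableSet.inter (measurableSet_extChartAt_target c)

theorem coordField_eq_sum [IsManifold (𝓡∂ 2) ∞ M] {c c' y : M}
    (hy : y ∈ (extChartAt (𝓡∂ 2) c).source)
    (hy' : y ∈ (extChartAt (𝓡∂ 2) c').source) (k : Fin 2) :
    coordField c k y = ∑ j, fderivWithin ℝ (extChartAt (𝓡∂ 2) c' ∘ (extChartAt (𝓡∂ 2) c).symm)
      (range (𝓡∂ 2)) (extChartAt (𝓡∂ 2) c y) (EuclideanSpace.single k 1) j • coordField c' j y := by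
  have hs : y ∈ (chartAt (EuclideanHalfSpace 2) c').source := by simpa using hy'
  have hb : y ∈ (trivializationAt ℝ² (TangentSpace (𝓡∂ 2)) c').baseSet := by simpa using hs
  have hf : MDifferentiableAt (𝓡∂ 2) 𝓘(ℝ, ℝ²) (extChartAt (𝓡∂ 2) c') y :=
    mdifferentiableAt_extChartAt hs
  have h1 := mvfderiv_coordField hy k hf
  set w : ℝ² := fderivWithin ℝ (extChartAt (𝓡∂ 2) c' ∘ (extChartAt (𝓡∂ 2) c).symm)
      (range (𝓡∂ 2)) (extChartAt (𝓡∂ 2) c y) (EuclideanSpace.single k 1) with hw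
  have h2 : mvfderiv (𝓡∂ 2) (extChartAt (𝓡∂ 2) c') y (coordField c k y) =
    (trivializationAt ℝ² (TangentSpace (𝓡∂ 2)) c').continuousLinearMapAt ℝ y (coordField c k y) := by
    rw [TangentBundle.continuousLinearMapAt_trivializationAt hs]
    rfl
  have h3 : coordField c k y = (trivializationAt ℝ² (TangentSpace (𝓡∂ 2)) c').symmL ℝ y w := by
    rw [← h1, h2]
    exact ((trivializationAt ℝ² (TangentSpace (𝓡∂ 2)) c').symmL_continuousLinearMapAt hb _).symm
  have h4 : w = ∑ j, w j • EuclideanSpace.single j (1 : ℝ) := by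
    ext i; fin_cases i <;> simp [Fin.sum_univ_two]
  rw [h3]
  conv_lhs => rw [h4]
  rw [map_sum]
  refine Finset.sum_congr rfl fun j _ ↦ ?_
  rw [map_smul, coordField_eq_symmL hs]

/-- The support condition reduces both integrals to the overlap of the charts. There, pulling back
by the coordinate change multiplies the 2-form by the Jacobian determinant, while the change of
variables formula produces its absolute value. The two agree because the coordinate change is
holomorphic. -/
theorem integral_chart_eq_integral_chart [IsRiemannSurface M] (c c' : M)
    (η : Π y : M, TangentSpace (𝓡∂ 2) y →ₗ[ℝ] TangentSpace (𝓡∂ 2) y →ₗ[ℝ] ℂ)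
    (halt : ∀ y X, η y X X = 0)
    (hsupp : ∀ y, y ∉ (extChartAt (𝓡∂ 2) c).source ∩ (extChartAt (𝓡∂ 2) c').source → η y = 0) :
    ∫ p in (extChartAt (𝓡∂ 2) c).target,
      η ((extChartAt (𝓡∂ 2) c).symm p) (coordVec c p 0) (coordVec c p 1) =
    ∫ p in (extChartAt (𝓡∂ 2) c').target,
      η ((extChartAt (𝓡∂ 2) c').symm p) (coordVec c' p 0) (coordVec c' p 1) := by
  set φ := extChartAt (𝓡∂ 2) c with hφ
  set ψ := extChartAt (𝓡∂ 2) c' with hψ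
  set τ := φ.symm ≫ ψ with hτ
  have hsrc : τ.source ⊆ φ.target := by
    rw [hτ, PartialEquiv.trans_source]; exact inter_subset_left
  have htgt : τ.target ⊆ ψ.target := by
    rw [hτ, PartialEquiv.trans_target]; exact inter_subset_left
  have hswap : ∀ (y : M) X Y, η y X Y = - η y Y X := by
    intro y X Y
    have := halt y (X + Y)
    simp only [map_add, LinearMap.add_apply, halt, zero_add, add_zero] at this
    exact eq_neg_of_add_eq_zero_right this
  have hmem : ∀ p, p ∈ τ.source → p ∈ φ.target ∧ φ.symm p ∈ ψ.source := by
    intro p hp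
    rw [hτ, PartialEquiv.trans_source] at hp
    exact ⟨hp.1, hp.2⟩
  have e1 : ∫ p in φ.target, η (φ.symm p) (coordVec c p 0) (coordVec c p 1) =
      ∫ p in τ.source, η (φ.symm p) (coordVec c p 0) (coordVec c p 1) := by
    refine setIntegral_eq_of_subset_of_forall_sdiff_eq_zero
      (measurableSet_extChartAt_target c) hsrc fun p hp ↦ ?_
    rw [hsupp _ fun h ↦ hp.2 ?_]
    · simp
    · rw [hτ, PartialEquiv.trans_source]
      exact ⟨hp.1, h.2⟩
  have e2 : ∫ p in ψ.target, η (ψ.symm p) (coordVec c' p 0) (coordVec c' p 1) =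
      ∫ p in τ.target, η (ψ.symm p) (coordVec c' p 0) (coordVec c' p 1) := by
    refine setIntegral_eq_of_subset_of_forall_sdiff_eq_zero
      (measurableSet_extChartAt_target c') htgt fun p hp ↦ ?_
    rw [hsupp _ fun h ↦ hp.2 ?_]
    · simp
    · rw [hτ, PartialEquiv.trans_target]
      exact ⟨hp.1, h.1⟩
  rw [e1, e2, ← τ.image_source_eq_target, integral_image_eq_integral_abs_det_fderiv_smul volume
    (f' := fderivWithin ℝ τ (range (𝓡∂ 2))) (measurableSet_extCoordChange_source c c') ?_ τ.injOn]
  · refine setIntegral_congr_fun (measurableSet_extCoordChange_source c c') fun p hp ↦ ?_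
    obtain ⟨hp1, hp2⟩ := hmem p hp
    have hp3 := φ.map_target hp1
    set y := φ.symm p with hy
    have hφy : φ y = p := φ.right_inv hp1
    have hcomm := IsRiemannSurface.holomorphic _ (chart_mem_atlas (EuclideanHalfSpace 2) c) _
      (chart_mem_atlas (EuclideanHalfSpace 2) c') p hp
    obtain ⟨hdet, hT1⟩ := det_eq_of_commute_rot (fderivWithin ℝ τ (range (𝓡∂ 2)) p) hcomm
    have hτp : ψ.symm (τ p) = y := ψ.left_inv hp2
    -- `ψ.symm (τ p)` equals `y` only propositionally. The tangent spaces depend on the point, so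
    -- the equality is transported through a generic `z`.
    have hgen : ∀ z : M, z = y →
        η z (coordField c' 0 z) (coordField c' 1 z) = η y (coordField c' 0 y) (coordField c' 1 y) := by
      rintro z rfl; rfl
    have k0 := coordField_eq_sum hp3 hp2 0
    have k1 := coordField_eq_sum hp3 hp2 1
    rw [← hφ, ← hψ, hφy] at k0 k1
    have hτc : (τ : ℝ² → ℝ²) = ψ ∘ φ.symm := rfl
    rw [← hτc] at k0 k1
    rw [hT1] at k1
    simp only [Fin.sum_univ_two] at k0 k1
    show η y (coordVec c p 0) (coordVec c p 1) = |(fderivWithin ℝ τ (range (𝓡∂ 2)) p).det| •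
      η (ψ.symm (τ p)) (coordVec c' (τ p) 0) (coordVec c' (τ p) 1)
    have hl : η y (coordVec c p 0) (coordVec c p 1) = η y (coordField c 0 y) (coordField c 1 y) := by
      rw [coordVec_eq_coordField hp1, coordVec_eq_coordField hp1]
    have hτt : τ p ∈ (extChartAt (𝓡∂ 2) c').target := ψ.map_source hp2
    have hr : η (ψ.symm (τ p)) (coordVec c' (τ p) 0) (coordVec c' (τ p) 1) =
        η y (coordField c' 0 y) (coordField c' 1 y) := by
      rw [coordVec_eq_coordField hτt, coordVec_eq_coordField hτt]
      exact hgen _ hτp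
    rw [hl, hr]
    rw [k0, k1, hdet, abs_of_nonneg (by positivity)]
    simp only [map_add, map_smul, LinearMap.add_apply, LinearMap.smul_apply, halt, rot,
      hswap y (coordField c' 1 y) (coordField c' 0 y)]
    simp
    ring
  · intro p hp
    obtain ⟨hp1, hp2⟩ := hmem p hp
    have h1 := contDiffWithinAt_ext_coord_change (I := 𝓡∂ 2) (n := ∞) c' c hp
    exact (h1.differentiableWithinAt (by simp)).hasFDerivWithinAt.mono
      (hsrc.trans (extChartAt_target_subset_range c))

end

/-! ### The boundary in charts, and smoothness of coordinate derivatives -/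

section

variable {M : Type*} [TopologicalSpace M] [ChartedSpace (EuclideanHalfSpace 2) M]

section Boundary
variable [IsManifold (𝓡∂ 2) ∞ M]

/-- Boundary points are defined through the preferred chart at `x`. Invariance of interior points
under change of chart allows any chart around `x` to be used. -/
theorem mem_boundary_iff_extChartAt {c x : M} (hx : x ∈ (extChartAt (𝓡∂ 2) c).source) :
    x ∈ (𝓡∂ 2).boundary M ↔ extChartAt (𝓡∂ 2) c x 0 = 0 := by
  have hx' : x ∈ (chartAt (EuclideanHalfSpace 2) c).source := by simpa using hx
  have h1 : x ∈ (𝓡∂ 2).boundary M ↔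
      ¬ extChartAt (𝓡∂ 2) c x ∈ interior (extChartAt (𝓡∂ 2) c).target := by
    exact ((𝓡∂ 2).isBoundaryPoint_iff_not_isInteriorPoint x).trans (not_congr
      ((𝓡∂ 2).isInteriorPoint_iff_of_mem_atlas (n := ∞) (by simp)
        (chart_mem_atlas (EuclideanHalfSpace 2) c) hx'))
  have h2 : extChartAt (𝓡∂ 2) c x ∈ interior (extChartAt (𝓡∂ 2) c).target ↔
      extChartAt (𝓡∂ 2) c x ∈ interior (range (𝓡∂ 2)) :=
    ⟨fun h ↦ OpenPartialHomeomorph.interior_extend_target_subset_interior_range _ h,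
      fun h ↦ (chartAt _ c).mem_interior_extend_target ((chartAt _ c).map_source hx') h⟩
  have h3 : 0 ≤ extChartAt (𝓡∂ 2) c x 0 := mem_range_halfPlane.1
    (extChartAt_target_subset_range c ((extChartAt (𝓡∂ 2) c).map_source hx))
  rw [h1, h2, interior_range_modelWithCornersEuclideanHalfSpace]
  simp only [mem_ofPred_eq, not_lt]
  exact ⟨fun h ↦ le_antisymm h h3, fun h ↦ h.le⟩

theorem coordField_self (x : M) (k : Fin 2) :
    coordField x k x = (EuclideanSpace.single k (1 : ℝ) : ℝ²) := by
  rw [coordField_eq_mfderivWithin (mem_extChartAt_source x), mfderivWithin_range_extChartAt_symm]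
  rfl

/-- `boundaryTangent x` refers to the chart at `x`, while the field comes from the chart at `c`. The
coordinate change between them maps boundary points to boundary points, so along the line `x₀ = 0`
the zeroth component of its values stays zero, and so does the derivative of that component. -/
theorem coordField_mem_boundaryTangent {c x : M} (hx : x ∈ (extChartAt (𝓡∂ 2) c).source)
    (hb : x ∈ (𝓡∂ 2).boundary M) : coordField c 1 x ∈ boundaryTangent x := by
  set φ := extChartAt (𝓡∂ 2) c with hφ
  set ψ := extChartAt (𝓡∂ 2) x with hψ
  set p := φ x with hp
  have hpt : p ∈ φ.target := φ.map_source hx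
  have hps : p ∈ (φ.symm ≫ ψ).source := by
    rw [PartialEquiv.trans_source]
    refine ⟨hpt, ?_⟩
    rw [mem_preimage, φ.left_inv hx]
    exact mem_extChartAt_source x
  have hd := ((contDiffWithinAt_ext_coord_change (I := 𝓡∂ 2) (n := ∞) x c
    hps).differentiableWithinAt (by simp)).hasFDerivWithinAt
  set e₁ : ℝ² := EuclideanSpace.single 1 1 with he₁
  have hline : HasDerivAt (fun t : ℝ ↦ p + t • e₁) e₁ 0 := by
    simpa using ((hasDerivAt_id (0 : ℝ)).smul_const e₁).const_add p
  have hp0 : p 0 = 0 := (mem_boundary_iff_extChartAt hx).1 hb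
  have hl0 : ∀ t : ℝ, (p + t • e₁) 0 = 0 := fun t ↦ by simp [hp0, he₁]
  have hlr : ∀ t : ℝ, p + t • e₁ ∈ range (𝓡∂ 2) := fun t ↦ mem_range_halfPlane.2 (hl0 t).ge
  have hcomp : HasDerivAt ((ψ ∘ φ.symm) ∘ fun t : ℝ ↦ p + t • e₁)
      (fderivWithin ℝ (ψ ∘ φ.symm) (range (𝓡∂ 2)) p e₁) 0 := by
    have hd' : HasFDerivWithinAt (ψ ∘ φ.symm) (fderivWithin ℝ (ψ ∘ φ.symm) (range (𝓡∂ 2)) p)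
        (range (𝓡∂ 2)) (p + (0 : ℝ) • e₁) := by
      rw [zero_smul, add_zero]
      exact hd
    exact (hd'.comp_hasDerivWithinAt (0 : ℝ) hline.hasDerivWithinAt (s := univ)
      (fun t _ ↦ hlr t)).hasDerivAt Filter.univ_mem
  have hcoord : HasDerivAt (fun t : ℝ ↦ ((ψ ∘ φ.symm) (p + t • e₁)) 0)
      (fderivWithin ℝ (ψ ∘ φ.symm) (range (𝓡∂ 2)) p e₁ 0) 0 :=
    (EuclideanSpace.proj (𝕜 := ℝ) (0 : Fin 2)).hasFDerivAt.comp_hasDerivAt (0 : ℝ) hcomp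
  have hev : (fun t : ℝ ↦ ((ψ ∘ φ.symm) (p + t • e₁)) 0) =ᶠ[𝓝 0] fun _ ↦ 0 := by
    have hn : (φ.symm ≫ ψ).source ∈ 𝓝[range (𝓡∂ 2)] p := by
      exact (𝓡∂ 2).extendCoordChange_source_mem_nhdsWithin hps
    have hten : Filter.Tendsto (fun t : ℝ ↦ p + t • e₁) (𝓝 0) (𝓝[range (𝓡∂ 2)] p) := by
      refine tendsto_nhdsWithin_iff.2 ⟨?_, Filter.Eventually.of_forall hlr⟩
      simpa using hline.continuousAt.tendsto
    filter_upwards [hten hn] with t ht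
    rw [mem_preimage, PartialEquiv.trans_source] at ht
    have hb' : φ.symm (p + t • e₁) ∈ (𝓡∂ 2).boundary M := by
      rw [mem_boundary_iff_extChartAt (φ.map_target ht.1), ← hφ, φ.right_inv ht.1]
      exact hl0 t
    exact (mem_boundary_iff_extChartAt ht.2).1 hb'
  have h0 : fderivWithin ℝ (ψ ∘ φ.symm) (range (𝓡∂ 2)) p e₁ 0 = 0 :=
    hcoord.unique ((hasDerivAt_const (0 : ℝ) (0 : ℝ)).congr_of_eventuallyEq hev)
  have hsum := coordField_eq_sum hx (mem_extChartAt_source (I := 𝓡∂ 2) x) 1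
  rw [Fin.sum_univ_two, coordField_self, coordField_self] at hsum
  have hsum' := congrArg (fun v : ℝ² ↦ v 0) hsum
  refine hsum'.trans ?_
  show (fderivWithin ℝ (ψ ∘ φ.symm) (range (𝓡∂ 2)) p e₁ 0 • (EuclideanSpace.single 0 (1 : ℝ) : ℝ²) +
    fderivWithin ℝ (ψ ∘ φ.symm) (range (𝓡∂ 2)) p e₁ 1 • (EuclideanSpace.single 1 (1 : ℝ) : ℝ²)) 0 = 0
  rw [h0]
  simp

end Boundary

theorem mvfderiv_sum {ι G : Type*} [NormedAddCommGroup G] [NormedSpace ℝ G] (s : Finset ι)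
    {f : ι → M → G} {y : M}
    (hf : ∀ i ∈ s, MDifferentiableAt (𝓡∂ 2) 𝓘(ℝ, G) (f i) y) :
    MDifferentiableAt (𝓡∂ 2) 𝓘(ℝ, G) (fun z ↦ ∑ i ∈ s, f i z) y ∧
    mvfderiv (𝓡∂ 2) (fun z ↦ ∑ i ∈ s, f i z) y = ∑ i ∈ s, mvfderiv (𝓡∂ 2) (f i) y := by
  classical
  induction s using Finset.induction_on with
  | empty => exact ⟨by simpa using mdifferentiableAt_const, by simpa using mvfderiv_const (0 : G)⟩
  | insert a s ha ih =>
    obtain ⟨h1, h2⟩ := ih fun i hi ↦ hf i (Finset.mem_insert_of_mem hi)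
    simp only [Finset.sum_insert ha]
    have h3 := hf a (Finset.mem_insert_self a s)
    exact ⟨h3.add h1, by rw [mvfderiv_fun_add h3 h1, h2]⟩

/-- The wedge product of a real and a complex valued linear form. -/
def wedge {W : Type*} [AddCommGroup W] [Module ℝ W] (a : W →ₗ[ℝ] ℝ) (b : W →ₗ[ℝ] ℂ) :
    W →ₗ[ℝ] W →ₗ[ℝ] ℂ :=
  LinearMap.mk₂ ℝ (fun X Y ↦ (a X : ℂ) * b Y - (a Y : ℂ) * b X)
    (by intros; simp; ring) (by intros; simp; ring) (by intros; simp; ring) (by intros; simp; ring)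

/-- The chart target is relatively open in the half-plane, so derivatives within either set agree
there. -/
theorem contDiffOn_fderivWithin_range_apply {G : Type*} [NormedAddCommGroup G] [NormedSpace ℝ G]
    {c : M} {f : ℝ² → G} (hf : ContDiffOn ℝ ∞ f (extChartAt (𝓡∂ 2) c).target) (v : ℝ²) :
    ContDiffOn ℝ ∞ (fun p ↦ fderivWithin ℝ f (range (𝓡∂ 2)) p v) (extChartAt (𝓡∂ 2) c).target := by
  have h1 : ContDiffOn ℝ ∞ (fun p ↦ fderivWithin ℝ f (extChartAt (𝓡∂ 2) c).target p)
      (extChartAt (𝓡∂ 2) c).target :=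
    hf.fderivWithin (uniqueDiffOn_extChartAt_target c) (by simp)
  refine (h1.clm_apply (contDiffOn_const (c := v))).congr fun p hp ↦ ?_
  have hn : 𝓝[range (𝓡∂ 2)] p ≤ 𝓝[(extChartAt (𝓡∂ 2) c).target] p :=
    nhdsWithin_le_of_mem (extChartAt_target_mem_nhdsWithin_of_mem hp)
  rw [fderivWithin_of_mem_nhdsWithin (extChartAt_target_mem_nhdsWithin_of_mem hp)
    ((𝓡∂ 2).uniqueDiffOn _ (extChartAt_target_subset_range c hp))
    (hf.differentiableOn (by simp) p hp)]

theorem contDiffOn_comp_extChartAt_symm [IsManifold (𝓡∂ 2) ∞ M] {G : Type*} [NormedAddCommGroup G]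
    [NormedSpace ℝ G] {c : M} {f : M → G}
    (hf : ContMDiffOn (𝓡∂ 2) 𝓘(ℝ, G) ∞ f (extChartAt (𝓡∂ 2) c).source) :
    ContDiffOn ℝ ∞ (f ∘ (extChartAt (𝓡∂ 2) c).symm) (extChartAt (𝓡∂ 2) c).target :=
  contMDiffOn_iff_contDiffOn.1
    (hf.comp (contMDiffOn_extChartAt_symm c) fun _ hp ↦ (extChartAt (𝓡∂ 2) c).map_target hp)

theorem contMDiffOn_mvfderiv_coordField [IsManifold (𝓡∂ 2) ∞ M] {G : Type*} [NormedAddCommGroup G]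
    [NormedSpace ℝ G] {c : M} {f : M → G}
    (hf : ContMDiffOn (𝓡∂ 2) 𝓘(ℝ, G) ∞ f (extChartAt (𝓡∂ 2) c).source) (k : Fin 2) :
    ContMDiffOn (𝓡∂ 2) 𝓘(ℝ, G) ∞ (fun y ↦ mvfderiv (𝓡∂ 2) f y (coordField c k y))
      (extChartAt (𝓡∂ 2) c).source := by
  have h1 := contDiffOn_fderivWithin_range_apply (contDiffOn_comp_extChartAt_symm hf)
    (EuclideanSpace.single k 1)
  have h2 : ContMDiffOn (𝓡∂ 2) 𝓘(ℝ, ℝ²) ∞ (extChartAt (𝓡∂ 2) c) (extChartAt (𝓡∂ 2) c).source := by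
    rw [extChartAt_source]; exact contMDiffOn_extChartAt
  refine (h1.contMDiffOn.comp h2 fun y hy ↦ (extChartAt (𝓡∂ 2) c).map_source hy).congr
    fun y hy ↦ ?_
  exact mvfderiv_coordField hy k ((hf.contMDiffAt
    ((isOpen_extChartAt_source c).mem_nhds hy)).mdifferentiableAt (by simp))

end

/-! ### Stokes' theorem on a compact surface -/

section SurfaceStokes

variable {M : Type*} [TopologicalSpace M] [ChartedSpace (EuclideanHalfSpace 2) M]
  [T2Space M] [CompactSpace M]

theorem tsupport_chartPartition_subset [IsManifold (𝓡∂ 2) ∞ M] (c : M) :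
    tsupport (chartPartition (M := M) c) ⊆ (extChartAt (𝓡∂ 2) c).source := by
  rw [extChartAt_source]
  exact (SmoothPartitionOfUnity.exists_isSubordinate_chartAt_source (𝓡∂ 2) M).choose_spec c

/-- The support of the partition function at `c`, in the chart at `c`. -/
def chartSupport [IsManifold (𝓡∂ 2) ∞ M] (c : M) : Set ℝ² :=
  extChartAt (𝓡∂ 2) c '' tsupport (chartPartition (M := M) c)

theorem isCompact_chartSupport [IsManifold (𝓡∂ 2) ∞ M] (c : M) : IsCompact (chartSupport c) :=
  (isClosed_tsupport _).isCompact.image_of_continuousOn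
    ((continuousOn_extChartAt c).mono (tsupport_chartPartition_subset c))

theorem chartSupport_subset_target [IsManifold (𝓡∂ 2) ∞ M] (c : M) :
    chartSupport c ⊆ (extChartAt (𝓡∂ 2) c).target := by
  rintro _ ⟨y, hy, rfl⟩
  exact (extChartAt (𝓡∂ 2) c).map_source (tsupport_chartPartition_subset c hy)

theorem notMem_tsupport_of_notMem_chartSupport [IsManifold (𝓡∂ 2) ∞ M] {c : M} {p : ℝ²}
    (hp : p ∈ (extChartAt (𝓡∂ 2) c).target \ chartSupport c) :
    (extChartAt (𝓡∂ 2) c).symm p ∉ tsupport (chartPartition (M := M) c) :=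
  fun h ↦ hp.2 ⟨_, h, (extChartAt (𝓡∂ 2) c).right_inv hp.1⟩

theorem mvfderiv_chartPartition_eq_zero [IsManifold (𝓡∂ 2) ∞ M] {c y : M}
    (hy : y ∉ tsupport (chartPartition (M := M) c)) :
    mvfderiv (𝓡∂ 2) (chartPartition (M := M) c) y = 0 := by
  have h : (chartPartition (M := M) c : M → ℝ) =ᶠ[𝓝 y] fun _ ↦ 0 :=
    notMem_tsupport_iff_eventuallyEq.1 hy
  have h1 : mfderiv (𝓡∂ 2) 𝓘(ℝ, ℝ) (chartPartition (M := M) c : M → ℝ) y = 0 := by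
    rw [h.mfderiv_eq, mfderiv_const]
    rfl
  rw [mvfderiv, h1]
  exact ContinuousLinearMap.comp_zero _

theorem exists_finset_chartPartition [IsManifold (𝓡∂ 2) ∞ M] :
    ∃ S : Finset M, (∀ c ∉ S, ∀ y, chartPartition (M := M) c y = 0) ∧
      ∀ y, ∑ c ∈ S, chartPartition (M := M) c y = 1 := by
  have hfin := (chartPartition (M := M)).locallyFinite.finite_nonempty_of_compact
  have h0 : ∀ c ∉ hfin.toFinset, ∀ y, chartPartition (M := M) c y = 0 := by
    intro c hc y
    by_contra hne
    exact hc (hfin.mem_toFinset.2 ⟨y, hne⟩)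
  refine ⟨hfin.toFinset, h0, fun y ↦ ?_⟩
  rw [← (chartPartition (M := M)).sum_eq_one (mem_univ y)]
  refine (finsum_eq_sum_of_support_subset _ fun c hc ↦ ?_).symm
  by_contra hne
  exact hc (h0 c hne y)

theorem surfaceIntegral_eq_sum [IsRiemannSurface M] {S : Finset M}
    (hS : ∀ c ∉ S, ∀ y, chartPartition (M := M) c y = 0)
    (α : Π x : M, TangentSpace (𝓡∂ 2) x → TangentSpace (𝓡∂ 2) x → ℂ) :
    surfaceIntegral α = ∑ c ∈ S, ∫ p in (extChartAt (𝓡∂ 2) c).target,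
      (chartPartition (M := M) c ((extChartAt (𝓡∂ 2) c).symm p) : ℂ) *
        α ((extChartAt (𝓡∂ 2) c).symm p) (coordVec c p 0) (coordVec c p 1) := by
  refine finsum_eq_sum_of_support_subset _ fun c hc ↦ ?_
  by_contra hne
  exact hc (by simp [hS c hne])

/-- The product of the differential of a real valued function and a one-form. -/
def dWedge (f : M → ℝ) (β : Π y : M, TangentSpace (𝓡∂ 2) y →ₗ[ℝ] ℂ) (y : M) :
    TangentSpace (𝓡∂ 2) y →ₗ[ℝ] TangentSpace (𝓡∂ 2) y →ₗ[ℝ] ℂ :=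
  wedge (mvfderiv (𝓡∂ 2) f y : TangentSpace (𝓡∂ 2) y →ₗ[ℝ] ℝ) (β y)

theorem dWedge_apply (f : M → ℝ) (β : Π y : M, TangentSpace (𝓡∂ 2) y →ₗ[ℝ] ℂ) (y : M)
    (X Y : TangentSpace (𝓡∂ 2) y) : dWedge f β y X Y =
      (mvfderiv (𝓡∂ 2) f y X : ℂ) * β y Y - (mvfderiv (𝓡∂ 2) f y Y : ℂ) * β y X := rfl

variable {β : Π y : M, TangentSpace (𝓡∂ 2) y →ₗ[ℝ] ℂ}

theorem continuousOn_mul_dWedge [IsManifold (𝓡∂ 2) ∞ M]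
    (hβ : ∀ c k, ContMDiffOn (𝓡∂ 2) 𝓘(ℝ, ℂ) ∞ (fun y ↦ β y (coordField c k y))
      (extChartAt (𝓡∂ 2) c).source) (a b c : M) :
    ContinuousOn (fun p ↦ (chartPartition (M := M) a ((extChartAt (𝓡∂ 2) c).symm p) : ℂ) *
      dWedge (chartPartition (M := M) b) β ((extChartAt (𝓡∂ 2) c).symm p)
        (coordVec c p 0) (coordVec c p 1)) (extChartAt (𝓡∂ 2) c).target := by
  have h0 : ContinuousOn (fun y ↦ (chartPartition (M := M) a y : ℂ) *
      dWedge (chartPartition (M := M) b) β y (coordField c 0 y) (coordField c 1 y))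
      (extChartAt (𝓡∂ 2) c).source := by
    have hd : ∀ k, ContinuousOn (fun y ↦ ((mvfderiv (𝓡∂ 2) (chartPartition (M := M) b) y
        (coordField c k y) : ℝ) : ℂ)) (extChartAt (𝓡∂ 2) c).source := fun k ↦
      Complex.continuous_ofReal.comp_continuousOn (contMDiffOn_mvfderiv_coordField
        (chartPartition (M := M) b).contMDiff.contMDiffOn k).continuousOn
    have ha : ContinuousOn (fun y ↦ (chartPartition (M := M) a y : ℂ))
        (extChartAt (𝓡∂ 2) c).source := Complex.continuous_ofReal.comp_continuousOn
      (chartPartition (M := M) a).contMDiff.continuous.continuousOn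
    simp only [dWedge_apply]
    exact ha.mul (((hd 0).mul (hβ c 1).continuousOn).sub ((hd 1).mul (hβ c 0).continuousOn))
  refine (h0.comp (continuousOn_extChartAt_symm c) fun p hp ↦
    (extChartAt (𝓡∂ 2) c).map_target hp).congr fun p hp ↦ ?_
  rw [coordVec_eq_coordField hp, coordVec_eq_coordField hp]
  rfl

theorem dWedge_chartPartition_eq_zero [IsManifold (𝓡∂ 2) ∞ M] {c y : M}
    (hy : y ∉ tsupport (chartPartition (M := M) c)) :
    dWedge (chartPartition (M := M) c) β y = 0 := by
  ext X Y
  simp [dWedge_apply, mvfderiv_chartPartition_eq_zero hy]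

/-- Integrability needs compact support inside the target of the chart at `c`. It holds because one
of the two partition functions involved is subordinate to that chart. -/
theorem integrableOn_mul_dWedge [IsManifold (𝓡∂ 2) ∞ M]
    (hβ : ∀ c k, ContMDiffOn (𝓡∂ 2) 𝓘(ℝ, ℂ) ∞ (fun y ↦ β y (coordField c k y))
      (extChartAt (𝓡∂ 2) c).source) {a b c : M} (hc : c = a ∨ c = b) :
    IntegrableOn (fun p ↦ (chartPartition (M := M) a ((extChartAt (𝓡∂ 2) c).symm p) : ℂ) *
      dWedge (chartPartition (M := M) b) β ((extChartAt (𝓡∂ 2) c).symm p)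
        (coordVec c p 0) (coordVec c p 1)) (extChartAt (𝓡∂ 2) c).target := by
  refine integrableOn_of_continuousOn_of_support (measurableSet_extChartAt_target c)
    (isCompact_chartSupport c) (chartSupport_subset_target c) (continuousOn_mul_dWedge hβ a b c)
    fun p hp ↦ ?_
  have h := notMem_tsupport_of_notMem_chartSupport hp
  rcases hc with rfl | rfl
  · rw [image_eq_zero_of_notMem_tsupport h, Complex.ofReal_zero, zero_mul]
  · rw [dWedge_chartPartition_eq_zero h, LinearMap.zero_apply, LinearMap.zero_apply, mul_zero]

theorem sum_dWedge_chartPartition [IsManifold (𝓡∂ 2) ∞ M] {S : Finset M}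
    (hS : ∀ y, ∑ c ∈ S, chartPartition (M := M) c y = 1) (y : M) (X Y : TangentSpace (𝓡∂ 2) y) :
    ∑ c ∈ S, dWedge (chartPartition (M := M) c) β y X Y = 0 := by
  have h := (mvfderiv_sum S (f := fun c ↦ (chartPartition (M := M) c : M → ℝ)) (y := y)
    fun c _ ↦ (chartPartition (M := M) c).contMDiff.mdifferentiableAt (by simp)).2
  have h1 : (fun z ↦ ∑ c ∈ S, chartPartition (M := M) c z) = fun _ ↦ 1 := funext hS
  rw [h1, mvfderiv_const] at h
  have h2 : ∀ Z, ∑ c ∈ S, (mvfderiv (𝓡∂ 2) (chartPartition (M := M) c) y Z : ℂ) = 0 := by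
    intro Z
    have := congrArg (fun L ↦ L Z) h
    simp only [sum_apply] at this
    exact_mod_cast this.symm
  simp only [dWedge_apply, Finset.sum_sub_distrib, ← Finset.sum_mul, h2, zero_mul, sub_zero]

/-- Insert `1 = ∑ ρ_a`. Each `ρ_a dρ_c ∧ β` is supported in both charts, so its integral may be
moved from the chart at `c` to the chart at `a`. -/
theorem integral_dWedge_eq_sum [IsRiemannSurface M]
    (hβ : ∀ c k, ContMDiffOn (𝓡∂ 2) 𝓘(ℝ, ℂ) ∞ (fun y ↦ β y (coordField c k y))
      (extChartAt (𝓡∂ 2) c).source) {S : Finset M}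
    (hS : ∀ y, ∑ c ∈ S, chartPartition (M := M) c y = 1) (c : M) :
    ∫ p in (extChartAt (𝓡∂ 2) c).target, dWedge (chartPartition (M := M) c) β
      ((extChartAt (𝓡∂ 2) c).symm p) (coordVec c p 0) (coordVec c p 1) =
    ∑ a ∈ S, ∫ p in (extChartAt (𝓡∂ 2) a).target,
      (chartPartition (M := M) a ((extChartAt (𝓡∂ 2) a).symm p) : ℂ) *
        dWedge (chartPartition (M := M) c) β ((extChartAt (𝓡∂ 2) a).symm p)
        (coordVec a p 0) (coordVec a p 1) := by
  have h1 : ∀ a, ∫ p in (extChartAt (𝓡∂ 2) a).target,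
      (chartPartition (M := M) a ((extChartAt (𝓡∂ 2) a).symm p) : ℂ) *
        dWedge (chartPartition (M := M) c) β ((extChartAt (𝓡∂ 2) a).symm p)
        (coordVec a p 0) (coordVec a p 1) = ∫ p in (extChartAt (𝓡∂ 2) c).target,
      (chartPartition (M := M) a ((extChartAt (𝓡∂ 2) c).symm p) : ℂ) *
        dWedge (chartPartition (M := M) c) β ((extChartAt (𝓡∂ 2) c).symm p)
        (coordVec c p 0) (coordVec c p 1) := by
    intro a
    have := integral_chart_eq_integral_chart a c
      (fun y ↦ (chartPartition (M := M) a y) • dWedge (chartPartition (M := M) c) β y)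
      (fun y X ↦ by simp [dWedge_apply]) (fun y hy ↦ by
        by_cases ha : y ∈ (extChartAt (𝓡∂ 2) a).source
        · have hc : y ∉ tsupport (chartPartition (M := M) c) := fun h ↦
            hy ⟨ha, tsupport_chartPartition_subset c h⟩
          simp [dWedge_chartPartition_eq_zero hc]
        · have h0 : y ∉ tsupport (chartPartition (M := M) a) := fun h ↦
            ha (tsupport_chartPartition_subset a h)
          simp [image_eq_zero_of_notMem_tsupport h0])
    simpa only [LinearMap.smul_apply, Complex.real_smul] using this
  simp only [h1]
  rw [← integral_finsetSum _ fun a _ ↦ integrableOn_mul_dWedge hβ (Or.inr rfl)]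
  refine integral_congr_ae (Filter.Eventually.of_forall fun p ↦ ?_)
  have : ∑ a ∈ S, (chartPartition (M := M) a ((extChartAt (𝓡∂ 2) c).symm p) : ℂ) = 1 := by
    exact_mod_cast hS _
  simp only [← Finset.sum_mul, this, one_mul]

/-- **Stokes' theorem** for the differential of a one-form which vanishes on the tangent vectors
of the boundary. -/
theorem surfaceIntegral_eq_zero_of_exact [IsRiemannSurface M]
    (hβ : ∀ c k, ContMDiffOn (𝓡∂ 2) 𝓘(ℝ, ℂ) ∞ (fun y ↦ β y (coordField c k y))
      (extChartAt (𝓡∂ 2) c).source)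
    (hb : ∀ x ∈ (𝓡∂ 2).boundary M, ∀ X ∈ boundaryTangent x, β x X = 0)
    {α : Π x : M, TangentSpace (𝓡∂ 2) x → TangentSpace (𝓡∂ 2) x → ℂ}
    (hα : ∀ c, ∀ y ∈ (extChartAt (𝓡∂ 2) c).source, α y (coordField c 0 y) (coordField c 1 y) =
      mvfderiv (𝓡∂ 2) (fun z ↦ β z (coordField c 1 z)) y (coordField c 0 y) -
        mvfderiv (𝓡∂ 2) (fun z ↦ β z (coordField c 0 z)) y (coordField c 1 y)) :
    surfaceIntegral α = 0 := by
  obtain ⟨S, hS0, hS1⟩ := exists_finset_chartPartition (M := M)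
  rw [surfaceIntegral_eq_sum hS0]
  -- The Leibniz rule `ρ dβ = d(ρ β) - dρ ∧ β`; the integral of `d(ρ β)` vanishes.
  have key : ∀ c : M, ∫ p in (extChartAt (𝓡∂ 2) c).target,
      (chartPartition (M := M) c ((extChartAt (𝓡∂ 2) c).symm p) : ℂ) *
        α ((extChartAt (𝓡∂ 2) c).symm p) (coordVec c p 0) (coordVec c p 1) =
      - ∫ p in (extChartAt (𝓡∂ 2) c).target, dWedge (chartPartition (M := M) c) β
      ((extChartAt (𝓡∂ 2) c).symm p) (coordVec c p 0) (coordVec c p 1) := by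
    intro c
    set T := (extChartAt (𝓡∂ 2) c).target with hT
    set ρ : M → ℝ := ⇑(chartPartition (M := M) c) with hρ
    set h : Fin 2 → M → ℂ := fun k y ↦ ρ y • β y (coordField c k y) with hh
    have hρs : ContMDiff (𝓡∂ 2) 𝓘(ℝ, ℝ) ∞ ρ := (chartPartition (M := M) c).contMDiff
    have hhs : ∀ k, ContMDiffOn (𝓡∂ 2) 𝓘(ℝ, ℂ) ∞ (h k) (extChartAt (𝓡∂ 2) c).source :=
      fun k ↦ hρs.contMDiffOn.smul (hβ c k)
    have hgs : ∀ k, ContDiffOn ℝ ∞ (h k ∘ (extChartAt (𝓡∂ 2) c).symm) T :=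
      fun k ↦ contDiffOn_comp_extChartAt_symm (hhs k)
    have hgK : ∀ k, ∀ p ∈ T \ chartSupport c, (h k ∘ (extChartAt (𝓡∂ 2) c).symm) p = 0 := by
      intro k p hp
      have := notMem_tsupport_of_notMem_chartSupport hp
      show ρ _ • _ = (0 : ℂ)
      rw [show ρ ((extChartAt (𝓡∂ 2) c).symm p) = 0 from image_eq_zero_of_notMem_tsupport this,
        zero_smul]
    have hst := integral_curl_eq_zero (T := T) (extChartAt_target_subset_range c)
      (measurableSet_extChartAt_target c)
      (fun p hp ↦ extChartAt_target_mem_nhdsWithin_of_mem hp) (isCompact_chartSupport c)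
      (chartSupport_subset_target c) ((hgs 0).of_le (by simp)) ((hgs 1).of_le (by simp))
      (hgK 0) (hgK 1) (fun p hp hp0 ↦ by
        have hy := (extChartAt (𝓡∂ 2) c).map_target hp
        have hyb : (extChartAt (𝓡∂ 2) c).symm p ∈ (𝓡∂ 2).boundary M := by
          rw [mem_boundary_iff_extChartAt hy, (extChartAt (𝓡∂ 2) c).right_inv hp]; exact hp0
        show ρ _ • β _ (coordField c 1 _) = 0
        rw [hb _ hyb _ (coordField_mem_boundaryTangent hy hyb), smul_zero])
    have hpt : ∀ p ∈ T,
        fderivWithin ℝ (h 1 ∘ (extChartAt (𝓡∂ 2) c).symm) (range (𝓡∂ 2)) p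
          (EuclideanSpace.single 0 1) -
        fderivWithin ℝ (h 0 ∘ (extChartAt (𝓡∂ 2) c).symm) (range (𝓡∂ 2)) p
          (EuclideanSpace.single 1 1) =
        (ρ ((extChartAt (𝓡∂ 2) c).symm p) : ℂ) *
        α ((extChartAt (𝓡∂ 2) c).symm p) (coordVec c p 0) (coordVec c p 1) +
        dWedge ρ β ((extChartAt (𝓡∂ 2) c).symm p) (coordVec c p 0) (coordVec c p 1) := by
      intro p hp
      have hy := (extChartAt (𝓡∂ 2) c).map_target hp
      have hmd : ∀ k, MDifferentiableAt (𝓡∂ 2) 𝓘(ℝ, ℂ) (fun y ↦ β y (coordField c k y))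
          ((extChartAt (𝓡∂ 2) c).symm p) := fun k ↦ ((hβ c k).contMDiffAt
        ((isOpen_extChartAt_source c).mem_nhds hy)).mdifferentiableAt (by simp)
      have hmρ : MDifferentiableAt (𝓡∂ 2) 𝓘(ℝ, ℝ) ρ ((extChartAt (𝓡∂ 2) c).symm p) :=
        hρs.mdifferentiableAt (by simp)
      have hd : ∀ k l, fderivWithin ℝ (h k ∘ (extChartAt (𝓡∂ 2) c).symm) (range (𝓡∂ 2)) p
          (EuclideanSpace.single l 1) = mvfderiv (𝓡∂ 2) (h k) ((extChartAt (𝓡∂ 2) c).symm p)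
            (coordField c l _) := by
        intro k l
        rw [mvfderiv_coordField hy l (((hhs k).contMDiffAt
          ((isOpen_extChartAt_source c).mem_nhds hy)).mdifferentiableAt (by simp)),
          (extChartAt (𝓡∂ 2) c).right_inv hp]
      rw [hd, hd, coordVec_eq_coordField hp, coordVec_eq_coordField hp, hα c _ hy, dWedge_apply]
      simp only [hh]
      rw [mvfderiv_fun_smul hmρ (hmd 1), mvfderiv_fun_smul hmρ (hmd 0)]
      generalize (extChartAt (𝓡∂ 2) c).symm p = y
      simp only [add_apply, smul_apply, ContinuousLinearMap.smulRight_apply, Complex.real_smul]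
      ring
    rw [setIntegral_congr_fun (measurableSet_extChartAt_target c) hpt] at hst
    have hint1 : IntegrableOn (fun p ↦ dWedge ρ β ((extChartAt (𝓡∂ 2) c).symm p)
        (coordVec c p 0) (coordVec c p 1)) T := by
      have h1 : IntegrableOn (fun p ↦ ∑ a ∈ S,
          (chartPartition (M := M) a ((extChartAt (𝓡∂ 2) c).symm p) : ℂ) * dWedge ρ β
            ((extChartAt (𝓡∂ 2) c).symm p) (coordVec c p 0) (coordVec c p 1)) T :=
        integrable_finsetSum _ fun a _ ↦ integrableOn_mul_dWedge hβ (Or.inr rfl)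
      refine h1.congr (Filter.Eventually.of_forall fun p ↦ ?_)
      have : ∑ a ∈ S, (chartPartition (M := M) a ((extChartAt (𝓡∂ 2) c).symm p) : ℂ) = 1 := by
        exact_mod_cast hS1 _
      simp only [← Finset.sum_mul, this, one_mul]
    have hcurl : IntegrableOn (fun p ↦
        fderivWithin ℝ (h 1 ∘ (extChartAt (𝓡∂ 2) c).symm) (range (𝓡∂ 2)) p
          (EuclideanSpace.single 0 1) -
        fderivWithin ℝ (h 0 ∘ (extChartAt (𝓡∂ 2) c).symm) (range (𝓡∂ 2)) p
          (EuclideanSpace.single 1 1)) T := by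
      refine integrableOn_of_continuousOn_of_support (measurableSet_extChartAt_target c)
        (isCompact_chartSupport c) (chartSupport_subset_target c)
        ((contDiffOn_fderivWithin_range_apply (hgs 1) _).continuousOn.sub
          (contDiffOn_fderivWithin_range_apply (hgs 0) _).continuousOn) fun p hp ↦ ?_
      have hn := notMem_tsupport_of_notMem_chartSupport hp
      have hρ0 : ρ ((extChartAt (𝓡∂ 2) c).symm p) = 0 := image_eq_zero_of_notMem_tsupport hn
      have hw0 : dWedge ρ β ((extChartAt (𝓡∂ 2) c).symm p) = 0 := dWedge_chartPartition_eq_zero hn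
      rw [hpt p hp.1, hρ0, hw0, LinearMap.zero_apply, LinearMap.zero_apply, Complex.ofReal_zero,
        zero_mul, add_zero]
    -- Nothing is assumed on the regularity of `α`. Integrability of `ρ α` is read off from that of
    -- the curl and of `dρ ∧ β`.
    have hint2 : IntegrableOn (fun p ↦ (ρ ((extChartAt (𝓡∂ 2) c).symm p) : ℂ) *
        α ((extChartAt (𝓡∂ 2) c).symm p) (coordVec c p 0) (coordVec c p 1)) T := by
      refine (hcurl.sub hint1).congr_fun (fun p hp ↦ ?_) (measurableSet_extChartAt_target c)
      simp only [Pi.sub_apply]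
      rw [hpt p hp, add_sub_cancel_right]
    rw [integral_add hint2 hint1] at hst
    exact eq_neg_of_add_eq_zero_left hst
  simp only [key, integral_dWedge_eq_sum hβ hS1, Finset.sum_neg_distrib]
  -- With the chart index `a` outside, all terms live in one chart, and the inner sum over `c`
  -- contains `∑ dρ_c = 0`.
  rw [Finset.sum_comm, neg_eq_zero]
  refine Finset.sum_eq_zero fun a _ ↦ ?_
  rw [← integral_finsetSum _ fun c _ ↦ integrableOn_mul_dWedge hβ (Or.inl rfl)]
  simp only [← Finset.mul_sum, sum_dWedge_chartPartition hS1, mul_zero, integral_zero]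

end SurfaceStokes

/-! ### Product rules and commuting coordinate derivatives -/

section CoordDeriv
variable {M : Type*} [TopologicalSpace M] [ChartedSpace (EuclideanHalfSpace 2) M]
  {G G' G'' : Type*} [NormedAddCommGroup G] [NormedSpace ℝ G]
  [NormedAddCommGroup G'] [NormedSpace ℝ G'] [NormedAddCommGroup G''] [NormedSpace ℝ G'']

theorem mvfderiv_bilinear (B : G →L[ℝ] G' →L[ℝ] G'') {f : M → G} {g : M → G'} {y : M}
    (hf : MDifferentiableAt (𝓡∂ 2) 𝓘(ℝ, G) f y) (hg : MDifferentiableAt (𝓡∂ 2) 𝓘(ℝ, G') g y) :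
    MDifferentiableAt (𝓡∂ 2) 𝓘(ℝ, G'') (fun z ↦ B (f z) (g z)) y ∧
    ∀ X : TangentSpace (𝓡∂ 2) y, mvfderiv (𝓡∂ 2) (fun z ↦ B (f z) (g z)) y X =
      B (f y) (mvfderiv (𝓡∂ 2) g y X) + B (mvfderiv (𝓡∂ 2) f y X) (g y) := by
  have hf' := hf.hasMFDerivAt
  have hg' := hg.hasMFDerivAt
  have h1 := B.hasFDerivWithinAt_of_bilinear hf'.2 hg'.2
  have h2 : HasMFDerivAt (𝓡∂ 2) 𝓘(ℝ, G'') (fun z ↦ B (f z) (g z)) y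
      (B.precompR ℝ² (writtenInExtChartAt (𝓡∂ 2) 𝓘(ℝ, G) y f (extChartAt (𝓡∂ 2) y y))
        (mfderiv (𝓡∂ 2) 𝓘(ℝ, G') g y) + B.precompL ℝ² (mfderiv (𝓡∂ 2) 𝓘(ℝ, G) f y)
        (writtenInExtChartAt (𝓡∂ 2) 𝓘(ℝ, G') y g (extChartAt (𝓡∂ 2) y y))) := by
    refine ⟨?_, h1⟩
    exact (B.continuous.continuousAt.comp hf'.1).clm_apply hg'.1
  refine ⟨h2.mdifferentiableAt, fun X ↦ ?_⟩
  have e1 : writtenInExtChartAt (𝓡∂ 2) 𝓘(ℝ, G) y f (extChartAt (𝓡∂ 2) y y) = f y :=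
    congrArg f ((extChartAt (𝓡∂ 2) y).left_inv (mem_extChartAt_source y))
  have e2 : writtenInExtChartAt (𝓡∂ 2) 𝓘(ℝ, G') y g (extChartAt (𝓡∂ 2) y y) = g y :=
    congrArg g ((extChartAt (𝓡∂ 2) y).left_inv (mem_extChartAt_source y))
  rw [e1, e2] at h2
  have := h2.mfderiv
  unfold mvfderiv
  rw [this]
  rfl

theorem mvfderiv_clm_comp (B : G →L[ℝ] G') {f : M → G} {y : M}
    (hf : MDifferentiableAt (𝓡∂ 2) 𝓘(ℝ, G) f y) (X : TangentSpace (𝓡∂ 2) y) :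
    mvfderiv (𝓡∂ 2) (fun z ↦ B (f z)) y X = B (mvfderiv (𝓡∂ 2) f y X) := by
  have h1 := (mvfderiv_bilinear (M := M) (ContinuousLinearMap.apply ℝ G' (E := G))
    (f := f) (g := fun _ ↦ B) (y := y) hf mdifferentiableAt_const).2 X
  simpa [mvfderiv_const] using h1

variable [IsManifold (𝓡∂ 2) ∞ M]

/-- The derivative of `f` with respect to the `k`-th coordinate of the chart at `c`. -/
def coordDeriv (c : M) (k : Fin 2) (f : M → G) (y : M) : G :=
  mvfderiv (𝓡∂ 2) f y (coordField c k y)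

theorem mvfderiv_congr_apply {f g : M → G} {y : M} (h : f =ᶠ[𝓝 y] g) (X : TangentSpace (𝓡∂ 2) y) :
    mvfderiv (𝓡∂ 2) f y X = mvfderiv (𝓡∂ 2) g y X := by
  unfold mvfderiv
  rw [h.mfderiv_eq, h.eq_of_nhds]

theorem coordDeriv_congr {c : M} {k : Fin 2} {f g : M → G} {y : M} (h : f =ᶠ[𝓝 y] g) :
    coordDeriv c k f y = coordDeriv c k g y :=
  mvfderiv_congr_apply h _

variable [T2Space M]

/-- Multiplication by a bump function. Derivatives depend only on germs, so locally smooth functions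
may be replaced by globally smooth ones. -/
theorem exists_contMDiff_eventuallyEq {U : Set M} (hU : IsOpen U) {f : M → G}
    (hf : ContMDiffOn (𝓡∂ 2) 𝓘(ℝ, G) ∞ f U) {y : M} (hy : y ∈ U) :
    ∃ g : M → G, ContMDiff (𝓡∂ 2) 𝓘(ℝ, G) ∞ g ∧ f =ᶠ[𝓝 y] g := by
  obtain ⟨b, -, hb⟩ := (SmoothBumpFunction.nhds_basis_tsupport (I := 𝓡∂ 2) y).mem_iff.mp
    (hU.mem_nhds hy)
  refine ⟨fun z ↦ b z • f z, ?_, ?_⟩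
  · refine contMDiff_of_tsupport fun z hz ↦ ?_
    have hz' : z ∈ tsupport b := tsupport_smul_subset_left (b : M → ℝ) f hz
    exact b.contMDiff.contMDiffAt.smul (hf.contMDiffAt (hU.mem_nhds (hb hz')))
  · filter_upwards [b.eventuallyEq_one] with z hz
    simp [hz]

theorem contMDiffOn_coordDeriv {c : M} {U : Set M} (hU : IsOpen U)
    (hUc : U ⊆ (extChartAt (𝓡∂ 2) c).source) {f : M → G}
    (hf : ContMDiffOn (𝓡∂ 2) 𝓘(ℝ, G) ∞ f U) (k : Fin 2) :
    ContMDiffOn (𝓡∂ 2) 𝓘(ℝ, G) ∞ (coordDeriv c k f) U := by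
  intro y hy
  obtain ⟨g, hg, hfg⟩ := exists_contMDiff_eventuallyEq hU hf hy
  have h1 := (contMDiffOn_mvfderiv_coordField (c := c) hg.contMDiffOn k).contMDiffAt
    ((isOpen_extChartAt_source c).mem_nhds (hUc hy))
  refine (h1.congr_of_eventuallyEq ?_).contMDiffWithinAt
  filter_upwards [hfg.eventuallyEq_nhds] with z hz
  exact coordDeriv_congr hz

/-- Symmetry of the second derivative in the chart. It persists at boundary points because every
point of the half-plane is in the closure of its interior. -/
theorem coordDeriv_comm {c : M} {U : Set M} (hU : IsOpen U)
    (hUc : U ⊆ (extChartAt (𝓡∂ 2) c).source) {f : M → G}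
    (hf : ContMDiffOn (𝓡∂ 2) 𝓘(ℝ, G) ∞ f U) {y : M} (hy : y ∈ U) (k l : Fin 2) :
    coordDeriv c k (coordDeriv c l f) y = coordDeriv c l (coordDeriv c k f) y := by
  obtain ⟨g, hg, hfg⟩ := exists_contMDiff_eventuallyEq hU hf hy
  have e : ∀ i j, coordDeriv c i (coordDeriv c j f) y = coordDeriv c i (coordDeriv c j g) y := by
    intro i j
    refine coordDeriv_congr ?_
    filter_upwards [hfg.eventuallyEq_nhds] with z hz
    exact coordDeriv_congr hz
  rw [e, e]
  have hyc := hUc hy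
  set φ := extChartAt (𝓡∂ 2) c with hφ
  have hp : φ y ∈ φ.target := φ.map_source hyc
  have hR := extChartAt_target_subset_range (I := 𝓡∂ 2) c
  have hgc : ContDiffOn ℝ ∞ (g ∘ φ.symm) φ.target := contDiffOn_comp_extChartAt_symm hg.contMDiffOn
  have hnhds : ∀ p ∈ φ.target, φ.target ∈ 𝓝[range (𝓡∂ 2)] p := fun p hp ↦
    extChartAt_target_mem_nhdsWithin_of_mem hp
  have hd : DifferentiableWithinAt ℝ (fderivWithin ℝ (g ∘ φ.symm) (range (𝓡∂ 2))) (range (𝓡∂ 2))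
      (φ y) := by
    have h1 : ContDiffWithinAt ℝ ∞ (g ∘ φ.symm) (range (𝓡∂ 2)) (φ y) :=
      (hgc _ hp).mono_of_mem_nhdsWithin (hnhds _ hp)
    exact (h1.fderivWithin_right (m := ∞) (𝓡∂ 2).uniqueDiffOn
      (by simp) (hR hp)).differentiableWithinAt (by simp)
  have key : ∀ i j, coordDeriv c i (coordDeriv c j g) y =
      fderivWithin ℝ (fderivWithin ℝ (g ∘ φ.symm) (range (𝓡∂ 2))) (range (𝓡∂ 2)) (φ y)
        (EuclideanSpace.single i 1) (EuclideanSpace.single j 1) := by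
    intro i j
    have hs := contMDiffOn_mvfderiv_coordField (c := c) hg.contMDiffOn j
    have h1 : coordDeriv c i (coordDeriv c j g) y = _ := mvfderiv_coordField hyc i
      ((hs.contMDiffAt ((isOpen_extChartAt_source c).mem_nhds hyc)).mdifferentiableAt (by simp))
    rw [h1, ← hφ]
    have h2 : coordDeriv c j g ∘ φ.symm =ᶠ[𝓝[range (𝓡∂ 2)] (φ y)]
        fun p ↦ fderivWithin ℝ (g ∘ φ.symm) (range (𝓡∂ 2)) p (EuclideanSpace.single j 1) := by
      filter_upwards [hnhds _ hp] with p hp'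
      simp only [Function.comp_apply, coordDeriv]
      rw [mvfderiv_coordField (φ.map_target hp') j (hg.mdifferentiableAt (by simp)), ← hφ,
        φ.right_inv hp']
    rw [h2.fderivWithin_eq_of_mem (hR hp),
      fderivWithin_clm_apply ((𝓡∂ 2).uniqueDiffOn _ (hR hp)) hd (differentiableWithinAt_const _)]
    simp
  rw [key, key]
  refine ContDiffWithinAt.isSymmSndFDerivWithinAt (n := ∞)
    ((hgc _ hp).mono_of_mem_nhdsWithin (hnhds _ hp)) (by simpa using ENat.LEInfty.out)
    (𝓡∂ 2).uniqueDiffOn ?_ (hR hp) _ _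
  exact (𝓡∂ 2).range_subset_closure_interior (hR hp)

end CoordDeriv

/-! ### Local frames and connection matrices -/

section Frame

variable {M : Type*} [TopologicalSpace M] [ChartedSpace (EuclideanHalfSpace 2) M]
  [IsManifold (𝓡∂ 2) ∞ M]
  {F : Type*} [NormedAddCommGroup F] [NormedSpace ℝ F]
  {V : M → Type*} [TopologicalSpace (TotalSpace F V)]
  [∀ x, AddCommGroup (V x)] [∀ x, Module ℝ (V x)] [∀ x, TopologicalSpace (V x)]
  [∀ x, IsTopologicalAddGroup (V x)] [∀ x, ContinuousSMul ℝ (V x)]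
  [FiberBundle F V] [VectorBundle ℝ F V] [ContMDiffVectorBundle ∞ F V (𝓡∂ 2)]

variable (F) in
/-- The coordinates of `w` in the preferred trivialization at `x₀`. -/
def frameCoord (x₀ : M) {y : M} (w : V y) : F := (trivializationAt F V x₀ ⟨y, w⟩).2

variable (F V) in
/-- The domain of the preferred trivialization at `x₀`. -/
def frameDomain (x₀ : M) : Set M := (trivializationAt F V x₀).baseSet

/-- The section which is constant, equal to `v`, in the preferred trivialization at `x₀`. -/
def frameSection (V : M → Type*) [TopologicalSpace (TotalSpace F V)]
    [∀ x, AddCommGroup (V x)] [∀ x, Module ℝ (V x)] [∀ x, TopologicalSpace (V x)]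
    [FiberBundle F V] (x₀ : M) (v : F) (y : M) : V y :=
  (trivializationAt F V x₀).symm y v

theorem isOpen_frameDomain (x₀ : M) : IsOpen (frameDomain F V x₀) :=
  (trivializationAt F V x₀).open_baseSet

theorem mem_frameDomain_self (x₀ : M) : x₀ ∈ frameDomain F V x₀ :=
  FiberBundle.mem_baseSet_trivializationAt' x₀

/-- The preferred trivialization at `x₀`, as a linear equivalence on fibres. -/
def frameEquiv {x₀ y : M} (hy : y ∈ frameDomain F V x₀) : V y ≃ₗ[ℝ] F :=
  ((trivializationAt F V x₀).continuousLinearEquivAt ℝ y hy).toLinearEquiv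

theorem frameEquiv_apply {x₀ y : M} (hy : y ∈ frameDomain F V x₀) (w : V y) :
    frameEquiv hy w = frameCoord F x₀ w := rfl

theorem frameEquiv_symm_apply {x₀ y : M} (hy : y ∈ frameDomain F V x₀) (v : F) :
    (frameEquiv hy).symm v = frameSection V x₀ v y := by
  exact congrFun ((trivializationAt F V x₀).symm_continuousLinearEquivAt_eq (R := ℝ) hy) v |>.trans
    ((trivializationAt F V x₀).symmL_apply (R := ℝ) hy v)

theorem frameCoord_frameSection {x₀ y : M} (hy : y ∈ frameDomain F V x₀) (v : F) :
    frameCoord F x₀ (frameSection V x₀ v y) = v := by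
  rw [← frameEquiv_symm_apply hy, ← frameEquiv_apply hy, LinearEquiv.apply_symm_apply]

theorem frameSection_frameCoord {x₀ y : M} (hy : y ∈ frameDomain F V x₀) (w : V y) :
    frameSection V x₀ (frameCoord F x₀ w) y = w := by
  rw [← frameEquiv_symm_apply hy, ← frameEquiv_apply hy, LinearEquiv.symm_apply_apply]

theorem extend_eq_frameSection {x : M} (w : V x) :
    FiberBundle.extend F w = frameSection V x (frameCoord F x w) := rfl

theorem contMDiffOn_frameSection (x₀ : M) (v : F) :
    ContMDiffOn (𝓡∂ 2) ((𝓡∂ 2).prod 𝓘(ℝ, F)) ∞ (T% (frameSection V x₀ v))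
      (frameDomain F V x₀) :=
  contMDiffOn_trivialization_symm x₀ v

theorem contMDiffOn_frameCoord_iff {x₀ : M} {σ : Π y, V y} {U : Set M} (hU : IsOpen U)
    (hU' : U ⊆ frameDomain F V x₀) :
    ContMDiffOn (𝓡∂ 2) ((𝓡∂ 2).prod 𝓘(ℝ, F)) ∞ (T% σ) U ↔
      ContMDiffOn (𝓡∂ 2) 𝓘(ℝ, F) ∞ (fun y ↦ frameCoord F x₀ (σ y)) U :=
  (trivializationAt F V x₀).contMDiffOn_section_iff hU hU'

theorem mdifferentiableAt_frameCoord_iff {x₀ : M} {σ : Π y, V y} {y : M}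
    (hy : y ∈ frameDomain F V x₀) :
    MDifferentiableAt (𝓡∂ 2) ((𝓡∂ 2).prod 𝓘(ℝ, F)) (T% σ) y ↔
      MDifferentiableAt (𝓡∂ 2) 𝓘(ℝ, F) (fun y ↦ frameCoord F x₀ (σ y)) y :=
  (trivializationAt F V x₀).mdifferentiableAt_section_iff (𝓡∂ 2) σ hy

theorem mdifferentiableAt_frameSection {x₀ y : M} (hy : y ∈ frameDomain F V x₀) (v : F) :
    MDifferentiableAt (𝓡∂ 2) ((𝓡∂ 2).prod 𝓘(ℝ, F)) (T% (frameSection V x₀ v)) y :=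
  ((contMDiffOn_frameSection x₀ v).contMDiffAt
    ((isOpen_frameDomain x₀).mem_nhds hy)).mdifferentiableAt (by simp)

variable [FiniteDimensional ℝ F]

/-- The matrix, in the preferred trivialization at `x₀`, of a linear map with values in `V y`. -/
def frameMatrix (x₀ : M) {y : M} (T : F → V y) : F →L[ℝ] F :=
  ∑ i, (LinearMap.toContinuousLinearMap ((Module.finBasis ℝ F).coord i)).smulRight
    (frameCoord F x₀ (T (Module.finBasis ℝ F i)))

theorem frameMatrix_apply (x₀ : M) {y : M} (T : F → V y) (v : F) :
    frameMatrix x₀ T v = ∑ i, (Module.finBasis ℝ F).repr v i •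
      frameCoord F x₀ (T (Module.finBasis ℝ F i)) := by
  simp [frameMatrix]

/-- `frameMatrix` uses only the values on a basis, which makes its smoothness a matter of finitely
many sections. For linear maps nothing is lost. -/
theorem frameMatrix_linear {x₀ y : M} (hy : y ∈ frameDomain F V x₀) (T : V y →ₗ[ℝ] V y) (v : F) :
    frameMatrix x₀ (fun v ↦ T (frameSection V x₀ v y)) v =
      frameCoord F x₀ (T (frameSection V x₀ v y)) := by
  rw [frameMatrix_apply]
  simp only [← frameEquiv_symm_apply hy, ← frameEquiv_apply hy, ← map_smul, ← map_sum]
  rw [(Module.finBasis ℝ F).sum_repr v]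

theorem trace_eq_trace_frameMatrix {x₀ y : M} (hy : y ∈ frameDomain F V x₀)
    (T : V y →ₗ[ℝ] V y) (S : F →L[ℝ] F)
    (h : ∀ w, frameCoord F x₀ (T w) = S (frameCoord F x₀ w)) :
    LinearMap.trace ℝ (V y) T = LinearMap.trace ℝ F (S : F →ₗ[ℝ] F) := by
  rw [← LinearMap.trace_conj' T (frameEquiv hy)]
  congr 1
  ext v
  rw [LinearEquiv.conj_apply_apply, frameEquiv_apply, h, ← frameEquiv_apply hy,
    LinearEquiv.apply_symm_apply]
  rfl

theorem contMDiffOn_frameMatrix {x₀ : M} {U : Set M} (hU : IsOpen U)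
    (hU' : U ⊆ frameDomain F V x₀) {T : Π y, F → V y}
    (hT : ∀ v, ContMDiffOn (𝓡∂ 2) ((𝓡∂ 2).prod 𝓘(ℝ, F)) ∞ (T% (fun y ↦ T y v)) U) :
    ContMDiffOn (𝓡∂ 2) 𝓘(ℝ, F →L[ℝ] F) ∞ (fun y ↦ frameMatrix x₀ (T y)) U := by
  have h : ∀ i, ContMDiffOn (𝓡∂ 2) 𝓘(ℝ, F →L[ℝ] F) ∞ (fun y ↦
      (ContinuousLinearMap.smulRightL ℝ F F (LinearMap.toContinuousLinearMap
        ((Module.finBasis ℝ F).coord i))) (frameCoord F x₀ (T y (Module.finBasis ℝ F i)))) U :=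
    fun i ↦ ((ContinuousLinearMap.contMDiff _).comp_contMDiffOn
      ((contMDiffOn_frameCoord_iff hU hU').1 (hT _)))
  exact contMDiffOn_finsetSum fun i _ ↦ h i

theorem cov_sum (D : CovariantDerivative (𝓡∂ 2) F V) {ι : Type*} (s : Finset ι) {y : M}
    {σ : ι → Π y, V y}
    (hσ : ∀ i ∈ s, MDifferentiableAt (𝓡∂ 2) ((𝓡∂ 2).prod 𝓘(ℝ, F)) (T% (σ i)) y) :
    D (fun z ↦ ∑ i ∈ s, σ i z) y = ∑ i ∈ s, D (σ i) y := by
  classical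
  induction s using Finset.induction_on with
  | empty =>
    simp only [Finset.sum_empty]
    exact D.isCovariantDerivativeOnUniv.zero
  | insert a s ha ih =>
    simp only [Finset.sum_insert ha]
    have h' : ∀ i ∈ s, MDifferentiableAt (𝓡∂ 2) ((𝓡∂ 2).prod 𝓘(ℝ, F)) (T% (σ i)) y :=
      fun i hi ↦ hσ i (Finset.mem_insert_of_mem hi)
    rw [← ih h']
    exact D.isCovariantDerivativeOnUniv.add (hσ a (Finset.mem_insert_self a s))
      (MDifferentiableAt.sum_section h')

/-- The connection matrix in the preferred trivialization at `x₀`, in the direction of `X`. -/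
def connectionMatrix (D : CovariantDerivative (𝓡∂ 2) F V) (x₀ y : M) (X : TangentSpace (𝓡∂ 2) y) :
    F →L[ℝ] F :=
  frameMatrix x₀ (fun v ↦ D (frameSection V x₀ v) y X)

/-- The formula `∇ = d + Γ`: expand `σ` in the frame sections and apply the Leibniz rule. -/
theorem frameCoord_cov (D : CovariantDerivative (𝓡∂ 2) F V) {x₀ y : M}
    (hy : y ∈ frameDomain F V x₀) {σ : Π y, V y}
    (hσ : MDifferentiableAt (𝓡∂ 2) ((𝓡∂ 2).prod 𝓘(ℝ, F)) (T% σ) y) (X : TangentSpace (𝓡∂ 2) y) :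
    frameCoord F x₀ (D σ y X) = mvfderiv (𝓡∂ 2) (fun z ↦ frameCoord F x₀ (σ z)) y X +
      connectionMatrix D x₀ y X (frameCoord F x₀ (σ y)) := by
  set b := Module.finBasis ℝ F with hb
  set f : M → F := fun z ↦ frameCoord F x₀ (σ z) with hf
  have hfd : MDifferentiableAt (𝓡∂ 2) 𝓘(ℝ, F) f y := (mdifferentiableAt_frameCoord_iff hy).1 hσ
  let φ : Fin (Module.finrank ℝ F) → F →L[ℝ] ℝ := fun i ↦ LinearMap.toContinuousLinearMap (b.coord i)
  have hφ : ∀ v, ∑ i, φ i v • b i = v := fun v ↦ b.sum_repr v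
  have hφd : ∀ i, MDifferentiableAt (𝓡∂ 2) 𝓘(ℝ, ℝ) (fun z ↦ φ i (f z)) y := fun i ↦
    (φ i).mdifferentiableAt.comp y hfd
  have hs : ∀ i, MDifferentiableAt (𝓡∂ 2) ((𝓡∂ 2).prod 𝓘(ℝ, F))
      (T% (frameSection V x₀ (b i))) y := fun i ↦ mdifferentiableAt_frameSection hy _
  have hsm : ∀ i, MDifferentiableAt (𝓡∂ 2) ((𝓡∂ 2).prod 𝓘(ℝ, F))
      (T% ((fun z ↦ φ i (f z)) • frameSection V x₀ (b i))) y :=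
    fun i ↦ (hφd i).smul_section (hs i)
  have hev : ∀ᶠ z in 𝓝 y, σ z = ∑ i, ((fun z ↦ φ i (f z)) • frameSection V x₀ (b i)) z := by
    filter_upwards [(isOpen_frameDomain x₀).mem_nhds hy] with z hz
    simp only [Pi.smul_apply', ← frameEquiv_symm_apply hz, ← map_smul, ← map_sum, hφ]
    exact ((frameEquiv hz).symm_apply_apply (σ z)).symm
  rw [D.isCovariantDerivativeOnUniv.congr_of_eventuallyEq hσ
    (MDifferentiableAt.sum_section fun i _ ↦ hsm i) Filter.univ_mem hev,
    cov_sum D _ fun i _ ↦ hsm i]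
  have hl : ∀ i, D ((fun z ↦ φ i (f z)) • frameSection V x₀ (b i)) y X =
      φ i (f y) • D (frameSection V x₀ (b i)) y X +
        φ i (mvfderiv (𝓡∂ 2) f y X) • frameSection V x₀ (b i) y := by
    intro i
    have := D.isCovariantDerivativeOnUniv.leibniz (hs i) (hφd i)
    rw [this]
    simp only [add_apply, smul_apply, ContinuousLinearMap.smulRight_apply]
    rw [mvfderiv_clm_comp (φ i) hfd]
  rw [sum_apply]
  simp only [hl]
  rw [← frameEquiv_apply hy, map_sum]
  simp only [map_add, map_smul, Finset.sum_add_distrib, frameEquiv_apply,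
    frameCoord_frameSection hy, hφ]
  rw [add_comm, connectionMatrix, frameMatrix_apply]
  rfl

theorem connectionMatrix_apply (D : CovariantDerivative (𝓡∂ 2) F V) {x₀ y : M}
    (hy : y ∈ frameDomain F V x₀) (X : TangentSpace (𝓡∂ 2) y) (v : F) :
    connectionMatrix D x₀ y X v = frameCoord F x₀ (D (frameSection V x₀ v) y X) := by
  rw [frameCoord_cov D hy (mdifferentiableAt_frameSection hy v), frameCoord_frameSection hy]
  have : (fun z ↦ frameCoord F x₀ (frameSection V x₀ v z)) =ᶠ[𝓝 y] fun _ ↦ v := by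
    filter_upwards [(isOpen_frameDomain x₀).mem_nhds hy] with z hz
    exact frameCoord_frameSection hz v
  rw [mvfderiv_congr_apply this, mvfderiv_const, zero_apply, zero_add]

variable [T2Space M]

theorem exists_contMDiff_section_eventuallyEq {U : Set M} (hU : IsOpen U) {σ : Π y, V y}
    (hσ : ContMDiffOn (𝓡∂ 2) ((𝓡∂ 2).prod 𝓘(ℝ, F)) ∞ (T% σ) U) {y : M} (hy : y ∈ U) :
    ∃ τ : Π y, V y, ContMDiff (𝓡∂ 2) ((𝓡∂ 2).prod 𝓘(ℝ, F)) ∞ (T% τ) ∧ ∀ᶠ z in 𝓝 y, σ z = τ z := by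
  obtain ⟨f, -, hf⟩ := (SmoothBumpFunction.nhds_basis_tsupport (I := 𝓡∂ 2) y).mem_iff.mp
    (hU.mem_nhds hy)
  refine ⟨(f : M → ℝ) • σ,
    ContMDiffOn.smul_section_of_tsupport f.contMDiff.contMDiffOn hU hf hσ, ?_⟩
  filter_upwards [f.eventuallyEq_one] with z hz
  simp [hz]

/-- The smoothness of the connection is applied to a global section with the same germ as `σ`. -/
theorem contMDiffOn_cov (D : SmoothConnection F V) {U : Set M} (hU : IsOpen U) {σ : Π y, V y}
    (hσ : ContMDiffOn (𝓡∂ 2) ((𝓡∂ 2).prod 𝓘(ℝ, F)) ∞ (T% σ) U)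
    {Y : Π y : M, TangentSpace (𝓡∂ 2) y}
    (hY : ContMDiffOn (𝓡∂ 2) ((𝓡∂ 2).prod 𝓘(ℝ, ℝ²)) ∞ (T% Y) U) :
    ContMDiffOn (𝓡∂ 2) ((𝓡∂ 2).prod 𝓘(ℝ, F)) ∞ (T% (fun y ↦ D.cov σ y (Y y))) U := by
  intro y hy
  obtain ⟨τ, hτ, hστ⟩ := exists_contMDiff_section_eventuallyEq hU hσ hy
  have h1 := (D.smooth.contMDiff.contMDiff (σ := τ) (by simpa using hτ.contMDiffOn)).contMDiffAt
    (x := y) Filter.univ_mem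
  have h2 := h1.clm_bundle_apply (hY.contMDiffAt (hU.mem_nhds hy))
  refine (h2.congr_of_eventuallyEq ?_).contMDiffWithinAt
  filter_upwards [hστ.eventually_nhds, hU.mem_nhds hy] with z hz hzU
  simp [D.cov.isCovariantDerivativeOn.congr_of_eventuallyEq
    ((hσ.contMDiffAt (hU.mem_nhds hzU)).mdifferentiableAt (by simp))
    ((hτ z).mdifferentiableAt (by simp)) Filter.univ_mem hz]

theorem contMDiffOn_connectionMatrix (D : SmoothConnection F V) (x₀ c : M) (k : Fin 2) :
    ContMDiffOn (𝓡∂ 2) 𝓘(ℝ, F →L[ℝ] F) ∞ (fun y ↦ connectionMatrix D.cov x₀ y (coordField c k y))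
      ((extChartAt (𝓡∂ 2) c).source ∩ frameDomain F V x₀) := by
  have hU := (isOpen_extChartAt_source (I := 𝓡∂ 2) c).inter (isOpen_frameDomain (F := F) (V := V) x₀)
  exact contMDiffOn_frameMatrix hU inter_subset_right fun v ↦ contMDiffOn_cov D hU
    ((contMDiffOn_frameSection x₀ v).mono inter_subset_right)
    ((contMDiffOn_coordField c k).mono inter_subset_left)

end Frame

/-! ### Curvature in coordinates and frames -/

section Curvature

variable {M : Type*} [TopologicalSpace M] [ChartedSpace (EuclideanHalfSpace 2) M]
  [IsManifold (𝓡∂ 2) ∞ M]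
  {F : Type*} [NormedAddCommGroup F] [NormedSpace ℝ F]
  {V : M → Type*} [TopologicalSpace (TotalSpace F V)]
  [∀ x, AddCommGroup (V x)] [∀ x, Module ℝ (V x)] [∀ x, TopologicalSpace (V x)]
  [∀ x, IsTopologicalAddGroup (V x)] [∀ x, ContinuousSMul ℝ (V x)]
  [FiberBundle F V] [VectorBundle ℝ F V] [ContMDiffVectorBundle ∞ F V (𝓡∂ 2)]
  [FiniteDimensional ℝ F] [T2Space M]

theorem curvatureAux_swap (D : CovariantDerivative (𝓡∂ 2) F V)
    (X Y : Π x : M, TangentSpace (𝓡∂ 2) x) (σ : Π x, V x) (y : M) :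
    curvatureAux D X Y σ y = - curvatureAux D Y X σ y := by
  unfold curvatureAux
  rw [VectorField.mlieBracket_swap_apply, map_neg]
  abel

/-- The term in `X f` produced by the Leibniz rule cancels against the one in `[X, f Y]`. This frees
the curvature from the particular extensions of tangent vectors used in its definition. -/
theorem tensorialAt_curvatureAux (D : SmoothConnection F V) {y : M} (w : V y)
    (X : Π x : M, TangentSpace (𝓡∂ 2) x) :
    TensorialAt (𝓡∂ 2) ℝ² (fun Y ↦ curvatureAux D.cov X Y (FiberBundle.extend F w) y) y where
  smul {f Y} hf hY := by
    have h1 := D.cov.isCovariantDerivativeOnUniv.leibniz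
      (mdifferentiableAt_cov_extend D.cov D.smooth w hY) hf
    have h2 : (fun z ↦ D.cov (FiberBundle.extend F w) z ((f • Y) z)) =
        f • fun z ↦ D.cov (FiberBundle.extend F w) z (Y z) := by
      funext z
      exact (D.cov (FiberBundle.extend F w) z).map_smul (f z) (Y z)
    unfold curvatureAux
    rw [h2, h1, VectorField.mlieBracket_smul_right hf hY]
    simp only [Pi.smul_apply', map_smul, map_add, add_apply, smul_apply,
      ContinuousLinearMap.smulRight_apply]
    module
  add {Y Y'} hY hY' := by
    have h1 := D.cov.isCovariantDerivativeOnUniv.add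
      (mdifferentiableAt_cov_extend D.cov D.smooth w hY)
      (mdifferentiableAt_cov_extend D.cov D.smooth w hY')
    have h2 : (fun z ↦ D.cov (FiberBundle.extend F w) z ((Y + Y') z)) =
        (fun z ↦ D.cov (FiberBundle.extend F w) z (Y z)) +
          fun z ↦ D.cov (FiberBundle.extend F w) z (Y' z) := by
      funext z
      exact (D.cov (FiberBundle.extend F w) z).map_add (Y z) (Y' z)
    unfold curvatureAux
    rw [h2, h1, VectorField.mlieBracket_add_right hY hY']
    simp only [Pi.add_apply, map_add, add_apply]
    abel

/-- Tensoriality in the second slot, and antisymmetry for the first, allow the extended fields to be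
replaced by coordinate fields, whose bracket vanishes. -/
theorem curvature_coordField (D : SmoothConnection F V) {c y : M}
    (hy : y ∈ (extChartAt (𝓡∂ 2) c).source) (w : V y) :
    D.curvature y (coordField c 0 y) (coordField c 1 y) w =
      D.cov (fun z ↦ D.cov (FiberBundle.extend F w) z (coordField c 1 z)) y (coordField c 0 y) -
      D.cov (fun z ↦ D.cov (FiberBundle.extend F w) z (coordField c 0 z)) y (coordField c 1 y) := by
  have hext (Z : TangentSpace (𝓡∂ 2) y) := FiberBundle.mdifferentiableAt_extend (𝓡∂ 2)
    ℝ² (V := fun y : M ↦ TangentSpace (𝓡∂ 2) y) Z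
  have hc (k) : MDifferentiableAt (𝓡∂ 2) ((𝓡∂ 2).prod 𝓘(ℝ, ℝ²)) (T% (coordField c k)) y :=
    ((contMDiffOn_coordField c k).contMDiffAt
      ((isOpen_extChartAt_source c).mem_nhds hy)).mdifferentiableAt (by simp)
  have hself (Z : TangentSpace (𝓡∂ 2) y) :
      FiberBundle.extend ℝ² (E := fun y : M ↦ TangentSpace (𝓡∂ 2) y) Z y = Z :=
    FiberBundle.extend_apply_self _ _
  show curvatureAux D.cov (FiberBundle.extend ℝ² (coordField c 0 y))
    (FiberBundle.extend ℝ² (coordField c 1 y)) (FiberBundle.extend F w) y = _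
  rw [(tensorialAt_curvatureAux D w _).pointwise (hext _) (hc 1) (hself _), curvatureAux_swap,
    (tensorialAt_curvatureAux D w _).pointwise (hext _) (hc 0) (hself _), ← curvatureAux_swap,
    curvatureAux, mlieBracket_coordField hy, map_zero, sub_zero]

/-- The curvature matrix, for the coordinates of the chart at `c`, in the preferred trivialization
at `x₀`. -/
def curvatureMatrix (D : SmoothConnection F V) (x₀ c y : M) : F →L[ℝ] F :=
  coordDeriv c 0 (fun z ↦ connectionMatrix D.cov x₀ z (coordField c 1 z)) y -
    coordDeriv c 1 (fun z ↦ connectionMatrix D.cov x₀ z (coordField c 0 z)) y +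
    (connectionMatrix D.cov x₀ y (coordField c 0 y) ∘L
        connectionMatrix D.cov x₀ y (coordField c 1 y) -
      connectionMatrix D.cov x₀ y (coordField c 1 y) ∘L
        connectionMatrix D.cov x₀ y (coordField c 0 y))

theorem frameCoord_cov_cov (D : SmoothConnection F V) {x₀ c y : M} {U : Set M} (hU : IsOpen U)
    (hUs : U ⊆ (extChartAt (𝓡∂ 2) c).source ∩ frameDomain F V x₀) (hy : y ∈ U) {σ : Π z, V z}
    (hσ : ContMDiffOn (𝓡∂ 2) ((𝓡∂ 2).prod 𝓘(ℝ, F)) ∞ (T% σ) U) (k l : Fin 2) :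
    frameCoord F x₀ (D.cov (fun z ↦ D.cov σ z (coordField c l z)) y (coordField c k y)) =
      coordDeriv c k (coordDeriv c l fun z ↦ frameCoord F x₀ (σ z)) y +
      (connectionMatrix D.cov x₀ y (coordField c l y)
        (coordDeriv c k (fun z ↦ frameCoord F x₀ (σ z)) y) +
      coordDeriv c k (fun z ↦ connectionMatrix D.cov x₀ z (coordField c l z)) y
        (frameCoord F x₀ (σ y))) +
      connectionMatrix D.cov x₀ y (coordField c k y)
        (coordDeriv c l (fun z ↦ frameCoord F x₀ (σ z)) y +
          connectionMatrix D.cov x₀ y (coordField c l y) (frameCoord F x₀ (σ y))) := by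
  have hUn := hU.mem_nhds hy
  have hUc : U ⊆ (extChartAt (𝓡∂ 2) c).source := fun z hz ↦ (hUs hz).1
  have hUf : U ⊆ frameDomain F V x₀ := fun z hz ↦ (hUs hz).2
  have hf := (contMDiffOn_frameCoord_iff hU hUf).1 hσ
  have hσd : ∀ z ∈ U, MDifferentiableAt (𝓡∂ 2) ((𝓡∂ 2).prod 𝓘(ℝ, F)) (T% σ) z := fun z hz ↦
    (hσ.contMDiffAt (hU.mem_nhds hz)).mdifferentiableAt (by simp)
  have hτ := contMDiffOn_cov D hU hσ ((contMDiffOn_coordField c l).mono hUc)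
  have hΓ : MDifferentiableAt (𝓡∂ 2) 𝓘(ℝ, F →L[ℝ] F)
      (fun z ↦ connectionMatrix D.cov x₀ z (coordField c l z)) y :=
    (((contMDiffOn_connectionMatrix D x₀ c l).mono hUs).contMDiffAt hUn).mdifferentiableAt (by simp)
  have hfd : MDifferentiableAt (𝓡∂ 2) 𝓘(ℝ, F) (fun z ↦ frameCoord F x₀ (σ z)) y :=
    (hf.contMDiffAt hUn).mdifferentiableAt (by simp)
  have hfl : MDifferentiableAt (𝓡∂ 2) 𝓘(ℝ, F)
      (coordDeriv c l fun z ↦ frameCoord F x₀ (σ z)) y :=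
    ((contMDiffOn_coordDeriv hU hUc hf l).contMDiffAt hUn).mdifferentiableAt (by simp)
  have hloc : ∀ z ∈ U, frameCoord F x₀ (D.cov σ z (coordField c l z)) =
      coordDeriv c l (fun z ↦ frameCoord F x₀ (σ z)) z +
        connectionMatrix D.cov x₀ z (coordField c l z) (frameCoord F x₀ (σ z)) :=
    fun z hz ↦ frameCoord_cov D.cov (hUf hz) (hσd z hz) _
  have hB := mvfderiv_bilinear (ContinuousLinearMap.id ℝ (F →L[ℝ] F)) hΓ hfd
  rw [frameCoord_cov D.cov (hUf hy) ((hτ.contMDiffAt hUn).mdifferentiableAt (by simp)),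
    hloc y hy, mvfderiv_congr_apply (Filter.eventuallyEq_of_mem hUn hloc)]
  have := mvfderiv_fun_add hfl hB.1
  simp only [ContinuousLinearMap.id_apply] at this hB
  rw [this, add_apply, hB.2]
  rfl

/-- Apply `∇ = d + Γ` twice and antisymmetrize. The second derivatives of the coordinates and the
mixed first order terms cancel. -/
theorem frameCoord_curvature (D : SmoothConnection F V) {x₀ c y : M}
    (hy : y ∈ (extChartAt (𝓡∂ 2) c).source) (hy' : y ∈ frameDomain F V x₀) (w : V y) :
    frameCoord F x₀ (D.curvature y (coordField c 0 y) (coordField c 1 y) w) =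
      curvatureMatrix D x₀ c y (frameCoord F x₀ w) := by
  -- The section `FiberBundle.extend F w` is constant in the trivialization at `y`, not in the one
  -- at `x₀`, so both frame domains are needed.
  set U := ((extChartAt (𝓡∂ 2) c).source ∩ frameDomain F V x₀) ∩ frameDomain F V y with hUdef
  have hU : IsOpen U := ((isOpen_extChartAt_source c).inter (isOpen_frameDomain x₀)).inter
    (isOpen_frameDomain y)
  have hyU : y ∈ U := ⟨⟨hy, hy'⟩, mem_frameDomain_self y⟩
  have hσ : ContMDiffOn (𝓡∂ 2) ((𝓡∂ 2).prod 𝓘(ℝ, F)) ∞ (T% (FiberBundle.extend F w)) U :=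
    (contMDiffOn_frameSection y _).mono inter_subset_right
  have hf := (contMDiffOn_frameCoord_iff (x₀ := x₀) hU fun z hz ↦ hz.1.2).1 hσ
  rw [curvature_coordField D hy, ← frameEquiv_apply hy', map_sub, frameEquiv_apply,
    frameEquiv_apply, frameCoord_cov_cov D hU inter_subset_left hyU hσ,
    frameCoord_cov_cov D hU inter_subset_left hyU hσ,
    coordDeriv_comm hU (fun z hz ↦ hz.1.1) hf hyU 0 1, FiberBundle.extend_apply_self,
    curvatureMatrix]
  simp only [add_apply, sub_apply, ContinuousLinearMap.comp_apply, map_add]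
  abel

theorem contMDiffOn_curvatureMatrix (D : SmoothConnection F V) (x₀ c : M) :
    ContMDiffOn (𝓡∂ 2) 𝓘(ℝ, F →L[ℝ] F) ∞ (curvatureMatrix D x₀ c)
      ((extChartAt (𝓡∂ 2) c).source ∩ frameDomain F V x₀) := by
  have hU := (isOpen_extChartAt_source (I := 𝓡∂ 2) c).inter (isOpen_frameDomain (F := F) (V := V) x₀)
  have hΓ := contMDiffOn_connectionMatrix D x₀ c
  have hd := fun k l ↦ contMDiffOn_coordDeriv hU inter_subset_left (hΓ k) l
  exact ((hd 1 0).sub (hd 0 1)).add (((hΓ 0).clm_comp (hΓ 1)).sub ((hΓ 1).clm_comp (hΓ 0)))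

end Curvature

/-! ### Traces of commutators -/

section MatrixTrace
variable {F : Type*} [NormedAddCommGroup F] [NormedSpace ℝ F] [FiniteDimensional ℝ F]

variable (F) in
/-- Half of the trace, as a continuous linear form. -/
def halfTrace : (F →L[ℝ] F) →L[ℝ] ℂ :=
  letI t : (F →L[ℝ] F) →ₗ[ℝ] ℝ := LinearMap.trace ℝ F ∘ₗ ContinuousLinearMap.coeLM ℝ
  (LinearMap.toContinuousLinearMap t).smulRight ((1 : ℂ) / 2)

theorem halfTrace_apply (S : F →L[ℝ] F) :
    halfTrace F S = (LinearMap.trace ℝ F (S : F →ₗ[ℝ] F) : ℂ) / 2 := by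
  simp [halfTrace]
  ring

theorem halfTrace_mul_comm (S T : F →L[ℝ] F) : halfTrace F (S * T) = halfTrace F (T * S) := by
  rw [halfTrace_apply, halfTrace_apply]
  congr 2
  exact LinearMap.trace_mul_comm ℝ (S : F →ₗ[ℝ] F) (T : F →ₗ[ℝ] F)

/-- Since `J` commutes with `T`, the argument is the commutator of `J S` and `T`. The matrix `S` is
not required to commute with `J`: it will be a connection matrix in a real frame. -/
theorem halfTrace_mul_commutator {J S T : F →L[ℝ] F} (h : J * T = T * J) :
    halfTrace F (J * (S * T - T * S)) = 0 := by
  have e : J * (S * T - T * S) = J * S * T - T * (J * S) := by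
    rw [mul_sub, ← mul_assoc, ← mul_assoc, h, mul_assoc T]
  rw [e, map_sub, halfTrace_mul_comm (J * S) T, sub_self]

theorem halfTrace_commutator_mul {J S T : F →L[ℝ] F} (h : J * T = T * J) :
    halfTrace F ((J * S - S * J) * T) = 0 := by
  have e : (J * S - S * J) * T = J * (S * T) - S * T * J := by
    rw [sub_mul, mul_assoc, mul_assoc, mul_assoc, h]
  rw [e, map_sub, halfTrace_mul_comm J, sub_self]

end MatrixTrace

/-! ### The trace of the difference of two connections, and its differential -/

section TraceForm

variable {M : Type*} [TopologicalSpace M] [ChartedSpace (EuclideanHalfSpace 2) M]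
  [IsManifold (𝓡∂ 2) ∞ M]
  {F : Type*} [NormedAddCommGroup F] [NormedSpace ℝ F]
  {V : M → Type*} [TopologicalSpace (TotalSpace F V)]
  [∀ x, AddCommGroup (V x)] [∀ x, Module ℝ (V x)] [∀ x, TopologicalSpace (V x)]
  [∀ x, IsTopologicalAddGroup (V x)] [∀ x, ContinuousSMul ℝ (V x)]
  [FiberBundle F V] [VectorBundle ℝ F V] [ContMDiffVectorBundle ∞ F V (𝓡∂ 2)]
  [FiniteDimensional ℝ F] [T2Space M] {P : BundlePair F V}

/-- The matrix of the complex structure in the preferred trivialization at `x₀`. -/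
def complexStructureMatrix (𝒥 : CompatibleComplexStructure P) (x₀ y : M) : F →L[ℝ] F :=
  frameMatrix x₀ (fun v ↦ 𝒥.J y (frameSection V x₀ v y))

variable {𝒥 : CompatibleComplexStructure P}

theorem frameCoord_complexStructure {x₀ y : M} (hy : y ∈ frameDomain F V x₀) (w : V y) :
    frameCoord F x₀ (𝒥.J y w) = complexStructureMatrix 𝒥 x₀ y (frameCoord F x₀ w) := by
  have := frameMatrix_linear hy (𝒥.J y : V y →ₗ[ℝ] V y) (frameCoord F x₀ w)
  rw [frameSection_frameCoord hy] at this
  exact this.symm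

theorem contMDiffOn_complexStructureMatrix (x₀ : M) :
    ContMDiffOn (𝓡∂ 2) 𝓘(ℝ, F →L[ℝ] F) ∞ (complexStructureMatrix 𝒥 x₀) (frameDomain F V x₀) :=
  contMDiffOn_frameMatrix (isOpen_frameDomain x₀) subset_rfl fun v ↦
    𝒥.J_smooth.contMDiffOn.clm_bundle_apply (contMDiffOn_frameSection x₀ v)

theorem mdifferentiableAt_complexStructureMatrix {x₀ y : M} (hy : y ∈ frameDomain F V x₀) :
    MDifferentiableAt (𝓡∂ 2) 𝓘(ℝ, F →L[ℝ] F) (complexStructureMatrix 𝒥 x₀) y :=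
  ((contMDiffOn_complexStructureMatrix x₀).contMDiffAt
    ((isOpen_frameDomain x₀).mem_nhds hy)).mdifferentiableAt (by simp)

/-- The condition `∇J = 0` in a frame. -/
theorem mvfderiv_complexStructureMatrix (D : 𝒥.Connection) {x₀ y : M}
    (hy : y ∈ frameDomain F V x₀) (X : TangentSpace (𝓡∂ 2) y) :
    mvfderiv (𝓡∂ 2) (complexStructureMatrix 𝒥 x₀) y X =
      complexStructureMatrix 𝒥 x₀ y * connectionMatrix D.cov x₀ y X -
        connectionMatrix D.cov x₀ y X * complexStructureMatrix 𝒥 x₀ y := by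
  ext v
  have hs := mdifferentiableAt_frameSection hy v
  have hJ : MDifferentiableAt (𝓡∂ 2) ((𝓡∂ 2).prod 𝓘(ℝ, F))
      (T% (fun z ↦ 𝒥.J z (frameSection V x₀ v z))) y :=
    (𝒥.J_smooth.mdifferentiableAt (by simp)).clm_bundle_apply hs
  have h1 := congrArg (frameCoord F x₀) (D.complex_linear _ y X hs)
  rw [frameCoord_complexStructure hy, ← connectionMatrix_apply D.cov hy,
    frameCoord_cov D.cov hy hJ, frameCoord_complexStructure hy, frameCoord_frameSection hy] at h1
  have h2 : (fun z ↦ frameCoord F x₀ (𝒥.J z (frameSection V x₀ v z))) =ᶠ[𝓝 y]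
      fun z ↦ ContinuousLinearMap.apply ℝ F v (complexStructureMatrix 𝒥 x₀ z) := by
    filter_upwards [(isOpen_frameDomain x₀).mem_nhds hy] with z hz
    rw [frameCoord_complexStructure hz, frameCoord_frameSection hz]
    rfl
  rw [mvfderiv_congr_apply h2,
    mvfderiv_clm_comp _ (mdifferentiableAt_complexStructureMatrix hy)] at h1
  exact eq_sub_of_add_eq h1

/-- In a frame the complex trace has the form `τ(S) + τ'(J S)` with fixed continuous linear forms
`τ`, `τ'`, so it can be differentiated by the product rule. -/
theorem complexTrace_eq_halfTrace {x₀ y : M} (hy : y ∈ frameDomain F V x₀) (T : V y →ₗ[ℝ] V y)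
    (S : F →L[ℝ] F) (h : ∀ w, frameCoord F x₀ (T w) = S (frameCoord F x₀ w)) :
    complexTrace (𝒥.J y : V y →ₗ[ℝ] V y) T = halfTrace F S +
      (-Complex.I • halfTrace F) (complexStructureMatrix 𝒥 x₀ y * S) := by
  rw [complexTrace, trace_eq_trace_frameMatrix hy T S h, trace_eq_trace_frameMatrix hy _
    (complexStructureMatrix 𝒥 x₀ y * S) fun w ↦ by
      rw [LinearMap.comp_apply, ContinuousLinearMap.coe_coe, frameCoord_complexStructure hy, h]
      rfl]
  rw [smul_apply, halfTrace_apply, halfTrace_apply, smul_eq_mul]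
  ring

/-- `complexTrace` as a linear map. -/
def complexTraceₗ {W : Type*} [AddCommGroup W] [Module ℝ W] (J : W →ₗ[ℝ] W) :
    (W →ₗ[ℝ] W) →ₗ[ℝ] ℂ where
  toFun := complexTrace J
  map_add' S T := by
    simp only [complexTrace, LinearMap.comp_add, map_add, Complex.ofReal_add]
    ring
  map_smul' a S := by
    simp only [complexTrace, LinearMap.comp_smul, map_smul, smul_eq_mul, Complex.ofReal_mul,
      RingHom.id_apply, Complex.real_smul]
    ring

/-- The difference of two connections, evaluated on a tangent vector. -/
def connectionDifference (D₁ D₂ : CovariantDerivative (𝓡∂ 2) F V) (y : M) :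
    TangentSpace (𝓡∂ 2) y →ₗ[ℝ] V y →ₗ[ℝ] V y :=
  LinearMap.mk₂ ℝ (fun X w ↦ CovariantDerivative.difference D₁ D₂ y w X)
    (by intros; simp) (by intros; simp) (by intros; simp) (by intros; simp)

theorem connectionDifference_apply (D₁ D₂ : CovariantDerivative (𝓡∂ 2) F V) {y : M} {σ : Π z, V z}
    (hσ : MDifferentiableAt (𝓡∂ 2) ((𝓡∂ 2).prod 𝓘(ℝ, F)) (T% σ) y) (X : TangentSpace (𝓡∂ 2) y) :
    connectionDifference D₁ D₂ y X (σ y) = D₁ σ y X - D₂ σ y X := by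
  have := IsCovariantDerivativeOn.difference_apply D₁.isCovariantDerivativeOnUniv
    D₂.isCovariantDerivativeOnUniv (x := y) trivial hσ
  exact congrArg (fun L ↦ L X) this

theorem frameCoord_connectionDifference (D₁ D₂ : CovariantDerivative (𝓡∂ 2) F V) {x₀ y : M}
    (hy : y ∈ frameDomain F V x₀) (X : TangentSpace (𝓡∂ 2) y) (w : V y) :
    frameCoord F x₀ (connectionDifference D₁ D₂ y X w) =
      (connectionMatrix D₁ x₀ y X - connectionMatrix D₂ x₀ y X) (frameCoord F x₀ w) := by
  have h := connectionDifference_apply D₁ D₂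
    (mdifferentiableAt_frameSection hy (frameCoord F x₀ w)) X
  rw [frameSection_frameCoord hy] at h
  rw [h, sub_apply, connectionMatrix_apply _ hy, connectionMatrix_apply _ hy,
    ← frameEquiv_apply hy, map_sub]
  rfl

/-- The one-form `tr (∇¹ - ∇²)`. -/
def traceForm (D₁ D₂ : 𝒥.Connection) (y : M) : TangentSpace (𝓡∂ 2) y →ₗ[ℝ] ℂ :=
  complexTraceₗ (𝒥.J y : V y →ₗ[ℝ] V y) ∘ₗ connectionDifference D₁.cov D₂.cov y

theorem traceForm_apply (D₁ D₂ : 𝒥.Connection) {x₀ y : M} (hy : y ∈ frameDomain F V x₀)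
    (X : TangentSpace (𝓡∂ 2) y) :
    traceForm D₁ D₂ y X =
      halfTrace F (connectionMatrix D₁.cov x₀ y X - connectionMatrix D₂.cov x₀ y X) +
      (-Complex.I • halfTrace F) (complexStructureMatrix 𝒥 x₀ y *
        (connectionMatrix D₁.cov x₀ y X - connectionMatrix D₂.cov x₀ y X)) :=
  complexTrace_eq_halfTrace hy _ _ fun w ↦ frameCoord_connectionDifference _ _ hy X w

theorem trCurvature_apply (D : 𝒥.Connection) {x₀ c y : M}
    (hy : y ∈ (extChartAt (𝓡∂ 2) c).source) (hy' : y ∈ frameDomain F V x₀) :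
    D.trCurvature y (coordField c 0 y) (coordField c 1 y) =
      halfTrace F (curvatureMatrix D.toSmoothConnection x₀ c y) +
      (-Complex.I • halfTrace F) (complexStructureMatrix 𝒥 x₀ y *
        curvatureMatrix D.toSmoothConnection x₀ c y) :=
  complexTrace_eq_halfTrace hy' _ _ fun w ↦ frameCoord_curvature D.toSmoothConnection hy hy' w

theorem contMDiffOn_trace_of_frame {f : M → ℂ} {W : Set M} {S : M → M → F →L[ℝ] F}
    (hS : ∀ x₀, ContMDiffOn (𝓡∂ 2) 𝓘(ℝ, F →L[ℝ] F) ∞ (S x₀) (W ∩ frameDomain F V x₀))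
    (hW : IsOpen W)
    (hf : ∀ x₀, ∀ y ∈ W ∩ frameDomain F V x₀, f y = halfTrace F (S x₀ y) +
      (-Complex.I • halfTrace F) (complexStructureMatrix 𝒥 x₀ y * S x₀ y)) :
    ContMDiffOn (𝓡∂ 2) 𝓘(ℝ, ℂ) ∞ f W := by
  intro y hy
  have hU := hW.inter (isOpen_frameDomain (F := F) (V := V) y)
  have h1 := ((halfTrace F).contMDiff.comp_contMDiffOn (hS y)).add
    (((-Complex.I • halfTrace F : (F →L[ℝ] F) →L[ℝ] ℂ)).contMDiff.comp_contMDiffOn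
      (((contMDiffOn_complexStructureMatrix (𝒥 := 𝒥) y).mono
        (inter_subset_right (s := W))).clm_comp (hS y)))
  exact ((h1.congr (hf y)).contMDiffAt
    (hU.mem_nhds ⟨hy, mem_frameDomain_self y⟩)).contMDiffWithinAt

theorem contMDiffOn_traceForm (D₁ D₂ : 𝒥.Connection) (c : M) (k : Fin 2) :
    ContMDiffOn (𝓡∂ 2) 𝓘(ℝ, ℂ) ∞ (fun y ↦ traceForm D₁ D₂ y (coordField c k y))
      (extChartAt (𝓡∂ 2) c).source :=
  contMDiffOn_trace_of_frame (𝒥 := 𝒥)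
    (fun x₀ ↦ (contMDiffOn_connectionMatrix D₁.toSmoothConnection x₀ c k).sub
      (contMDiffOn_connectionMatrix D₂.toSmoothConnection x₀ c k)) (isOpen_extChartAt_source c)
    fun _ _ hy ↦ traceForm_apply D₁ D₂ hy.2 _

theorem contMDiffOn_trCurvature (D : 𝒥.Connection) (c : M) :
    ContMDiffOn (𝓡∂ 2) 𝓘(ℝ, ℂ) ∞ (fun y ↦ D.trCurvature y (coordField c 0 y) (coordField c 1 y))
      (extChartAt (𝓡∂ 2) c).source :=
  contMDiffOn_trace_of_frame (𝒥 := 𝒥)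
    (fun x₀ ↦ contMDiffOn_curvatureMatrix D.toSmoothConnection x₀ c) (isOpen_extChartAt_source c)
    fun _ _ hy ↦ trCurvature_apply D hy.1 hy.2

theorem mvfderiv_trace_mul (τ τ' : (F →L[ℝ] F) →L[ℝ] ℂ) {J S : M → F →L[ℝ] F} {y : M}
    (hJ : MDifferentiableAt (𝓡∂ 2) 𝓘(ℝ, F →L[ℝ] F) J y)
    (hS : MDifferentiableAt (𝓡∂ 2) 𝓘(ℝ, F →L[ℝ] F) S y) (X : TangentSpace (𝓡∂ 2) y) :
    mvfderiv (𝓡∂ 2) (fun z ↦ τ (S z) + τ' (J z * S z)) y X =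
      τ (mvfderiv (𝓡∂ 2) S y X) +
        (τ' (J y * mvfderiv (𝓡∂ 2) S y X) + τ' (mvfderiv (𝓡∂ 2) J y X * S y)) := by
  have hB := mvfderiv_bilinear (ContinuousLinearMap.compL ℝ F F F) hJ hS
  have h1 : MDifferentiableAt (𝓡∂ 2) 𝓘(ℝ, ℂ) (fun z ↦ τ (S z)) y :=
    τ.mdifferentiableAt.comp y hS
  have h2 : MDifferentiableAt (𝓡∂ 2) 𝓘(ℝ, ℂ) (fun z ↦ τ' (J z * S z)) y :=
    τ'.mdifferentiableAt.comp y hB.1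
  rw [mvfderiv_fun_add h1 h2, add_apply, mvfderiv_clm_comp τ hS]
  refine congrArg _ ((mvfderiv_clm_comp τ' hB.1 X).trans ?_)
  rw [hB.2, map_add]
  rfl

/-- The Chern-Weil identity `tr F₁ - tr F₂ = d tr A`. In a frame, `F₁ - F₂` is the curl of `A` plus
commutators that each contain a component of `A`. As `A` commutes with `J`, the complex traces of
these commutators vanish, and so does the contribution of the derivative of `J` to `d tr A`. -/
theorem trCurvature_sub (D₁ D₂ : 𝒥.Connection) {c y : M} (hy : y ∈ (extChartAt (𝓡∂ 2) c).source) :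
    D₁.trCurvature y (coordField c 0 y) (coordField c 1 y) -
      D₂.trCurvature y (coordField c 0 y) (coordField c 1 y) =
    mvfderiv (𝓡∂ 2) (fun z ↦ traceForm D₁ D₂ z (coordField c 1 z)) y (coordField c 0 y) -
      mvfderiv (𝓡∂ 2) (fun z ↦ traceForm D₁ D₂ z (coordField c 0 z)) y (coordField c 1 y) := by
  have hyf := mem_frameDomain_self (F := F) (V := V) y
  have hU := (isOpen_extChartAt_source (I := 𝓡∂ 2) c).inter (isOpen_frameDomain (F := F) (V := V) y)
  have hUn := hU.mem_nhds ⟨hy, hyf⟩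
  set J := complexStructureMatrix 𝒥 y with hJ
  set Γ₁ : Fin 2 → M → F →L[ℝ] F := fun k z ↦ connectionMatrix D₁.cov y z (coordField c k z)
  set Γ₂ : Fin 2 → M → F →L[ℝ] F := fun k z ↦ connectionMatrix D₂.cov y z (coordField c k z)
  have hΓ₁ : ∀ k, MDifferentiableAt (𝓡∂ 2) 𝓘(ℝ, F →L[ℝ] F) (Γ₁ k) y := fun k ↦
    ((contMDiffOn_connectionMatrix D₁.toSmoothConnection y c k).contMDiffAt hUn).mdifferentiableAt
      (by simp)
  have hΓ₂ : ∀ k, MDifferentiableAt (𝓡∂ 2) 𝓘(ℝ, F →L[ℝ] F) (Γ₂ k) y := fun k ↦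
    ((contMDiffOn_connectionMatrix D₂.toSmoothConnection y c k).contMDiffAt hUn).mdifferentiableAt
      (by simp)
  have hJd : MDifferentiableAt (𝓡∂ 2) 𝓘(ℝ, F →L[ℝ] F) J y :=
    mdifferentiableAt_complexStructureMatrix hyf
  have hJ₁ : ∀ k, coordDeriv c k J y = J y * Γ₁ k y - Γ₁ k y * J y := fun k ↦
    mvfderiv_complexStructureMatrix D₁ hyf _
  have hJ₂ : ∀ k, coordDeriv c k J y = J y * Γ₂ k y - Γ₂ k y * J y := fun k ↦
    mvfderiv_complexStructureMatrix D₂ hyf _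
  -- Both connections give an expression for the same derivative of `J`; their difference says that
  -- `A = Γ₁ - Γ₂` commutes with `J`.
  have hcomm : ∀ k, J y * (Γ₁ k y - Γ₂ k y) = (Γ₁ k y - Γ₂ k y) * J y := by
    intro k
    have := (hJ₁ k).symm.trans (hJ₂ k)
    rw [mul_sub, sub_mul, sub_eq_sub_iff_add_eq_add]
    rw [sub_eq_sub_iff_add_eq_add] at this
    rw [this, add_comm]
  have hd : ∀ k l, mvfderiv (𝓡∂ 2) (fun z ↦ traceForm D₁ D₂ z (coordField c l z)) y
      (coordField c k y) = halfTrace F (coordDeriv c k (Γ₁ l) y - coordDeriv c k (Γ₂ l) y) +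
        (-Complex.I • halfTrace F) (J y * (coordDeriv c k (Γ₁ l) y - coordDeriv c k (Γ₂ l) y)) := by
    intro k l
    have hev : (fun z ↦ traceForm D₁ D₂ z (coordField c l z)) =ᶠ[𝓝 y] fun z ↦
        halfTrace F (Γ₁ l z - Γ₂ l z) + (-Complex.I • halfTrace F)
          (J z * (Γ₁ l z - Γ₂ l z)) := by
      filter_upwards [hUn] with z hz
      exact traceForm_apply D₁ D₂ hz.2 _
    have hΔ : MDifferentiableAt (𝓡∂ 2) 𝓘(ℝ, F →L[ℝ] F) (fun z ↦ Γ₁ l z - Γ₂ l z) y :=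
      (hΓ₁ l).sub (hΓ₂ l)
    rw [mvfderiv_congr_apply hev, mvfderiv_trace_mul _ _ hJd hΔ,
      mvfderiv_fun_sub (hΓ₁ l) (hΓ₂ l), sub_apply]
    have h0 : (-Complex.I • halfTrace F) (mvfderiv (𝓡∂ 2) J y (coordField c k y) *
        (Γ₁ l y - Γ₂ l y)) = 0 := by
      rw [show mvfderiv (𝓡∂ 2) J y (coordField c k y) = _ from hJ₁ k, smul_apply,
        halfTrace_commutator_mul (hcomm l), smul_zero]
    rw [h0, add_zero]
    rfl
  -- `[Γ₁, Γ₁] - [Γ₂, Γ₂]` is split asymmetrically, through `Γ₁` in direction `0` and `Γ₂` in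
  -- direction `1`, so that each remaining commutator has a difference `Γ₁ - Γ₂` as a factor.
  have hK : curvatureMatrix D₁.toSmoothConnection y c y -
      curvatureMatrix D₂.toSmoothConnection y c y =
      (coordDeriv c 0 (Γ₁ 1) y - coordDeriv c 0 (Γ₂ 1) y) -
      (coordDeriv c 1 (Γ₁ 0) y - coordDeriv c 1 (Γ₂ 0) y) +
      ((Γ₁ 0 y * (Γ₁ 1 y - Γ₂ 1 y) - (Γ₁ 1 y - Γ₂ 1 y) * Γ₁ 0 y) -
        (Γ₂ 1 y * (Γ₁ 0 y - Γ₂ 0 y) - (Γ₁ 0 y - Γ₂ 0 y) * Γ₂ 1 y)) := by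
    have e : ∀ D : SmoothConnection F V, curvatureMatrix D y c y =
        coordDeriv c 0 (fun z ↦ connectionMatrix D.cov y z (coordField c 1 z)) y -
        coordDeriv c 1 (fun z ↦ connectionMatrix D.cov y z (coordField c 0 z)) y +
        (connectionMatrix D.cov y y (coordField c 0 y) * connectionMatrix D.cov y y (coordField c 1 y)
          - connectionMatrix D.cov y y (coordField c 1 y) *
            connectionMatrix D.cov y y (coordField c 0 y)) := fun D ↦ rfl
    rw [e, e]
    noncomm_ring
  have hone : ∀ S T : F →L[ℝ] F, halfTrace F (S * T - T * S) = 0 := fun S T ↦ by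
    rw [map_sub, halfTrace_mul_comm, sub_self]
  rw [hd, hd, trCurvature_apply D₁ hy hyf, trCurvature_apply D₂ hy hyf, add_sub_add_comm,
    ← map_sub, ← map_sub, ← mul_sub, hK, mul_add, mul_sub (J y) (_ * _ - _), map_add, map_add,
    map_sub _ (_ * _ - _), hone, hone, map_sub _ (J y * (_ * _ - _)), smul_apply _ _ (J y * (_ * _ - _)),
    smul_apply _ _ (J y * (_ * _ - _)),
    halfTrace_mul_commutator (hcomm 1), halfTrace_mul_commutator (hcomm 0)]
  simp only [map_sub, mul_sub, smul_zero, sub_zero, add_zero]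
  ring

end TraceForm

/-! ### Linear algebra of Lagrangian subspaces -/

section LagrangianTrace
variable {W : Type*} [AddCommGroup W] [Module ℝ W] [FiniteDimensional ℝ W]

/-- The isomorphism of `W` with its dual given by `B` conjugates `A` to the transpose of `-A`, so
the trace equals its opposite. -/
theorem trace_eq_zero_of_skew {B : LinearMap.BilinForm ℝ W} (hB : B.Nondegenerate)
    {A : W →ₗ[ℝ] W} (hA : ∀ v w, B (A v) w = - B v (A w)) : LinearMap.trace ℝ W A = 0 := by
  have h : (B.toDual hB).conj A = Module.Dual.transpose (R := ℝ) (-A) := by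
    ext f w
    obtain ⟨v, rfl⟩ := (B.toDual hB).surjective f
    rw [LinearEquiv.conj_apply_apply, LinearEquiv.symm_apply_apply]
    exact (hA v w).trans (map_neg (B v) (A w)).symm
  have h2 := LinearMap.trace_conj' A (B.toDual hB)
  rw [h, LinearMap.trace_transpose', map_neg] at h2
  linarith

/-- If `w` and `J w` both lie in `L`, then `B w (J w) = 0`, so `w = 0` by positivity. Since `L` is
its own orthogonal, its dimension is half that of `W`, and the disjoint subspaces `L` and `J L` fill
`W`. -/
theorem isCompl_lagrangian_map {B : LinearMap.BilinForm ℝ W} (hB : B.Nondegenerate)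
    {J : W →ₗ[ℝ] W} (hJ : ∀ v, J (J v) = -v) (hpos : ∀ v, v ≠ 0 → 0 < B v (J v))
    {L : Submodule ℝ W} (hL : ∀ v, v ∈ L ↔ ∀ w ∈ L, B w v = 0) : IsCompl L (L.map J) := by
  have hinj : Function.Injective J := fun v w h ↦ by
    have := congrArg J h
    rwa [hJ, hJ, neg_inj] at this
  have hort : B.orthogonal L = L := by
    ext v
    exact (hL v).symm
  have hdim := B.finrank_orthogonal hB L
  rw [hort] at hdim
  have hle := L.finrank_le
  have hdisj : Disjoint L (L.map J) := by
    rw [Submodule.disjoint_def]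
    rintro _ hv ⟨w, hw, rfl⟩
    by_contra hne
    have hw0 : w ≠ 0 := fun h ↦ hne (by rw [h, map_zero])
    exact (hpos w hw0).ne' ((hL _).1 hv w hw)
  refine ⟨hdisj, codisjoint_iff.2 (Submodule.eq_top_of_disjoint _ _ ?_ hdisj)⟩
  rw [← (Submodule.equivMapOfInjective J hinj L).finrank_eq]
  lia

theorem trace_eq_zero_of_isCompl {S T : Submodule ℝ W} (h : IsCompl S T) {A : W →ₗ[ℝ] W}
    (hS : ∀ v ∈ S, A v ∈ T) (hT : ∀ v ∈ T, A v ∈ S) : LinearMap.trace ℝ W A = 0 := by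
  refine LinearMap.trace_eq_zero_of_mapsTo_ne (N := fun b : Bool ↦ cond b S T)
    ((DirectSum.isInternal_submodule_iff_isCompl _ (i := true) (j := false) (by simp)
      (by ext b; cases b <;> simp)).2 h) not (by simp) ?_
  rintro (_ | _)
  · exact hT
  · exact hS

/-- A skew-hermitian endomorphism which preserves a Lagrangian subspace has no trace. -/
theorem complexTrace_eq_zero_of_lagrangian {B : LinearMap.BilinForm ℝ W} (hB : B.Nondegenerate)
    {J : W →ₗ[ℝ] W} (hJ : ∀ v, J (J v) = -v) (hpos : ∀ v, v ≠ 0 → 0 < B v (J v))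
    {L : Submodule ℝ W} (hL : ∀ v, v ∈ L ↔ ∀ w ∈ L, B w v = 0) {A : W →ₗ[ℝ] W}
    (hAJ : ∀ v, A (J v) = J (A v)) (hA : ∀ v w, B (A v) w = - B v (A w))
    (hAL : ∀ v ∈ L, A v ∈ L) : complexTrace J A = 0 := by
  -- `J A` exchanges `L` and `J L`, so it has no diagonal blocks. This disposes of the imaginary
  -- part of the complex trace; skewness disposes of the real part.
  have h2 : LinearMap.trace ℝ W (J ∘ₗ A) = 0 := by
    refine trace_eq_zero_of_isCompl (isCompl_lagrangian_map hB hJ hpos hL)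
      (fun v hv ↦ ⟨A v, hAL v hv, rfl⟩) ?_
    rintro _ ⟨v, hv, rfl⟩
    rw [LinearMap.comp_apply, hAJ, hJ]
    exact L.neg_mem (hAL v hv)
  rw [complexTrace, trace_eq_zero_of_skew hB hA, h2]
  simp

end LagrangianTrace

/-! ### Pointwise properties of the difference of two connections -/

section Unitary

variable {M : Type*} [TopologicalSpace M] [ChartedSpace (EuclideanHalfSpace 2) M]
  [IsManifold (𝓡∂ 2) ∞ M]
  {F : Type*} [NormedAddCommGroup F] [NormedSpace ℝ F]
  {V : M → Type*} [TopologicalSpace (TotalSpace F V)]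
  [∀ x, AddCommGroup (V x)] [∀ x, Module ℝ (V x)] [∀ x, TopologicalSpace (V x)]
  [∀ x, IsTopologicalAddGroup (V x)] [∀ x, ContinuousSMul ℝ (V x)]
  [FiberBundle F V] [VectorBundle ℝ F V] [ContMDiffVectorBundle ∞ F V (𝓡∂ 2)]
  [FiniteDimensional ℝ F] [T2Space M] {P : BundlePair F V} {𝒥 : CompatibleComplexStructure P}

theorem connectionDifference_extend (D₁ D₂ : CovariantDerivative (𝓡∂ 2) F V) {x : M}
    (X : TangentSpace (𝓡∂ 2) x) (v : V x) : connectionDifference D₁ D₂ x X v =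
      D₁ (FiberBundle.extend F v) x X - D₂ (FiberBundle.extend F v) x X := by
  have := connectionDifference_apply D₁ D₂ (FiberBundle.mdifferentiableAt_extend (𝓡∂ 2) F v) X
  rwa [FiberBundle.extend_apply_self] at this

theorem connectionDifference_complexStructure (D₁ D₂ : 𝒥.Connection) {x : M}
    (X : TangentSpace (𝓡∂ 2) x) (v : V x) :
    connectionDifference D₁.cov D₂.cov x X (𝒥.J x v) =
      𝒥.J x (connectionDifference D₁.cov D₂.cov x X v) := by
  have hs := FiberBundle.mdifferentiableAt_extend (𝓡∂ 2) F v
  have hJ : MDifferentiableAt (𝓡∂ 2) ((𝓡∂ 2).prod 𝓘(ℝ, F))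
      (T% (fun z ↦ 𝒥.J z (FiberBundle.extend F v z))) x :=
    (𝒥.J_smooth.mdifferentiableAt (by simp)).clm_bundle_apply hs
  have h := connectionDifference_apply D₁.cov D₂.cov hJ X
  rw [D₁.complex_linear _ x X hs, D₂.complex_linear _ x X hs, FiberBundle.extend_apply_self] at h
  rw [h, connectionDifference_extend, map_sub]

theorem form_swap (P : BundlePair F V) (x : M) (v w : V x) : P.form x v w = - P.form x w v := by
  have h := P.form_alternating x (v + w)
  simp only [map_add, add_apply, P.form_alternating, zero_add, add_zero] at h
  linarith

/-- Subtract the two compatibility identities: the derivative of the hermitian product cancels. The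
imaginary part of what remains is the statement for the symplectic form. -/
theorem connectionDifference_skew {D₁ D₂ : 𝒥.Connection} {x : M} {X : TangentSpace (𝓡∂ 2) x}
    (h₁ : D₁.IsUnitaryInDirection x X) (h₂ : D₂.IsUnitaryInDirection x X) (v w : V x) :
    P.form x (connectionDifference D₁.cov D₂.cov x X v) w =
      - P.form x v (connectionDifference D₁.cov D₂.cov x X w) := by
  have hv := FiberBundle.mdifferentiableAt_extend (𝓡∂ 2) F v
  have hw := FiberBundle.mdifferentiableAt_extend (𝓡∂ 2) F w
  have h := congrArg Complex.im ((h₁ _ _ hv hw).symm.trans (h₂ _ _ hv hw))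
  simp only [CompatibleComplexStructure.hermitian, FiberBundle.extend_apply_self, Complex.add_im,
    Complex.ofReal_im, Complex.mul_im, Complex.I_re, Complex.I_im, Complex.ofReal_re, zero_mul,
    one_mul, zero_add] at h
  rw [connectionDifference_extend, connectionDifference_extend, map_sub, map_sub, sub_apply]
  linarith

theorem traceForm_eq_zero {D₁ D₂ : 𝒥.Connection} {x : M} {X : TangentSpace (𝓡∂ 2) x}
    (hx : x ∈ (𝓡∂ 2).boundary M)
    (h₁ : D₁.IsUnitaryInDirection x X) (h₂ : D₂.IsUnitaryInDirection x X)
    (hL : ∀ v ∈ P.L x, connectionDifference D₁.cov D₂.cov x X v ∈ P.L x) :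
    traceForm D₁ D₂ x X = 0 := by
  have : FiniteDimensional ℝ (V x) := VectorBundle.finiteDimensional ℝ F V x
  let B : LinearMap.BilinForm ℝ (V x) :=
    LinearMap.mk₂ ℝ (fun v w ↦ P.form x v w) (by intros; simp) (by intros; simp) (by intros; simp)
      (by intros; simp)
  have hB : B.Nondegenerate := by
    refine ⟨fun v hv ↦ P.form_nondegenerate x v hv, fun v hv ↦ P.form_nondegenerate x v fun w ↦ ?_⟩
    rw [form_swap, neg_eq_zero]
    exact hv w
  refine complexTrace_eq_zero_of_lagrangian hB (𝒥.J_sq x) (𝒥.pos x) (L := P.L x) (fun v ↦ ?_)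
    (connectionDifference_complexStructure D₁ D₂ X) (connectionDifference_skew h₁ h₂) hL
  rw [P.L_lagrangian x hx]
  refine forall₂_congr fun w _ ↦ ?_
  rw [form_swap, neg_eq_zero]
  rfl

end Unitary

/-- Picard-Lindelöf on the ball of radius `1` around `v`. A short interval is enough, since only the
derivative of parallel lifts at time `0` will be used. -/
theorem exists_hasDerivWithinAt_linear {F : Type*} [NormedAddCommGroup F] [NormedSpace ℝ F]
    [FiniteDimensional ℝ F] {Γ : ℝ → F →L[ℝ] F} {δ : ℝ} (hδ : 0 < δ)
    (hΓ : ContinuousOn Γ (Icc 0 δ)) (v : F) :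
    ∃ b ∈ Ioc 0 δ, ∃ c : ℝ → F, c 0 = v ∧
      ∀ t ∈ Icc 0 b, HasDerivWithinAt c (-(Γ t (c t))) (Icc 0 b) t := by
  have := FiniteDimensional.complete ℝ F
  obtain ⟨K, hK⟩ := isCompact_Icc.exists_bound_of_continuousOn hΓ
  have hK0 : 0 ≤ K := (norm_nonneg _).trans (hK 0 ⟨le_rfl, hδ.le⟩)
  lift K to NNReal using hK0
  -- `K (‖v‖ + 1)` bounds the velocity on the ball; the added `1` makes `C` positive. Times up to
  -- `C⁻¹` then keep the solution in the ball.
  set C : NNReal := K * (‖v‖₊ + 1) + 1 with hC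
  have hC0 : 0 < C := by positivity
  set b : ℝ := min δ (C : ℝ)⁻¹ with hb
  have hb0 : 0 < b := lt_min hδ (by positivity)
  have hbδ : b ≤ δ := min_le_left _ _
  have hp : IsPicardLindelof (fun t x ↦ -(Γ t x)) (⟨0, le_rfl, hb0.le⟩ : Icc 0 b) v 1 0 C K := by
    refine ⟨fun t ht ↦ ?_, fun x _ ↦ ?_, fun t ht x hx ↦ ?_, ?_⟩
    · refine (LipschitzWith.of_dist_le_mul fun x y ↦ ?_).lipschitzOnWith
      rw [dist_neg_neg, dist_eq_norm, ← map_sub, dist_eq_norm]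
      exact (Γ t).le_of_opNorm_le (hK t ⟨ht.1, ht.2.trans hbδ⟩) _
    · exact ((hΓ.mono (Icc_subset_Icc_right hbδ)).clm_apply continuousOn_const).neg
    · have hx' : ‖x‖ ≤ ‖v‖ + 1 := by
        have := norm_le_of_mem_closedBall hx
        simpa using this
      rw [norm_neg]
      calc ‖Γ t x‖ ≤ K * ‖x‖ := (Γ t).le_of_opNorm_le (hK t ⟨ht.1, ht.2.trans hbδ⟩) _
        _ ≤ K * (‖v‖ + 1) := by gcongr
        _ ≤ C := by simp [hC]
    · have : (C : ℝ) * b ≤ 1 := by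
        calc (C : ℝ) * b ≤ C * (C : ℝ)⁻¹ := by gcongr; exact min_le_right _ _
          _ = 1 := mul_inv_cancel₀ (by positivity)
      simpa [hb0.le] using this
  obtain ⟨c, hc0, hc⟩ := hp.exists_eq_forall_mem_Icc_hasDerivWithinAt₀
  exact ⟨b, ⟨hb0, hbδ⟩, c, hc0, hc⟩

/-! ### A coordinate curve inside the boundary -/

section BoundaryCurve

variable {M : Type*} [TopologicalSpace M] [ChartedSpace (EuclideanHalfSpace 2) M]

/-- The line through `x` parallel to the boundary, in the chart at `x`. -/
def boundaryLine (x : M) (t : ℝ) : ℝ² :=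
  extChartAt (𝓡∂ 2) x x + t • EuclideanSpace.single (1 : Fin 2) (1 : ℝ)

/-- The curve through `x`, parallel to the boundary in the chart at `x`. -/
def boundaryCurve (x : M) (t : ℝ) : M := (extChartAt (𝓡∂ 2) x).symm (boundaryLine x t)

theorem boundaryCurve_zero (x : M) : boundaryCurve x 0 = x := by
  rw [boundaryCurve, boundaryLine, zero_smul, add_zero]
  exact extChartAt_to_inv x

theorem hasDerivAt_boundaryLine (x : M) (t : ℝ) :
    HasDerivAt (boundaryLine x) (EuclideanSpace.single (1 : Fin 2) (1 : ℝ)) t := by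
  have := ((hasDerivAt_id t).smul_const
    (EuclideanSpace.single (1 : Fin 2) (1 : ℝ))).const_add (extChartAt (𝓡∂ 2) x x)
  rwa [one_smul] at this

theorem boundaryLine_apply_zero (x : M) (t : ℝ) :
    boundaryLine x t 0 = extChartAt (𝓡∂ 2) x x 0 := by
  simp only [boundaryLine, PiLp.add_apply, PiLp.smul_apply]
  simp

theorem boundaryLine_mem_range (x : M) (t : ℝ) : boundaryLine x t ∈ range (𝓡∂ 2) := by
  rw [mem_range_halfPlane, boundaryLine_apply_zero]
  exact mem_range_halfPlane.1 (extChartAt_target_subset_range x (mem_extChartAt_target x))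

variable [IsManifold (𝓡∂ 2) ∞ M]

theorem exists_boundaryLine_mem (x : M) {U : Set M} (hU : IsOpen U) (hxU : x ∈ U) :
    ∃ δ > 0, ∀ t ∈ Icc 0 δ, boundaryLine x t ∈ (extChartAt (𝓡∂ 2) x).target ∧
      boundaryCurve x t ∈ U := by
  have hten : Filter.Tendsto (boundaryLine x) (𝓝 0)
      (𝓝[range (𝓡∂ 2)] (extChartAt (𝓡∂ 2) x x)) := by
    refine tendsto_nhdsWithin_iff.2 ⟨?_, Filter.Eventually.of_forall (boundaryLine_mem_range x)⟩
    have := (hasDerivAt_boundaryLine x 0).continuousAt.tendsto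
    simpa [boundaryLine] using this
  have h1 : ∀ᶠ p in 𝓝[range (𝓡∂ 2)] (extChartAt (𝓡∂ 2) x x),
      p ∈ (extChartAt (𝓡∂ 2) x).target ∧ (extChartAt (𝓡∂ 2) x).symm p ∈ U := by
    refine Filter.Eventually.and (extChartAt_target_mem_nhdsWithin x) ?_
    refine ((continuousAt_extChartAt_symm x).tendsto.mono_left nhdsWithin_le_nhds) ?_
    rw [extChartAt_to_inv]
    exact hU.mem_nhds hxU
  obtain ⟨ε, hε, h2⟩ := Metric.eventually_nhds_iff_ball.1 (hten.eventually h1)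
  refine ⟨ε / 2, by positivity, fun t ht ↦ h2 t ?_⟩
  rw [Metric.mem_ball, dist_zero_right, Real.norm_of_nonneg ht.1]
  linarith [ht.2]

variable {x : M} {b t : ℝ}

theorem boundaryCurve_mem_source (ht : boundaryLine x t ∈ (extChartAt (𝓡∂ 2) x).target) :
    boundaryCurve x t ∈ (extChartAt (𝓡∂ 2) x).source :=
  (extChartAt (𝓡∂ 2) x).map_target ht

theorem boundaryCurve_mem_boundary (hx : x ∈ (𝓡∂ 2).boundary M)
    (ht : boundaryLine x t ∈ (extChartAt (𝓡∂ 2) x).target) :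
    boundaryCurve x t ∈ (𝓡∂ 2).boundary M := by
  rw [mem_boundary_iff_extChartAt (boundaryCurve_mem_source ht), boundaryCurve,
    (extChartAt (𝓡∂ 2) x).right_inv ht, boundaryLine_apply_zero]
  exact (mem_boundary_iff_extChartAt (mem_extChartAt_source x)).1 hx

theorem contMDiffOn_boundaryCurve
    (hb : ∀ t ∈ Icc 0 b, boundaryLine x t ∈ (extChartAt (𝓡∂ 2) x).target) :
    ContMDiffOn 𝓘(ℝ, ℝ) (𝓡∂ 2) ∞ (boundaryCurve x) (Icc 0 b) := by
  have h : ContDiff ℝ ∞ (boundaryLine x) := contDiff_const.add (contDiff_id.smul contDiff_const)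
  exact (contMDiffOn_extChartAt_symm x).comp h.contMDiff.contMDiffOn hb

theorem mfderivWithin_boundaryCurve (hb0 : 0 < b)
    (hb : ∀ t ∈ Icc 0 b, boundaryLine x t ∈ (extChartAt (𝓡∂ 2) x).target) (ht : t ∈ Icc 0 b) :
    mfderivWithin 𝓘(ℝ, ℝ) (𝓡∂ 2) (boundaryCurve x) (Icc 0 b) t (1 : ℝ) =
      coordField x 1 (boundaryCurve x t) := by
  have h1 : MDifferentiableWithinAt 𝓘(ℝ, ℝ²) (𝓡∂ 2) (extChartAt (𝓡∂ 2) x).symm (range (𝓡∂ 2))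
      (boundaryLine x t) := mdifferentiableWithinAt_extChartAt_symm (hb t ht)
  have hu : UniqueMDiffWithinAt 𝓘(ℝ, ℝ) (Icc 0 b) t :=
    (uniqueDiffOn_Icc hb0 t ht).uniqueMDiffWithinAt
  have h2 := mfderivWithin_comp t h1
    (hasDerivAt_boundaryLine x t).differentiableAt.differentiableWithinAt.mdifferentiableWithinAt
    (fun s _ ↦ boundaryLine_mem_range x s) hu
  have h3 : mfderivWithin 𝓘(ℝ, ℝ) 𝓘(ℝ, ℝ²) (boundaryLine x) (Icc 0 b) t (1 : ℝ) =
      (EuclideanSpace.single (1 : Fin 2) (1 : ℝ) : ℝ²) := by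
    rw [mfderivWithin_eq_fderivWithin]
    exact (hasDerivAt_boundaryLine x t).hasDerivWithinAt.derivWithin (uniqueDiffOn_Icc hb0 t ht)
  rw [coordField_eq_mfderivWithin (boundaryCurve_mem_source (hb t ht))]
  refine (congrArg (fun L ↦ L (1 : ℝ)) h2).trans ?_
  refine (congrArg _ h3).trans ?_
  rw [boundaryCurve, (extChartAt (𝓡∂ 2) x).right_inv (hb t ht)]
  rfl

theorem hasDerivWithinAt_comp_boundaryCurve {G : Type*} [NormedAddCommGroup G] [NormedSpace ℝ G]
    (hb : ∀ t ∈ Icc 0 b, boundaryLine x t ∈ (extChartAt (𝓡∂ 2) x).target) (ht : t ∈ Icc 0 b)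
    {f : M → G} (hf : MDifferentiableAt (𝓡∂ 2) 𝓘(ℝ, G) f (boundaryCurve x t)) :
    HasDerivWithinAt (fun u ↦ f (boundaryCurve x u))
      (mvfderiv (𝓡∂ 2) f (boundaryCurve x t) (coordField x 1 (boundaryCurve x t))) (Icc 0 b) t := by
  have h1 : MDifferentiableWithinAt 𝓘(ℝ, ℝ²) (𝓡∂ 2) (extChartAt (𝓡∂ 2) x).symm (range (𝓡∂ 2))
      (boundaryLine x t) := mdifferentiableWithinAt_extChartAt_symm (hb t ht)
  have h2 : DifferentiableWithinAt ℝ (f ∘ (extChartAt (𝓡∂ 2) x).symm) (range (𝓡∂ 2))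
      (boundaryLine x t) :=
    (MDifferentiableAt.comp_mdifferentiableWithinAt (boundaryLine x t) hf h1).differentiableWithinAt
  rw [mvfderiv_coordField (boundaryCurve_mem_source (hb t ht)) 1 hf, boundaryCurve,
    (extChartAt (𝓡∂ 2) x).right_inv (hb t ht)]
  exact h2.hasFDerivWithinAt.comp_hasDerivWithinAt t (hasDerivAt_boundaryLine x t).hasDerivWithinAt
    fun s _ ↦ boundaryLine_mem_range x s

end BoundaryCurve

/-! ### Parallel sections along the boundary curve -/

section Parallel

variable {M : Type*} [TopologicalSpace M] [ChartedSpace (EuclideanHalfSpace 2) M]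
  [IsManifold (𝓡∂ 2) ∞ M]
  {F : Type*} [NormedAddCommGroup F] [NormedSpace ℝ F]
  {V : M → Type*} [TopologicalSpace (TotalSpace F V)]
  [∀ x, AddCommGroup (V x)] [∀ x, Module ℝ (V x)] [∀ x, TopologicalSpace (V x)]
  [∀ x, IsTopologicalAddGroup (V x)] [∀ x, ContinuousSMul ℝ (V x)]
  [FiberBundle F V] [VectorBundle ℝ F V] [ContMDiffVectorBundle ∞ F V (𝓡∂ 2)]
  [FiniteDimensional ℝ F]

/-- The transition matrix from the preferred trivialization at `x` to the one at `y`. -/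
def transitionMatrix (V : M → Type*) [TopologicalSpace (TotalSpace F V)]
    [∀ x, AddCommGroup (V x)] [∀ x, Module ℝ (V x)] [∀ x, TopologicalSpace (V x)]
    [FiberBundle F V] (x y z : M) : F →L[ℝ] F :=
  frameMatrix y fun v ↦ frameSection V x v z

theorem transitionMatrix_apply {x y z : M} (hx : z ∈ frameDomain F V x)
    (hy : z ∈ frameDomain F V y) (v : F) :
    transitionMatrix (F := F) V x y z v = frameCoord F y (frameSection V x v z) := by
  rw [transitionMatrix, frameMatrix_apply]
  simp only [← frameEquiv_symm_apply hx, ← frameEquiv_apply hy, ← map_smul, ← map_sum]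
  rw [(Module.finBasis ℝ F).sum_repr v]

theorem mdifferentiableAt_transitionMatrix {x y z : M} (hx : z ∈ frameDomain F V x)
    (hy : z ∈ frameDomain F V y) :
    MDifferentiableAt (𝓡∂ 2) 𝓘(ℝ, F →L[ℝ] F) (transitionMatrix (F := F) V x y) z := by
  have hU := (isOpen_frameDomain (F := F) (V := V) x).inter (isOpen_frameDomain (F := F) (V := V) y)
  have h := contMDiffOn_frameMatrix (x₀ := y) hU inter_subset_right
    (T := fun z v ↦ frameSection V x v z) fun v ↦
    (contMDiffOn_frameSection x v).mono inter_subset_left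
  exact (h.contMDiffAt (hU.mem_nhds ⟨hx, hy⟩)).mdifferentiableAt (by simp)

/-- The gauge transformation law `g Γ_x = dg + Γ_y g`. It is needed because `IsParallelAlong` is
tested at each time in the trivialization at the current point, while the differential equation is
solved in the fixed frame at `x`. -/
theorem transitionMatrix_connectionMatrix (D : CovariantDerivative (𝓡∂ 2) F V) {x y z : M}
    (hx : z ∈ frameDomain F V x) (hy : z ∈ frameDomain F V y) (X : TangentSpace (𝓡∂ 2) z) (v : F) :
    transitionMatrix (F := F) V x y z (connectionMatrix D x z X v) =
      mvfderiv (𝓡∂ 2) (transitionMatrix (F := F) V x y) z X v +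
        connectionMatrix D y z X (transitionMatrix (F := F) V x y z v) := by
  have h := frameCoord_cov D hy (mdifferentiableAt_frameSection hx v) X
  have hev : (fun w ↦ frameCoord F y (frameSection V x v w)) =ᶠ[𝓝 z]
      fun w ↦ ContinuousLinearMap.apply ℝ F v (transitionMatrix (F := F) V x y w) := by
    filter_upwards [(isOpen_frameDomain x).mem_nhds hx, (isOpen_frameDomain y).mem_nhds hy]
      with w hw hw'
    exact (transitionMatrix_apply hw hw' v).symm
  rw [mvfderiv_congr_apply hev, mvfderiv_clm_comp _ (mdifferentiableAt_transitionMatrix hx hy),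
    ← transitionMatrix_apply hx hy] at h
  rw [connectionMatrix_apply D hx, transitionMatrix_apply hx hy, frameSection_frameCoord hx, h]
  rfl

variable [T2Space M] {x : M} {b : ℝ}

theorem isParallelAlong_boundaryCurve (D : SmoothConnection F V) (hb0 : 0 < b)
    (hb : ∀ t ∈ Icc 0 b, boundaryLine x t ∈ (extChartAt (𝓡∂ 2) x).target)
    (hbF : ∀ t ∈ Icc 0 b, boundaryCurve x t ∈ frameDomain F V x) {c : ℝ → F}
    (hc : ∀ t ∈ Icc 0 b, HasDerivWithinAt c (-(connectionMatrix D.cov x (boundaryCurve x t)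
      (coordField x 1 (boundaryCurve x t)) (c t))) (Icc 0 b) t) :
    D.IsParallelAlong (boundaryCurve x) 0 b fun t ↦ frameSection V x (c t) (boundaryCurve x t) := by
  intro t ht
  have hyx := hbF t ht
  have hyy := mem_frameDomain_self (F := F) (V := V) (boundaryCurve x t)
  have hg := hasDerivWithinAt_comp_boundaryCurve hb ht (mdifferentiableAt_transitionMatrix hyx hyy)
  -- In the frame at the current point the section has coordinates `g c`, with derivative `g' c + g
  -- c'`. Since `c' = -Γ_x c`, the transformation law makes this cancel with `Γ_y g c`.
  refine ⟨_, (hg.clm_apply (hc t ht)).congr_of_eventuallyEq_of_mem ?_ ht, ?_⟩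
  · have hcont := (contMDiffOn_boundaryCurve hb).continuousOn t ht
    filter_upwards [hcont ((isOpen_frameDomain (F := F) (V := V) _).mem_nhds hyy),
      self_mem_nhdsWithin] with u hu hu'
    exact (transitionMatrix_apply (hbF u hu') hu (c u)).symm
  · rw [mfderivWithin_boundaryCurve hb0 hb ht, extend_eq_frameSection]
    refine (frameEquiv hyy).injective ?_
    rw [map_add, map_zero, frameEquiv_apply, frameEquiv_apply, ← connectionMatrix_apply D.cov hyy,
      ← transitionMatrix_apply hyx hyy, map_neg, transitionMatrix_connectionMatrix D.cov hyx hyy]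
    erw [frameCoord_frameSection hyy]
    abel

end Parallel

/-! ### The difference of two connections preserves `L` on the boundary -/

section Lagrangian

variable {M : Type*} [TopologicalSpace M] [ChartedSpace (EuclideanHalfSpace 2) M]
  [IsManifold (𝓡∂ 2) ∞ M]
  {F : Type*} [NormedAddCommGroup F] [NormedSpace ℝ F]
  {V : M → Type*} [TopologicalSpace (TotalSpace F V)]
  [∀ x, AddCommGroup (V x)] [∀ x, Module ℝ (V x)] [∀ x, TopologicalSpace (V x)]
  [∀ x, IsTopologicalAddGroup (V x)] [∀ x, ContinuousSMul ℝ (V x)]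
  [FiberBundle F V] [VectorBundle ℝ F V] [ContMDiffVectorBundle ∞ F V (𝓡∂ 2)]
  [FiniteDimensional ℝ F] [T2Space M] {P : BundlePair F V}

/-- Solve the parallel transport equation along the boundary curve. The hypothesis on `L` concerns
endpoints only, so it is applied to `[0, t]` for every small `t`. -/
theorem exists_parallel_lift {D : SmoothConnection F V} {L : Π x : M, Submodule ℝ (V x)}
    (hD : D.PreservesAlongBoundary L) {x : M} (hx : x ∈ (𝓡∂ 2).boundary M) {v : V x}
    (hv : v ∈ L x) : ∃ c : ℝ → F, c 0 = frameCoord F x v ∧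
      HasDerivWithinAt c (-(connectionMatrix D.cov x x (coordField x 1 x) (frameCoord F x v)))
        (Ioi 0) 0 ∧
      ∀ᶠ t in 𝓝[>] (0 : ℝ), frameSection V x (c t) (boundaryCurve x t) ∈ L (boundaryCurve x t) := by
  obtain ⟨δ, hδ, hmem⟩ := exists_boundaryLine_mem x (isOpen_frameDomain (F := F) (V := V) x)
    (mem_frameDomain_self x)
  have hΓ : ContinuousOn (fun t ↦ connectionMatrix D.cov x (boundaryCurve x t)
      (coordField x 1 (boundaryCurve x t))) (Icc 0 δ) :=
    (contMDiffOn_connectionMatrix D x x 1).continuousOn.comp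
      (contMDiffOn_boundaryCurve fun t ht ↦ (hmem t ht).1).continuousOn
      fun t ht ↦ ⟨boundaryCurve_mem_source (hmem t ht).1, (hmem t ht).2⟩
  obtain ⟨b, hb, c, hc0, hc⟩ := exists_hasDerivWithinAt_linear hδ hΓ (frameCoord F x v)
  refine ⟨c, hc0, ?_, ?_⟩
  · have h0 := hc 0 ⟨le_rfl, hb.1.le⟩
    rw [hc0, boundaryCurve_zero] at h0
    exact h0.mono_of_mem_nhdsWithin (Filter.mem_of_superset (Ioc_mem_nhdsGT hb.1) Ioc_subset_Icc_self)
  · filter_upwards [Ioc_mem_nhdsGT hb.1] with t ht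
    have hsub : Icc 0 t ⊆ Icc 0 b := Icc_subset_Icc_right ht.2
    have hsub' : Icc 0 t ⊆ Icc 0 δ := hsub.trans (Icc_subset_Icc_right hb.2)
    have hpar := isParallelAlong_boundaryCurve D ht.1 (fun s hs ↦ (hmem s (hsub' hs)).1)
      (fun s hs ↦ (hmem s (hsub' hs)).2) fun s hs ↦ (hc s (hsub hs)).mono hsub
    refine hD _ 0 t ht.1 (contMDiffOn_boundaryCurve fun s hs ↦ (hmem s (hsub' hs)).1)
      (fun s hs ↦ boundaryCurve_mem_boundary hx (hmem s (hsub' hs)).1) _ hpar ?_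
    show frameSection V x (c 0) (boundaryCurve x 0) ∈ L (boundaryCurve x 0)
    rw [boundaryCurve_zero, hc0, frameSection_frameCoord (mem_frameDomain_self x)]
    exact hv

theorem continuousOn_form_frameSection (P : BundlePair F V) (x : M) (a b : F) :
    ContinuousOn (fun z ↦ P.form z (frameSection V x a z) (frameSection V x b z))
      (frameDomain F V x) := by
  have h : ContMDiffOn (𝓡∂ 2) ((𝓡∂ 2).prod 𝓘(ℝ, ℝ)) ∞
      (fun z ↦ TotalSpace.mk' ℝ (E := Bundle.Trivial M ℝ) z
        (P.form z (frameSection V x a z) (frameSection V x b z))) (frameDomain F V x) := by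
    apply ContMDiffOn.clm_bundle_apply₂ (F₁ := F) (F₂ := F)
    · exact P.form_smooth.contMDiffOn
    · exact contMDiffOn_frameSection x a
    · exact contMDiffOn_frameSection x b
  intro z hz
  have := h z hz
  simp only [contMDiffWithinAt_totalSpace] at this
  exact this.2.continuousWithinAt

theorem form_frameSection (P : BundlePair F V) {x z : M} (hz : z ∈ frameDomain F V x) (a b : F) :
    P.form z (frameSection V x a z) (frameSection V x b z) =
      ∑ i, ∑ j, (Module.finBasis ℝ F).repr a i * ((Module.finBasis ℝ F).repr b j *
        P.form z (frameSection V x (Module.finBasis ℝ F i) z)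
          (frameSection V x (Module.finBasis ℝ F j) z)) := by
  have h : ∀ a : F, frameSection V x a z = ∑ i, (Module.finBasis ℝ F).repr a i •
      frameSection V x (Module.finBasis ℝ F i) z := by
    intro a
    simp only [← frameEquiv_symm_apply hz, ← map_smul, ← map_sum]
    rw [(Module.finBasis ℝ F).sum_repr a]
  conv_lhs => rw [h a, h b]
  simp only [map_sum, map_smul, sum_apply, smul_apply, smul_eq_mul, Finset.mul_sum]
  rw [Finset.sum_comm]
  exact Finset.sum_congr rfl fun i _ ↦ Finset.sum_congr rfl fun j _ ↦ by ring

/-- Expansion in a basis reduces joint continuity to that of the finitely many coefficients of the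
form in the frame. -/
theorem tendsto_form_frameSection (P : BundlePair F V) {x : M} {ι : Type*} {l : Filter ι}
    {z : ι → M} (hz : Filter.Tendsto z l (𝓝 x)) {a b : ι → F} {a₀ b₀ : F}
    (ha : Filter.Tendsto a l (𝓝 a₀)) (hb : Filter.Tendsto b l (𝓝 b₀)) :
    Filter.Tendsto (fun i ↦ P.form (z i) (frameSection V x (a i) (z i))
      (frameSection V x (b i) (z i))) l
      (𝓝 (P.form x (frameSection V x a₀ x) (frameSection V x b₀ x))) := by
  have hU := (isOpen_frameDomain (F := F) (V := V) x).mem_nhds (mem_frameDomain_self x)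
  rw [form_frameSection P (mem_frameDomain_self x)]
  have hrepr : ∀ i, Continuous fun v ↦ (Module.finBasis ℝ F).repr v i := fun i ↦
    (LinearMap.toContinuousLinearMap ((Module.finBasis ℝ F).coord i)).continuous
  have hlim := tendsto_finsetSum Finset.univ fun i _ ↦ tendsto_finsetSum Finset.univ fun j _ ↦
    (((hrepr i).tendsto a₀).comp ha).mul ((((hrepr j).tendsto b₀).comp hb).mul
      ((((continuousOn_form_frameSection P x (Module.finBasis ℝ F i)
        (Module.finBasis ℝ F j)).continuousAt hU).tendsto).comp hz))
  refine hlim.congr' ?_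
  filter_upwards [hz hU] with i hi
  rw [form_frameSection P hi]
  rfl

/-- Transport `v` along the boundary curve by both connections. The two lifts stay in `L`, hence so
does their difference quotient, whose limit at `0` is `-A v` by the parallel transport equations. To
pass to the limit in the moving subspaces, membership in `L` is expressed as the vanishing of the
symplectic form against elements of `L`. -/
theorem connectionDifference_mem_lagrangian {D₁ D₂ : SmoothConnection F V}
    (h₁ : D₁.PreservesAlongBoundary P.L) (h₂ : D₂.PreservesAlongBoundary P.L) {x : M}
    (hx : x ∈ (𝓡∂ 2).boundary M) {v : V x} (hv : v ∈ P.L x) :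
    connectionDifference D₁.cov D₂.cov x (coordField x 1 x) v ∈ P.L x := by
  have hxf := mem_frameDomain_self (F := F) (V := V) x
  rw [P.L_lagrangian x hx]
  intro w hw
  obtain ⟨c₁, hc₁, hd₁, hm₁⟩ := exists_parallel_lift h₁ hx hv
  obtain ⟨c₂, hc₂, hd₂, hm₂⟩ := exists_parallel_lift h₂ hx hv
  -- This lift serves only to extend `w` to vectors of `L` along the curve, depending continuously
  -- on the time at `0`.
  obtain ⟨u, hu, hdu, hmu⟩ := exists_parallel_lift h₁ hx hw
  obtain ⟨δ, hδ, hmem⟩ := exists_boundaryLine_mem x (isOpen_frameDomain (F := F) (V := V) x) hxf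
  have hslope := (hasDerivWithinAt_iff_tendsto_slope' self_notMem_Ioi).1 (hd₁.sub hd₂)
  have hγ : Filter.Tendsto (boundaryCurve x) (𝓝[>] 0) (𝓝 x) := by
    have h := (contMDiffOn_boundaryCurve fun t ht ↦ (hmem t ht).1).continuousOn 0 ⟨le_rfl, hδ.le⟩
    rw [ContinuousWithinAt, boundaryCurve_zero] at h
    exact h.mono_left (nhdsWithin_le_of_mem
      (Filter.mem_of_superset (Ioc_mem_nhdsGT hδ) Ioc_subset_Icc_self))
  have hu' : Filter.Tendsto u (𝓝[>] 0) (𝓝 (frameCoord F x w)) := by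
    rw [← hu]
    exact hdu.continuousWithinAt
  have hlim := tendsto_form_frameSection P hγ hslope hu'
  have hzero : ∀ᶠ t in 𝓝[>] (0 : ℝ), P.form (boundaryCurve x t)
      (frameSection V x (slope (c₁ - c₂) 0 t) (boundaryCurve x t))
      (frameSection V x (u t) (boundaryCurve x t)) = 0 := by
    filter_upwards [hm₁, hm₂, hmu, Ioc_mem_nhdsGT hδ] with t ht₁ ht₂ htu ht
    have hmt := hmem t (Ioc_subset_Icc_self ht)
    have hs : slope (c₁ - c₂) 0 t = t⁻¹ • (c₁ t - c₂ t) := by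
      rw [slope_def_module, Pi.sub_apply, Pi.sub_apply, hc₁, hc₂, sub_self, sub_zero, sub_zero]
    refine (P.L_lagrangian _ (boundaryCurve_mem_boundary hx hmt.1) _).1 ?_ _ htu
    rw [hs, ← frameEquiv_symm_apply hmt.2, map_smul, map_sub, frameEquiv_symm_apply,
      frameEquiv_symm_apply]
    exact Submodule.smul_mem _ _ (Submodule.sub_mem _ ht₁ ht₂)
  have h0 := tendsto_nhds_unique (hlim.congr' hzero) tendsto_const_nhds
  have hA : frameSection V x (-(connectionMatrix D₁.cov x x (coordField x 1 x) (frameCoord F x v)) -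
      -(connectionMatrix D₂.cov x x (coordField x 1 x) (frameCoord F x v))) x =
      - connectionDifference D₁.cov D₂.cov x (coordField x 1 x) v := by
    rw [neg_sub_neg, ← neg_sub, ← sub_apply, ← frameCoord_connectionDifference _ _ hxf,
      ← frameEquiv_symm_apply hxf, map_neg, frameEquiv_symm_apply, frameSection_frameCoord hxf]
  rw [hA, frameSection_frameCoord hxf, map_neg, neg_apply, neg_eq_zero] at h0
  exact h0

/-- The tangent line of the boundary is spanned by the velocity of the boundary curve, so that
single direction suffices. -/
theorem traceForm_eq_zero_of_boundaryTangent {𝒥 : CompatibleComplexStructure P}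
    {D₁ D₂ : 𝒥.Connection} (h₁ : D₁.RestrictsToLOrthogonalUnitary)
    (h₂ : D₂.RestrictsToLOrthogonalUnitary) {x : M} (hx : x ∈ (𝓡∂ 2).boundary M)
    {X : TangentSpace (𝓡∂ 2) x} (hX : X ∈ boundaryTangent x) : traceForm D₁ D₂ x X = 0 := by
  have hc := coordField_mem_boundaryTangent (mem_extChartAt_source (I := 𝓡∂ 2) x) hx
  have hXc : X = (show ℝ² from X) 1 • coordField x 1 x := by
    rw [coordField_self]
    have hX0 : (show ℝ² from X) 0 = 0 := hX
    change (show ℝ² from X) = (show ℝ² from X) 1 • (EuclideanSpace.single 1 (1 : ℝ) : ℝ²)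
    ext i
    fin_cases i
    · simpa using hX0
    · simp
  rw [hXc, map_smul, traceForm_eq_zero hx (h₁.1 x hx _ hc) (h₂.1 x hx _ hc)
    fun v hv ↦ connectionDifference_mem_lagrangian h₁.2 h₂.2 hx hv, smul_zero]

end Lagrangian

/-! ### Independence of the connection -/

section Main

variable {M : Type*} [TopologicalSpace M] [ChartedSpace (EuclideanHalfSpace 2) M]
  [IsRiemannSurface M] [T2Space M] [CompactSpace M]
  {F : Type*} [NormedAddCommGroup F] [NormedSpace ℝ F] [FiniteDimensional ℝ F]
  {V : M → Type*} [TopologicalSpace (TotalSpace F V)]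
  [∀ x, AddCommGroup (V x)] [∀ x, Module ℝ (V x)] [∀ x, TopologicalSpace (V x)]
  [∀ x, IsTopologicalAddGroup (V x)] [∀ x, ContinuousSMul ℝ (V x)]
  [FiberBundle F V] [VectorBundle ℝ F V] [ContMDiffVectorBundle ∞ F V (𝓡∂ 2)]
  {P : BundlePair F V} {𝒥 : CompatibleComplexStructure P}

theorem integrableOn_trCurvature (D : 𝒥.Connection) (c : M) :
    IntegrableOn (fun p ↦ (chartPartition (M := M) c ((extChartAt (𝓡∂ 2) c).symm p) : ℂ) *
      D.trCurvature ((extChartAt (𝓡∂ 2) c).symm p) (coordVec c p 0) (coordVec c p 1))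
      (extChartAt (𝓡∂ 2) c).target := by
  have hsymm := continuousOn_extChartAt_symm (I := 𝓡∂ 2) c
  have hmaps : MapsTo (extChartAt (𝓡∂ 2) c).symm (extChartAt (𝓡∂ 2) c).target
      (extChartAt (𝓡∂ 2) c).source := fun p hp ↦ (extChartAt (𝓡∂ 2) c).map_target hp
  refine integrableOn_of_continuousOn_of_support (measurableSet_extChartAt_target c)
    (isCompact_chartSupport c) (chartSupport_subset_target c) ?_ fun p hp ↦ ?_
  · have h1 := (contMDiffOn_trCurvature D c).continuousOn.comp hsymm hmaps
    have h2 := (Complex.continuous_ofReal.comp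
      (chartPartition (M := M) c).contMDiff.continuous).comp_continuousOn hsymm
    refine (h2.mul h1).congr fun p hp ↦ ?_
    rw [coordVec_eq_coordField hp, coordVec_eq_coordField hp]
    rfl
  · rw [show chartPartition (M := M) c ((extChartAt (𝓡∂ 2) c).symm p) = 0 from
      image_eq_zero_of_notMem_tsupport (notMem_tsupport_of_notMem_chartSupport hp),
      Complex.ofReal_zero, zero_mul]

theorem surfaceIntegral_trCurvature_eq {D₁ D₂ : 𝒥.Connection}
    (h₁ : D₁.RestrictsToLOrthogonalUnitary) (h₂ : D₂.RestrictsToLOrthogonalUnitary) :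
    surfaceIntegral D₁.trCurvature = surfaceIntegral D₂.trCurvature := by
  have h0 := surfaceIntegral_eq_zero_of_exact (contMDiffOn_traceForm D₁ D₂)
    (fun x hx X hX ↦ traceForm_eq_zero_of_boundaryTangent h₁ h₂ hx hX)
    (α := fun x X Y ↦ D₁.trCurvature x X Y - D₂.trCurvature x X Y)
    fun c y hy ↦ trCurvature_sub D₁ D₂ hy
  obtain ⟨S, hS0, -⟩ := exists_finset_chartPartition (M := M)
  rw [surfaceIntegral_eq_sum hS0] at h0 ⊢
  rw [surfaceIntegral_eq_sum hS0, ← sub_eq_zero, ← Finset.sum_sub_distrib, ← h0]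
  refine Finset.sum_congr rfl fun c _ ↦ ?_
  rw [← integral_sub (integrableOn_trCurvature D₁ c) (integrableOn_trCurvature D₂ c)]
  simp only [mul_sub]

end Main

end

end MaslovCW

theorem mainTheorem5
    {M : Type*} [TopologicalSpace M] [T2Space M] [CompactSpace M]
    [ChartedSpace (EuclideanHalfSpace 2) M] [MaslovCW.IsRiemannSurface M]
    {F : Type*} [NormedAddCommGroup F] [NormedSpace ℝ F] [FiniteDimensional ℝ F]
    {V : M → Type*} [TopologicalSpace (TotalSpace F V)]
    [∀ x, AddCommGroup (V x)] [∀ x, Module ℝ (V x)] [∀ x, TopologicalSpace (V x)]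
    [∀ x, IsTopologicalAddGroup (V x)] [∀ x, ContinuousSMul ℝ (V x)]
    [FiberBundle F V] [VectorBundle ℝ F V] [ContMDiffVectorBundle ∞ F V (𝓡∂ 2)]
    (P : MaslovCW.BundlePair F V) (𝒥 : MaslovCW.CompatibleComplexStructure P) :
    (∀ D₁ D₂ : 𝒥.Connection, D₁.IsLOrthogonalUnitary → D₂.IsLOrthogonalUnitary →
      MaslovCW.surfaceIntegral D₁.trCurvature = MaslovCW.surfaceIntegral D₂.trCurvature) ∧
    ∃ μ : ℂ, ∀ D : 𝒥.Connection, D.RestrictsToLOrthogonalUnitary →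
      Complex.I / (Real.pi : ℂ) * MaslovCW.surfaceIntegral D.trCurvature = μ := by
  refine ⟨fun D₁ D₂ h₁ h₂ ↦ MaslovCW.surfaceIntegral_trCurvature_eq
    ⟨fun x _ X _ ↦ h₁.1 x X, h₁.2⟩ ⟨fun x _ X _ ↦ h₂.1 x X, h₂.2⟩, ?_⟩
  -- If an admissible connection exists, its value serves as `μ`. Otherwise the condition on `μ` is
  -- empty and `0` is a default value.
  by_cases h : ∃ D : 𝒥.Connection, D.RestrictsToLOrthogonalUnitary
  · obtain ⟨D₀, hD₀⟩ := h
    exact ⟨_, fun D hD ↦ by rw [MaslovCW.surfaceIntegral_trCurvature_eq hD hD₀]⟩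
  · exact ⟨0, fun D hD ↦ (h ⟨D, hD⟩).elim⟩
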